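/- Let $D$ be a finite set. A $t$-ary operation $D^t\to D$ acts coordinatewise on vectors of $D^n$. For a set $\mathcal F$ of operations on $D$ and $\mathcal S\subseteq D^n$, let $Cl_{\mathcal F}(\mathcal S)$ be the smallest subset of $D^n$ that contains $\mathcal S$ and is closed under the operations of $\mathcal F$. Let $\langle\mathcal F\rangle$ be the clone generated by $\mathcal F$, that is, the set of all operations obtained by composition from the operations of $\mathcal F$ and the projections. An operation $f$ of arity $k$ is a near unanimity operation if $f(y_1,\dots,y_k)=x$ whenever at most one of the $y_i$ is different from $x$. $\textsc{Closure}_{\mathcal F}$ is the decision problem: given finitely many vectors forming a set $\mathcal S\subseteq D^n$ and a vector $v\in D^n$, is $v\in Cl_{\mathcal F}(\mathcal S)$? $\textsc{EnumClosure}_{\mathcal F}$ is the enumeration problem: given finitely many vectors forming a set $\mathcal S\subseteq D^n$, output every element of $Cl_{\mathcal F}(\mathcal S)$, each exactly once. ($\mathcal F$ is fixed; $n$ and $\mathcal S$ are part of the input.) The size of an instance with $m$ vectors in $D^n$ is $(n+1)(m+1)$. The computational model is the random access machine with addition, subtraction and multiplication, an OUTPUT instruction that outputs the contents of the output registers, and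 unit cost per instruction, whose registers always hold numbers bounded by a polynomial in the size of the instance. (In this model, the problems decidable in polynomially many steps are those of the usual class $\mathrm P$.) An algorithm has delay $\delta(n)$ if, after a precomputation whose time is polynomial in the size of the instance, it makes at most $\delta(n)$ steps between two consecutive outputs and between the last output and its stop. **Theorem.** Let $\mathcal F$ be any set of operations on the finite set $D$ such that $\langle\mathcal F\rangle$ contains a near unanimity operation of arity $k$ (for instance, such that $\mathcal F$ itself contains one). Then 1. $\textsc{Closure}_{\mathcal F}\in\mathrm P$; 2. $\textsc{EnumClosure}_{\mathcal F}$ can be solved with delay $O(n^{k-1})$, where $n$ is the size of the vectors and the implied constant does not depend on the number of vectors. -/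

import Mathlib

open scoped Asymptotics

/-! ## Operations, clones, closures -/

/-- A finitary operation on `D`: an arity `t` together with a function `D ^ t → D`. -/
abbrev Operation (D : Type*) := Σ t : ℕ, ((Fin t → D) → D)

/-- Operations obtained by composition from the operations of `F` and the projections. -/
inductive InClone {D : Type*} (F : Set (Operation D)) : (t : ℕ) → ((Fin t → D) → D) → Prop
  | base {t : ℕ} (f : (Fin t → D) → D) : (⟨t, f⟩ : Operation D) ∈ F → InClone F t f
  | proj {t : ℕ} (i : Fin t) : InClone F t (fun x => x i)
  | comp {s t : ℕ} (f : (Fin s → D) → D) (g : Fin s → (Fin t → D) → D) :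
      InClone F s f → (∀ i, InClone F t (g i)) → InClone F t (fun x => f (fun i => g i x))

/-- The functional clone generated by `F`. -/
def cloneOf {D : Type*} (F : Set (Operation D)) : Set (Operation D) :=
  {o | InClone F o.1 o.2}

/-- `f` is a near unanimity operation: `f y = x` as soon as at most one entry of `y` differs
from `x`. -/
def IsNearUnanimity {D : Type*} {k : ℕ} (f : (Fin k → D) → D) : Prop :=
  ∀ (x : D) (y : Fin k → D), {j | y j ≠ x}.Subsingleton → f y = x

/-- `Cl_F(S)`: the smallest set of vectors of size `n` that contains `S` and is closed under the
operations of `F` acting coordinatewise. -/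
inductive Cl {D : Type*} (F : Set (Operation D)) {n : ℕ} (S : Set (Fin n → D)) :
    (Fin n → D) → Prop
  | mem (v : Fin n → D) : v ∈ S → Cl F S v
  | app (o : Operation D) (v : Fin o.1 → Fin n → D) :
      o ∈ F → (∀ i, Cl F S (v i)) → Cl F S (fun j => o.2 (fun i => v i j))

/-! ## Random access machines -/

/-- Instructions. Arguments `r a b` are register numbers, `l` is a program line. -/
inductive RAMInstr where
  /-- `R[r] := c` -/
  | const (r c : ℕ)
  /-- `R[r] := R[a] + R[b]` -/
  | add (r a b : ℕ)
  /-- `R[r] := R[a] - R[b]`, or `0` if `R[a] < R[b]` -/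
  | sub (r a b : ℕ)
  /-- `R[r] := R[a] * R[b]` -/
  | mul (r a b : ℕ)
  /-- `R[r] := In[R[a]]` -/
  | read (r a : ℕ)
  /-- `R[r] := R[R[a]]` -/
  | load (r a : ℕ)
  /-- `R[R[a]] := R[r]` -/
  | store (a r : ℕ)
  /-- `Out[R[a]] := R[r]` -/
  | setOut (a r : ℕ)
  /-- go to line `l` -/
  | jump (l : ℕ)
  /-- go to line `l` if `R[r] = 0` -/
  | jumpZero (r l : ℕ)
  /-- the OUTPUT instruction -/
  | output

/-- A program. The machine stops when the program counter leaves the program. -/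
abbrev RAMProgram := List RAMInstr

/-- Program counter, read-only input registers, registers, output registers. -/
structure RAMConfig where
  pc : ℕ
  inp : ℕ → ℕ
  reg : ℕ → ℕ
  out : ℕ → ℕ

/-- Effect of one instruction (the OUTPUT instruction leaves the registers unchanged). -/
def RAMInstr.exec (c : RAMConfig) : RAMInstr → RAMConfig
  | .const r x => { c with pc := c.pc + 1, reg := Function.update c.reg r x }
  | .add r a b => { c with pc := c.pc + 1, reg := Function.update c.reg r (c.reg a + c.reg b) }
  | .sub r a b => { c with pc := c.pc + 1, reg := Function.update c.reg r (c.reg a - c.reg b) }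
  | .mul r a b => { c with pc := c.pc + 1, reg := Function.update c.reg r (c.reg a * c.reg b) }
  | .read r a => { c with pc := c.pc + 1, reg := Function.update c.reg r (c.inp (c.reg a)) }
  | .load r a => { c with pc := c.pc + 1, reg := Function.update c.reg r (c.reg (c.reg a)) }
  | .store a r => { c with pc := c.pc + 1, reg := Function.update c.reg (c.reg a) (c.reg r) }
  | .setOut a r => { c with pc := c.pc + 1, out := Function.update c.out (c.reg a) (c.reg r) }
  | .jump l => { c with pc := l }
  | .jumpZero r l => { c with pc := if c.reg r = 0 then l else c.pc + 1 }
  | .output => { c with pc := c.pc + 1 }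

namespace RAMProgram

/-- One step, of cost one. -/
def step (P : RAMProgram) (c : RAMConfig) : RAMConfig :=
  match P[c.pc]? with
  | none => c
  | some i => i.exec c

/-- The configuration after `t` steps on the input `w`, whose entries are in the input registers
`0, 1, …`; everything else is initially `0`. -/
def run (P : RAMProgram) (w : List ℕ) (t : ℕ) : RAMConfig :=
  P.step^[t] ⟨0, fun i => w.getD i 0, fun _ => 0, fun _ => 0⟩

/-- On input `w`, the machine has stopped at time `t`. -/
def Halted (P : RAMProgram) (w : List ℕ) (t : ℕ) : Prop :=
  P[(P.run w t).pc]? = none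

/-- On input `w`, the machine executes an OUTPUT instruction at time `t`. -/
def Outputs (P : RAMProgram) (w : List ℕ) (t : ℕ) : Prop :=
  P[(P.run w t).pc]? = some .output

/-- The word held by the output registers at time `t`: `Out[0]` is its length, and
`Out[1], Out[2], …` are its letters. -/
def outputWord (P : RAMProgram) (w : List ℕ) (t : ℕ) : List ℕ :=
  List.ofFn (fun i : Fin ((P.run w t).out 0) => (P.run w t).out (i + 1))

/-- On input `w`, every register and output register always holds a number at most `B`. -/
def WordsBounded (P : RAMProgram) (w : List ℕ) (B : ℕ) : Prop :=
  ∀ t r, (P.run w t).reg r ≤ B ∧ (P.run w t).out r ≤ B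

end RAMProgram

/-- The class `P`, for the decision problem "does `x` satisfy `yes`?" whose instances `x` are
given to the machine as `enc x` and have size `size x`. A RAM stops after polynomially many steps
with the answer (`1` or `0`) in register `0`. Its registers hold polynomially bounded numbers, so
that polynomial unit-cost time is polynomial time on a Turing machine, in spite of the
multiplication instruction. -/
def InP {α : Type*} (enc : α → List ℕ) (size : α → ℕ) (yes : α → Prop) : Prop :=
  ∃ (P : RAMProgram) (p : Polynomial ℕ), ∀ x : α,
    P.WordsBounded (enc x) (p.eval (size x)) ∧
    ∃ t ≤ p.eval (size x), P.Halted (enc x) t ∧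
      (yes x → (P.run (enc x) t).reg 0 = 1) ∧
      (¬ yes x → (P.run (enc x) t).reg 0 = 0)

/-- The enumeration problem "list the words of `A x`" is solved by a RAM, with delay at most
`delay x`: on input `x` the words written by the OUTPUT instructions are exactly those of `A x`,
each written once; the first output (or the stop, if there is none) comes after a precomputation
of polynomial time; and after each output, the next output, or the stop after the last one, comes
within `delay x` steps. The registers hold polynomially bounded numbers. -/
def EnumerableWithDelay {α : Type*} (enc : α → List ℕ) (size : α → ℕ)
    (A : α → Set (List ℕ)) (delay : α → ℕ) : Prop :=
  ∃ (P : RAMProgram) (p : Polynomial ℕ), ∀ x : α,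
    P.WordsBounded (enc x) (p.eval (size x)) ∧
    (∀ u, u ∈ A x ↔ ∃ t, P.Outputs (enc x) t ∧ P.outputWord (enc x) t = u) ∧
    (∀ s t, P.Outputs (enc x) s → P.Outputs (enc x) t →
      P.outputWord (enc x) s = P.outputWord (enc x) t → s = t) ∧
    (∃ t ≤ p.eval (size x), P.Outputs (enc x) t ∨ P.Halted (enc x) t) ∧
    (∀ s, P.Outputs (enc x) s →
      ∃ t, s < t ∧ t ≤ s + delay x ∧ (P.Outputs (enc x) t ∨ P.Halted (enc x) t))

/-! ## The closure problems -/

/-- An instance of the enumeration problem: the set of vectors `{vec 0, …, vec (m - 1)}`, all of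
size `n`. -/
structure VectorFamily (D : Type*) where
  n : ℕ
  m : ℕ
  vec : Fin m → Fin n → D

/-- An instance of the decision problem: a set of vectors and one more vector. -/
structure ClosureInstance (D : Type*) extends VectorFamily D where
  target : Fin n → D

/-- A vector as a word, the elements of `D` being numbered by `code`. -/
def encodeVector {D : Type*} {d : ℕ} (code : D ≃ Fin d) {n : ℕ} (v : Fin n → D) : List ℕ :=
  List.ofFn (fun j => (code (v j) : ℕ))

/-- The vectors of the family, one after the other. -/
def VectorFamily.rows {D : Type*} {d : ℕ} (code : D ≃ Fin d) (S : VectorFamily D) : List ℕ :=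
  (List.ofFn (fun i => encodeVector code (S.vec i))).flatten

/-- The numbers `n`, `m`, then the vectors. -/
def VectorFamily.encode {D : Type*} {d : ℕ} (code : D ≃ Fin d) (S : VectorFamily D) : List ℕ :=
  S.n :: S.m :: S.rows code

/-- The numbers `n`, `m`, then the vector to be tested, then the family. -/
def ClosureInstance.encode {D : Type*} {d : ℕ} (code : D ≃ Fin d) (x : ClosureInstance D) :
    List ℕ :=
  x.n :: x.m :: (encodeVector code x.target ++ x.rows code)

/-- Number of symbols needed to write `m + 1` lines of `n` letters each, with end-of-line marks
(one line is the vector to be tested, or a header). -/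
def VectorFamily.size {D : Type*} (S : VectorFamily D) : ℕ := (S.n + 1) * (S.m + 1)

/-- The decision problem `Closure_F` (is the given vector in the closure of the given set?) is
in `P`. -/
def ClosureInP {D : Type*} {d : ℕ} (code : D ≃ Fin d) (F : Set (Operation D)) : Prop :=
  InP (ClosureInstance.encode code) (fun x => x.size)
    (fun x => Cl F (Set.range x.vec) x.target)

/-- The enumeration problem `EnumClosure_F` can be solved with delay `δ n`, where `n` is the size
of the vectors. -/
def EnumClosureWithDelay {D : Type*} {d : ℕ} (code : D ≃ Fin d) (F : Set (Operation D))
    (δ : ℕ → ℕ) : Prop :=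
  EnumerableWithDelay (VectorFamily.encode code) VectorFamily.size
    (fun S => {u | ∃ v, Cl F (Set.range S.vec) v ∧ encodeVector code v = u}) (fun S => δ S.n)

/-! ## Closures and near unanimity -/

namespace Cl

variable {D : Type*} {F : Set (Operation D)} {n : ℕ} {S : Set (Fin n → D)}

/-! Write `k = r + 2`. A near unanimity term gives the Baker–Pixley property: a vector lies in the
closure as soon as, on each set of at most `r + 1` coordinates, some vector of the closure agrees
with it (`Cl.interpolate`). Closure commutes with the selection of coordinates (`Cl.comp_iff`), so
each local condition asks whether an `(r + 1)`-tuple lies in the closure of a given subset of `D ^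
(r + 1)`. There are finitely many such questions and their answers depend only on `F`. They are
hardwired into the program as a finite table, which is why `F` may be infinite and need not be
computable in any sense.

The machine first records, for every `(r + 1)`-tuple of coordinates, the bit mask of the projections
of the input vectors. This takes polynomial time, and afterwards the number of vectors no longer
matters. Membership of a vector is then a conjunction of polynomially many table lookups.

For the enumeration, the local conditions are grouped by their largest coordinate `l`
(`Cl.exists_prefix_iff`). Level `l` involves only the letters up to `l` and costs `O(n ^ r)`
lookups. By Baker–Pixley applied to initial segments, a prefix that satisfies its levels is a prefix
of a vector of the closure (`IsTable.extendable`), so the lexicographic search has no dead ends.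
Between two words it climbs at most `n` levels, descends at most `n` levels, and tries at most `|D|`
letters at each of them: `O(n * n ^ r) = O(n ^ (k - 1))` steps.

To obtain actual machines, the algorithms are written in a small structured language whose compiler
is proved correct step by step (`Exec.steps`). The trace of an execution records when each word is
output, `Delayed` expresses the delay on traces, and `Trip` gives timed total correctness for the
silent parts.

Two boundary cases need care. The empty set of coordinates imposes only that the closure be
nonempty, and this is tested separately because nullary operations make the closure of the empty set
nonempty. An arity `k ≤ 1` is possible only if `D` has at most one element; the delay must then be
constant, so the program stops right after its only output. -/

theorem of_inClone {t : ℕ} {f : (Fin t → D) → D} (hf : InClone F t f) :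
    ∀ v : Fin t → Fin n → D, (∀ i, Cl F S (v i)) → Cl F S (fun j => f (fun i => v i j)) := by
  induction hf with
  | base f h => exact fun v hv => Cl.app ⟨_, f⟩ v h hv
  | proj i => exact fun v hv => hv i
  | comp f g _ _ ihf ihg => exact fun v hv => ihf _ (fun i => ihg i v hv)

/-- Interpolation needs a vector to start from, even when no coordinate is prescribed; this
criterion is what the machine can test: the number of rows, and one bit that depends on `F`. -/
theorem nonempty_iff : (∃ v, Cl F S v) ↔ S.Nonempty ∨ ∃ o ∈ F, o.1 = 0 := by
  constructor
  · rintro ⟨v, hv⟩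
    induction hv with
    | mem v h => exact Or.inl ⟨v, h⟩
    | app o v ho _ ih =>
      by_cases h : o.1 = 0
      · exact Or.inr ⟨o, ho, h⟩
      · exact ih ⟨0, Nat.pos_of_ne_zero h⟩
  · rintro (⟨v, hv⟩ | ⟨⟨t, f⟩, ho, rfl⟩)
    · exact ⟨v, Cl.mem v hv⟩
    · exact ⟨_, Cl.app ⟨0, f⟩ Fin.elim0 ho (fun i => i.elim0)⟩

/-- Closure commutes with the selection of coordinates. -/
theorem comp_iff {q : ℕ} (J : Fin q → Fin n) (y : Fin q → D) :
    Cl F ((fun s : Fin n → D => s ∘ J) '' S) y ↔ ∃ w, Cl F S w ∧ w ∘ J = y := by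
  constructor
  · intro h
    induction h with
    | mem v h =>
      obtain ⟨s, hs, rfl⟩ := h
      exact ⟨s, Cl.mem s hs, rfl⟩
    | app o v ho _ ih =>
      choose w hw hJ using ih
      refine ⟨_, Cl.app o w ho hw, ?_⟩
      funext j
      simp only [Function.comp_apply, ← hJ]
  · rintro ⟨w, hw, rfl⟩
    induction hw with
    | mem v h => exact Cl.mem _ ⟨v, h, rfl⟩
    | app o v ho _ ih => exact Cl.app o (fun i => v i ∘ J) ho ih

variable {r : ℕ} {f : (Fin (r + 2) → D) → D}

/-- **Baker–Pixley**: what can be interpolated in `Cl F S` on small sets of coordinates can be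
interpolated on all sets of coordinates. -/
theorem interpolate (hf : InClone F (r + 2) f) (hnu : IsNearUnanimity f) (x : Fin n → D)
    (T : Finset (Fin n))
    (h : ∀ T' ⊆ T, T'.card ≤ r + 1 → ∃ w, Cl F S w ∧ ∀ i ∈ T', w i = x i) :
    ∃ w, Cl F S w ∧ ∀ i ∈ T, w i = x i := by
  induction T using Finset.strongInduction with
  | H T ih =>
    by_cases hT : T.card ≤ r + 1
    · exact h T subset_rfl hT
    · have hc : Fintype.card (Fin (r + 2)) ≤ Fintype.card T := by simp; omega
      obtain ⟨e⟩ := Function.Embedding.nonempty_of_card_le hc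
      have h' : ∀ j, ∃ w, Cl F S w ∧ ∀ i ∈ T.erase (e j), w i = x i := fun j =>
        ih _ (Finset.erase_ssubset (e j).2)
          (fun T' hT' => h T' (hT'.trans (Finset.erase_subset _ _)))
      choose w hw hx using h'
      -- The `r + 2` coordinates `e j` of `T` are distinct and `w j` is correct on `T` except
      -- perhaps at `e j`. Hence at each coordinate of `T` at most one of the `w j` is wrong, and
      -- `f` outvotes it.
      refine ⟨_, of_inClone hf w hw, fun i hi => hnu _ _ ?_⟩
      have key : ∀ j, w j i ≠ x i → (e j : Fin n) = i := fun j hj => by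
        by_contra hne
        exact hj (hx j i (Finset.mem_erase.2 ⟨fun h => hne h.symm, hi⟩))
      intro a ha b hb
      exact e.injective (Subtype.ext ((key a ha).trans (key b hb).symm))

/-- Each nonempty set of at most `r + 1` coordinates has a largest element `l`, and its other
elements, repeated if necessary, form a tuple of length `r` below `l`. Sorting the conditions by `l`
lets a prefix be tested letter by letter. The empty set is covered by `hne`. -/
theorem exists_prefix_iff (hf : InClone F (r + 2) f) (hnu : IsNearUnanimity f)
    (hne : ∃ w, Cl F S w) (x : Fin n → D) (b : ℕ) :
    (∃ w, Cl F S w ∧ ∀ i : Fin n, (i : ℕ) < b → w i = x i) ↔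
      ∀ l : Fin n, (l : ℕ) < b → ∀ I : Fin r → Fin n, (∀ i, I i ≤ l) →
        ∃ w, Cl F S w ∧ w l = x l ∧ ∀ i, w (I i) = x (I i) := by
  constructor
  · rintro ⟨w, hw, hx⟩ l hl I hI
    exact ⟨w, hw, hx l hl, fun i => hx _ (lt_of_le_of_lt (Fin.le_def.1 (hI i)) hl)⟩
  · intro h
    obtain ⟨w, hw, hx⟩ := interpolate hf hnu x (Finset.univ.filter fun i : Fin n => (i : ℕ) < b)
      (fun T hT hc => by
        rcases T.eq_empty_or_nonempty with rfl | hT0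
        · obtain ⟨w, hw⟩ := hne
          exact ⟨w, hw, by simp⟩
        · set l := T.max' hT0 with hl
          have hlT : l ∈ T := T.max'_mem hT0
          have hcard : (T.erase l).card ≤ r := by
            rw [Finset.card_erase_of_mem hlT]; omega
          -- The other elements of `T`, padded with `l` up to length `r`.
          let I : Fin r → Fin n := fun i =>
            if h : (i : ℕ) < (T.erase l).card then ((T.erase l).equivFin.symm ⟨i, h⟩ : Fin n) else l
          have hI : ∀ i, I i ≤ l := fun i => by
            by_cases h : (i : ℕ) < (T.erase l).card
            · simp only [I, h, dif_pos]
              exact T.le_max' _ (Finset.mem_of_mem_erase (Subtype.property _))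
            · simp [I, h]
          obtain ⟨w, hw, hwl, hwI⟩ := h l (by simpa using hT hlT) I hI
          refine ⟨w, hw, fun i hi => ?_⟩
          by_cases hil : i = l
          · rw [hil, hwl]
          · have him : i ∈ T.erase l := Finset.mem_erase.2 ⟨hil, hi⟩
            have h1 := ((T.erase l).equivFin ⟨i, him⟩).2
            have := hwI ⟨(T.erase l).equivFin ⟨i, him⟩, lt_of_lt_of_le h1 hcard⟩
            simpa [I, h1] using this)
    exact ⟨w, hw, fun i hi => hx i (by simpa using hi)⟩

end Cl


/-! ## A structured language for random access machines -/

/-- Names of the scalar variables. -/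
inductive Slot
  | ans | dim | rows | ptr | row | lvl | cand | flag | more | top | go | found | tmp | val
  | cnt (j : ℕ) | addr (j : ℕ) | word (j : ℕ)
deriving DecidableEq

/-- Numbering of the scalar variables. -/
def Slot.idx : Slot → ℕ
  | ans => 0 | dim => 1 | rows => 2 | ptr => 3 | row => 4 | lvl => 5 | cand => 6 | flag => 7
  | more => 8 | top => 9 | go => 10 | found => 11 | tmp => 12 | val => 13
  | cnt j => 14 + 3 * j | addr j => 15 + 3 * j | word j => 16 + 3 * j

theorem Slot.idx_injective : Function.Injective Slot.idx := by
  intro a b h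
  cases a <;> cases b <;> simp only [Slot.idx] at h <;> first | rfl | omega | (congr 1; omega)

/-- The register of a scalar variable. -/
def Slot.reg (x : Slot) : ℕ := 4 * x.idx

/-- Scalar variables, two unbounded arrays, and the output registers. -/
structure Store where
  sc : Slot → ℕ
  V : ℕ → ℕ
  W : ℕ → ℕ
  out : ℕ → ℕ

/-- The word held by the output registers. -/
def wordOf (out : ℕ → ℕ) : List ℕ := List.ofFn (fun i : Fin (out 0) => out (i + 1))

inductive ArithOp
  | add | sub | mul

namespace ArithOp

def fn : ArithOp → ℕ → ℕ → ℕ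
  | add, a, b => a + b
  | sub, a, b => a - b
  | mul, a, b => a * b

def instr : ArithOp → ℕ → ℕ → ℕ → RAMInstr
  | add => .add
  | sub => .sub
  | mul => .mul

/-- The bound on the result that does not follow from a bound on the arguments. -/
def Ok (B : ℕ) : ArithOp → ℕ → ℕ → Prop
  | add, a, b => a + b ≤ B
  | sub, _, _ => True
  | mul, a, b => a * b ≤ B

end ArithOp

/-- Assignments. -/
inductive Prim
  | const (r : Slot) (c : ℕ)
  | copy (r a : Slot)
  | op (o : ArithOp) (r a b : Slot)
  | opc (o : ArithOp) (r a : Slot) (c : ℕ)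
  | read (r a : Slot)
  | getV (r a : Slot)
  | setV (a r : Slot)
  | getW (r a : Slot)
  | setW (a r : Slot)
  | setOut (a r : Slot)

namespace Prim

def exec (inp : ℕ → ℕ) (s : Store) : Prim → Store
  | const r c => { s with sc := Function.update s.sc r c }
  | copy r a => { s with sc := Function.update s.sc r (s.sc a) }
  | op o r a b => { s with sc := Function.update s.sc r (o.fn (s.sc a) (s.sc b)) }
  | opc o r a c => { s with sc := Function.update s.sc r (o.fn (s.sc a) c) }
  | read r a => { s with sc := Function.update s.sc r (inp (s.sc a)) }
  | getV r a => { s with sc := Function.update s.sc r (s.V (s.sc a)) }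
  | setV a r => { s with V := Function.update s.V (s.sc a) (s.sc r) }
  | getW r a => { s with sc := Function.update s.sc r (s.W (s.sc a)) }
  | setW a r => { s with W := Function.update s.W (s.sc a) (s.sc r) }
  | setOut a r => { s with out := Function.update s.out (s.sc a) (s.sc r) }

/-- The values written, addresses included, are at most `B`. -/
def Ok (inp : ℕ → ℕ) (B : ℕ) (s : Store) : Prim → Prop
  | const _ c => c ≤ B
  | copy _ _ => True
  | op o _ a b => o.Ok B (s.sc a) (s.sc b)
  | opc o _ a c => c ≤ B ∧ o.Ok B (s.sc a) c
  | read _ a => inp (s.sc a) ≤ B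
  | getV _ a => 4 * s.sc a + 1 ≤ B
  | setV a _ => 4 * s.sc a + 1 ≤ B
  | getW _ a => 4 * s.sc a + 2 ≤ B
  | setW a _ => 4 * s.sc a + 2 ≤ B
  | setOut _ _ => True

/-- Register `3` receives `4 * R[a] + o`. -/
def location (o a : ℕ) : List RAMInstr :=
  [.const 3 o, .add 3 3 a, .add 3 3 a, .add 3 3 a, .add 3 3 a]

/-- Register `3` serves as scratch space for constants and computed addresses; a copy is the
addition of a zero placed there. -/
def code : Prim → List RAMInstr
  | const r c => [.const r.reg c]
  | copy r a => [.const 3 0, .add r.reg a.reg 3]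
  | op o r a b => [o.instr r.reg a.reg b.reg]
  | opc o r a c => [.const 3 c, o.instr r.reg a.reg 3]
  | read r a => [.read r.reg a.reg]
  | getV r a => location 1 a.reg ++ [.load r.reg 3]
  | setV a r => location 1 a.reg ++ [.store 3 r.reg]
  | getW r a => location 2 a.reg ++ [.load r.reg 3]
  | setW a r => location 2 a.reg ++ [.store 3 r.reg]
  | setOut a r => [.setOut a.reg r.reg]

/-- The maximum is reached by array accesses: five instructions for the address and one for the
access. This is the unit cost `6` of an assignment in all time bounds. -/
theorem code_length_le (p : Prim) : p.code.length ≤ 6 := by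
  cases p <;> simp [code, location]

end Prim

/-- Structured programs. -/
inductive Cmd
  | skip
  | prim (p : Prim)
  | output
  | seq (a b : Cmd)
  | ifz (r : Slot) (a b : Cmd)
  | loop (r : Slot) (b : Cmd)

/-- One entry for each step: the word that is output, if there is one. -/
abbrev Trace := List (Option (List ℕ))

/-- Big-step semantics, with the trace of the execution; the values written are at most `B`. -/
inductive Exec (inp : ℕ → ℕ) (B : ℕ) : Cmd → Store → Trace → Store → Prop
  | skip (s) : Exec inp B .skip s [] s
  | prim (p : Prim) (s) : p.Ok inp B s →
      Exec inp B (.prim p) s (List.replicate p.code.length none) (p.exec inp s)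
  | output (s) : Exec inp B .output s [some (wordOf s.out)] s
  | seq {a b s s₁ s₂ τ₁ τ₂} : Exec inp B a s τ₁ s₁ → Exec inp B b s₁ τ₂ s₂ →
      Exec inp B (.seq a b) s (τ₁ ++ τ₂) s₂
  | ifz_zero {r a b s s' τ} : s.sc r = 0 → Exec inp B a s τ s' →
      Exec inp B (.ifz r a b) s (none :: τ) s'
  | ifz_ne {r a b s s' τ} : s.sc r ≠ 0 → Exec inp B b s τ s' →
      Exec inp B (.ifz r a b) s (none :: τ ++ [none]) s'
  | loop_zero {r b s} : s.sc r = 0 → Exec inp B (.loop r b) s [none] s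
  | loop_ne {r b s s₁ s₂ τ₁ τ₂} : s.sc r ≠ 0 → Exec inp B b s τ₁ s₁ →
      Exec inp B (.loop r b) s₁ τ₂ s₂ → Exec inp B (.loop r b) s (none :: τ₁ ++ none :: τ₂) s₂

namespace Cmd

/-- The code of a structured program, to be placed at line `l`. -/
def compile : Cmd → ℕ → List RAMInstr
  | skip, _ => []
  | prim p, _ => p.code
  | output, _ => [.output]
  | seq a b, l => a.compile l ++ b.compile (l + (a.compile l).length)
  -- The nonzero branch stands first and ends with a jump over the zero branch, whence the
  -- additional silent step in `Exec.ifz_ne`.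
  | ifz r a b, l =>
      let B := b.compile (l + 1)
      let A := a.compile (l + 1 + B.length + 1)
      [.jumpZero r.reg (l + 1 + B.length + 1)] ++ B ++
        [.jump (l + 1 + B.length + 1 + A.length)] ++ A
  | loop r b, l =>
      let B := b.compile (l + 1)
      [.jumpZero r.reg (l + 1 + B.length + 1)] ++ B ++ [.jump l]

/-- The scalar variables that a program may modify. -/
def Writes : Cmd → Slot → Prop
  | skip, _ => False
  | prim (.const r _), x => x = r
  | prim (.copy r _), x => x = r
  | prim (.op _ r _ _), x => x = r
  | prim (.opc _ r _ _), x => x = r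
  | prim (.read r _), x => x = r
  | prim (.getV r _), x => x = r
  | prim (.getW r _), x => x = r
  | prim (.setV _ _), _ => False
  | prim (.setW _ _), _ => False
  | prim (.setOut _ _), _ => False
  | output, _ => False
  | seq a b, x => a.Writes x ∨ b.Writes x
  | ifz _ a b, x => a.Writes x ∨ b.Writes x
  | loop _ b, x => b.Writes x

/-- Whether a program may modify the first array. -/
def WritesV : Cmd → Prop
  | prim (.setV _ _) => True
  | seq a b => a.WritesV ∨ b.WritesV
  | ifz _ a b => a.WritesV ∨ b.WritesV
  | loop _ b => b.WritesV
  | _ => False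

/-- Whether a program may modify the second array. -/
def WritesW : Cmd → Prop
  | prim (.setW _ _) => True
  | seq a b => a.WritesW ∨ b.WritesW
  | ifz _ a b => a.WritesW ∨ b.WritesW
  | loop _ b => b.WritesW
  | _ => False

end Cmd

/-- A syntactic frame rule: with its analogues for the two arrays, it spares the loop invariants
from mentioning variables that the body cannot touch. -/
theorem Exec.sc_eq {inp : ℕ → ℕ} {B : ℕ} {c : Cmd} {s s' : Store} {τ : Trace}
    (h : Exec inp B c s τ s') {x : Slot} (hx : ¬ c.Writes x) : s'.sc x = s.sc x := by
  induction h with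
  | skip | output | loop_zero => rfl
  | prim p s _ =>
    cases p <;> simp only [Cmd.Writes] at hx <;> simp [Prim.exec, Function.update_of_ne, hx]
  | seq _ _ ih₁ ih₂ =>
    simp only [Cmd.Writes, not_or] at hx
    rw [ih₂ hx.2, ih₁ hx.1]
  | ifz_zero _ _ ih => exact ih fun h => hx (Or.inl h)
  | ifz_ne _ _ ih => exact ih fun h => hx (Or.inr h)
  | loop_ne _ _ _ ih₁ ih₂ => rw [ih₂ hx, ih₁ hx]

theorem Exec.V_eq {inp : ℕ → ℕ} {B : ℕ} {c : Cmd} {s s' : Store} {τ : Trace}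
    (h : Exec inp B c s τ s') (hx : ¬ c.WritesV) : s'.V = s.V := by
  induction h with
  | skip | output | loop_zero => rfl
  | prim p s _ => cases p <;> simp [Cmd.WritesV] at hx <;> simp [Prim.exec]
  | seq _ _ ih₁ ih₂ =>
    simp only [Cmd.WritesV, not_or] at hx
    rw [ih₂ hx.2, ih₁ hx.1]
  | ifz_zero _ _ ih => exact ih fun h => hx (Or.inl h)
  | ifz_ne _ _ ih => exact ih fun h => hx (Or.inr h)
  | loop_ne _ _ _ ih₁ ih₂ => rw [ih₂ hx, ih₁ hx]

theorem Exec.W_eq {inp : ℕ → ℕ} {B : ℕ} {c : Cmd} {s s' : Store} {τ : Trace}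
    (h : Exec inp B c s τ s') (hx : ¬ c.WritesW) : s'.W = s.W := by
  induction h with
  | skip | output | loop_zero => rfl
  | prim p s _ => cases p <;> simp [Cmd.WritesW] at hx <;> simp [Prim.exec]
  | seq _ _ ih₁ ih₂ =>
    simp only [Cmd.WritesW, not_or] at hx
    rw [ih₂ hx.2, ih₁ hx.1]
  | ifz_zero _ _ ih => exact ih fun h => hx (Or.inl h)
  | ifz_ne _ _ ih => exact ih fun h => hx (Or.inr h)
  | loop_ne _ _ _ ih₁ ih₂ => rw [ih₂ hx, ih₁ hx]

/-! ### Correctness of the compiler -/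

/-- The word output by an instruction. -/
def RAMInstr.label (c : RAMConfig) : RAMInstr → Option (List ℕ)
  | .output => some (wordOf c.out)
  | _ => none

def RAMConfig.Bounded (B : ℕ) (c : RAMConfig) : Prop := ∀ r, c.reg r ≤ B ∧ c.out r ≤ B

/-- Finitely many steps of a machine, with their trace. -/
inductive Steps (P : RAMProgram) (B : ℕ) : RAMConfig → Trace → RAMConfig → Prop
  | nil (c) : Steps P B c [] c
  | cons {c c' i τ} : P[c.pc]? = some i → (i.exec c).Bounded B → Steps P B (i.exec c) τ c' →
      Steps P B c (i.label c :: τ) c'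

namespace Steps

variable {P : RAMProgram} {B : ℕ} {c c₁ c₂ : RAMConfig} {τ₁ τ₂ : Trace}

theorem append (h₁ : Steps P B c τ₁ c₁) (h₂ : Steps P B c₁ τ₂ c₂) :
    Steps P B c (τ₁ ++ τ₂) c₂ := by
  induction h₁ with
  | nil => exact h₂
  | cons h hb _ ih => exact .cons h hb (ih h₂)

theorem single {i : RAMInstr} (h : P[c.pc]? = some i) (hb : (i.exec c).Bounded B) :
    Steps P B c [i.label c] (i.exec c) := .cons h hb (.nil _)

end Steps

/-- The code `L` stands at line `l` of `P`. -/
def CodeAt (P : RAMProgram) (l : ℕ) (L : List RAMInstr) : Prop :=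
  ∀ i x, L[i]? = some x → P[l + i]? = some x

namespace CodeAt

variable {P : RAMProgram} {l : ℕ} {L L' : List RAMInstr}

theorem left (h : CodeAt P l (L ++ L')) : CodeAt P l L := fun i x hx =>
  h i x (by
    have := (List.getElem?_eq_some_iff.1 hx).1
    rw [List.getElem?_append_left this, hx])

theorem right (h : CodeAt P l (L ++ L')) : CodeAt P (l + L.length) L' := fun i x hx => by
  rw [add_assoc]
  exact h _ x (by rw [List.getElem?_append_right (by omega)]; simpa using hx)

theorem head {i : RAMInstr} (h : CodeAt P l (i :: L)) : P[l]? = some i := h 0 i rfl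

theorem tail {i : RAMInstr} (h : CodeAt P l (i :: L)) : CodeAt P (l + 1) L :=
  right (L := [i]) h

end CodeAt

/-- The machine configuration `c` holds the store `s`. -/
structure Holds (inp : ℕ → ℕ) (B : ℕ) (s : Store) (c : RAMConfig) : Prop where
  inp : c.inp = inp
  sc : ∀ x : Slot, c.reg x.reg = s.sc x
  V : ∀ i, c.reg (4 * i + 1) = s.V i
  W : ∀ i, c.reg (4 * i + 2) = s.W i
  out : c.out = s.out
  bounded : c.Bounded B

theorem Slot.reg_inj {x y : Slot} : x.reg = y.reg ↔ x = y :=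
  ⟨fun h => Slot.idx_injective (by unfold Slot.reg at h; omega), fun h => h ▸ rfl⟩

/-- Registers are shared out by residue modulo `4`: scalars have residue `0`, the arrays `V` and `W`
residues `1` and `2`, and register `3` is scratch. Hence writes to different kinds of variables
never interfere. -/
theorem Slot.reg_ne_one (x : Slot) (i : ℕ) : x.reg ≠ 4 * i + 1 := by unfold Slot.reg; omega
theorem Slot.reg_ne_two (x : Slot) (i : ℕ) : x.reg ≠ 4 * i + 2 := by unfold Slot.reg; omega
theorem Slot.reg_ne_three (x : Slot) : x.reg ≠ 3 := by unfold Slot.reg; omega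

namespace Holds

variable {inp : ℕ → ℕ} {B : ℕ} {s : Store} {c : RAMConfig}

theorem jump (h : Holds inp B s c) (l : ℕ) : Holds inp B s { c with pc := l } :=
  ⟨h.inp, h.sc, h.V, h.W, h.out, h.bounded⟩

theorem setTmp (h : Holds inp B s c) (l v : ℕ) (hv : v ≤ B) :
    Holds inp B s { c with pc := l, reg := Function.update c.reg 3 v } where
  inp := h.inp
  sc x := by simp [Function.update_of_ne x.reg_ne_three, h.sc]
  V i := by
    have : 4 * i + 1 ≠ 3 := by omega
    simp [Function.update_of_ne this, h.V]
  W i := by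
    simp [h.W]
  out := h.out
  bounded r := by
    refine ⟨?_, (h.bounded r).2⟩
    rcases eq_or_ne r 3 with rfl | hr
    · simpa using hv
    · simpa [Function.update_of_ne hr] using (h.bounded r).1

theorem setSc (h : Holds inp B s c) (l : ℕ) (x : Slot) (v : ℕ) (hv : v ≤ B) :
    Holds inp B { s with sc := Function.update s.sc x v }
      { c with pc := l, reg := Function.update c.reg x.reg v } where
  inp := h.inp
  sc y := by
    rcases eq_or_ne y x with rfl | hy
    · simp
    · simp [Function.update_of_ne hy, Function.update_of_ne (mt Slot.reg_inj.1 hy), h.sc]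
  V i := by simp [Function.update_of_ne (x.reg_ne_one i).symm, h.V]
  W i := by simp [Function.update_of_ne (x.reg_ne_two i).symm, h.W]
  out := h.out
  bounded r := by
    refine ⟨?_, (h.bounded r).2⟩
    rcases eq_or_ne r x.reg with rfl | hr
    · simpa using hv
    · simpa [Function.update_of_ne hr] using (h.bounded r).1

theorem setV (h : Holds inp B s c) (l i v : ℕ) (hv : v ≤ B) :
    Holds inp B { s with V := Function.update s.V i v }
      { c with pc := l, reg := Function.update c.reg (4 * i + 1) v } where
  inp := h.inp
  sc y := by simp [Function.update_of_ne (y.reg_ne_one i), h.sc]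
  V j := by
    rcases eq_or_ne j i with rfl | hj
    · simp
    · have : 4 * j + 1 ≠ 4 * i + 1 := by omega
      simp [Function.update_of_ne hj, Function.update_of_ne this, h.V]
  W j := by
    have : 4 * j + 2 ≠ 4 * i + 1 := by omega
    simp [Function.update_of_ne this, h.W]
  out := h.out
  bounded r := by
    refine ⟨?_, (h.bounded r).2⟩
    rcases eq_or_ne r (4 * i + 1) with rfl | hr
    · simpa using hv
    · simpa [Function.update_of_ne hr] using (h.bounded r).1

theorem setW (h : Holds inp B s c) (l i v : ℕ) (hv : v ≤ B) :
    Holds inp B { s with W := Function.update s.W i v }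
      { c with pc := l, reg := Function.update c.reg (4 * i + 2) v } where
  inp := h.inp
  sc y := by simp [Function.update_of_ne (y.reg_ne_two i), h.sc]
  W j := by
    rcases eq_or_ne j i with rfl | hj
    · simp
    · have : 4 * j + 2 ≠ 4 * i + 2 := by omega
      simp [Function.update_of_ne hj, Function.update_of_ne this, h.W]
  V j := by
    have : 4 * j + 1 ≠ 4 * i + 2 := by omega
    simp [Function.update_of_ne this, h.V]
  out := h.out
  bounded r := by
    refine ⟨?_, (h.bounded r).2⟩
    rcases eq_or_ne r (4 * i + 2) with rfl | hr
    · simpa using hv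
    · simpa [Function.update_of_ne hr] using (h.bounded r).1

theorem setOut (h : Holds inp B s c) (l i v : ℕ) (hv : v ≤ B) :
    Holds inp B { s with out := Function.update s.out i v }
      { c with pc := l, out := Function.update c.out i v } where
  inp := h.inp
  sc := h.sc
  V := h.V
  W := h.W
  out := by simp [h.out]
  bounded r := by
    refine ⟨(h.bounded r).1, ?_⟩
    rcases eq_or_ne r i with rfl | hr
    · simpa using hv
    · simpa [Function.update_of_ne hr] using (h.bounded r).2

theorem sc_le (h : Holds inp B s c) (x : Slot) : s.sc x ≤ B := h.sc x ▸ (h.bounded _).1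

end Holds

theorem steps_location {inp : ℕ → ℕ} {B : ℕ} {P : RAMProgram} {s : Store} {c : RAMConfig}
    (h : Holds inp B s c) (o : ℕ) (a : Slot) (hP : CodeAt P c.pc (Prim.location o a.reg))
    (hB : 4 * s.sc a + o ≤ B) :
    ∃ c', Steps P B c (List.replicate 5 none) c' ∧ Holds inp B s c' ∧ c'.pc = c.pc + 5 ∧
      c'.reg 3 = 4 * s.sc a + o := by
  -- The address is reached by four additions; the partial sums increase, so the bound on the final
  -- address covers them all.
  have add : ∀ c : RAMConfig, Holds inp B s c → ∀ k, c.reg 3 = k → k + s.sc a ≤ B →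
      Holds inp B s (RAMInstr.exec c (.add 3 3 a.reg)) ∧
      (RAMInstr.exec c (.add 3 3 a.reg)).pc = c.pc + 1 ∧
      (RAMInstr.exec c (.add 3 3 a.reg)).reg 3 = k + s.sc a := by
    intro c h k hk hB
    refine ⟨?_, rfl, by simp [RAMInstr.exec, hk, h.sc]⟩
    exact h.setTmp _ _ (by rw [hk, h.sc]; exact hB)
  have h0 : Holds inp B s (RAMInstr.exec c (.const 3 o)) := h.setTmp _ _ (by omega)
  obtain ⟨h1, p1, r1⟩ := add _ h0 o (by simp [RAMInstr.exec]) (by omega)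
  obtain ⟨h2, p2, r2⟩ := add _ h1 _ r1 (by omega)
  obtain ⟨h3, p3, r3⟩ := add _ h2 _ r2 (by omega)
  obtain ⟨h4, p4, r4⟩ := add _ h3 _ r3 (by omega)
  have q0 : (RAMInstr.exec c (.const 3 o)).pc = c.pc + 1 := rfl
  refine ⟨_, ?_, h4, by rw [p4, p3, p2, p1, q0], by rw [r4]; ring⟩
  refine .cons (i := .const 3 o) hP.head h0.bounded ?_
  refine .cons (i := .add 3 3 a.reg) (by rw [q0]; exact hP.tail.head) h1.bounded ?_
  refine .cons (i := .add 3 3 a.reg) (by rw [p1, q0]; exact hP.tail.tail.head) h2.bounded ?_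
  refine .cons (i := .add 3 3 a.reg) (by rw [p2, p1, q0]; exact hP.tail.tail.tail.head)
    h3.bounded ?_
  exact .cons (i := .add 3 3 a.reg) (by rw [p3, p2, p1, q0]; exact hP.tail.tail.tail.tail.head)
    h4.bounded (.nil _)

theorem ArithOp.exec_instr (o : ArithOp) (c : RAMConfig) (r a b : ℕ) :
    RAMInstr.exec c (o.instr r a b) =
      { c with pc := c.pc + 1, reg := Function.update c.reg r (o.fn (c.reg a) (c.reg b)) } := by
  cases o <;> rfl

theorem ArithOp.label_instr (o : ArithOp) (c : RAMConfig) (r a b : ℕ) :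
    RAMInstr.label c (o.instr r a b) = none := by
  cases o <;> rfl

theorem ArithOp.fn_le {B : ℕ} (o : ArithOp) {a b : ℕ} (h : o.Ok B a b) (ha : a ≤ B) :
    o.fn a b ≤ B := by
  cases o with
  | add => exact h
  | sub => exact (Nat.sub_le _ _).trans ha
  | mul => exact h

theorem Prim.steps {inp : ℕ → ℕ} {B : ℕ} {P : RAMProgram} {s : Store} {c : RAMConfig} (p : Prim)
    (h : Holds inp B s c) (hP : CodeAt P c.pc p.code) (hB : p.Ok inp B s) :
    ∃ c', Steps P B c (List.replicate p.code.length none) c' ∧ Holds inp B (p.exec inp s) c' ∧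
      c'.pc = c.pc + p.code.length := by
  cases p with
  | const r x =>
    have h' := h.setSc (c.pc + 1) r x hB
    exact ⟨_, .single (i := .const r.reg x) hP.head h'.bounded, h', rfl⟩
  | copy r a =>
    have h0 : Holds inp B s (RAMInstr.exec c (.const 3 0)) := h.setTmp _ _ (by omega)
    have h1 := h0.setSc (c.pc + 2) r (s.sc a) (h.sc_le a)
    have e : RAMInstr.exec (RAMInstr.exec c (.const 3 0)) (.add r.reg a.reg 3) =
      { (RAMInstr.exec c (.const 3 0)) with
        pc := c.pc + 2
        reg := Function.update (RAMInstr.exec c (.const 3 0)).reg r.reg (s.sc a) } := by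
      simp [RAMInstr.exec, Function.update_of_ne a.reg_ne_three, h.sc]
    rw [← e] at h1
    exact ⟨_, .cons (i := .const 3 0) hP.head h0.bounded
      (.single (i := .add r.reg a.reg 3) hP.tail.head h1.bounded), h1, rfl⟩
  | op o r a b =>
    have h' := h.setSc (c.pc + 1) r _ (o.fn_le hB (h.sc_le a))
    have e := o.exec_instr c r.reg a.reg b.reg
    rw [h.sc, h.sc] at e
    rw [← e] at h'
    have := Steps.single (P := P) hP.head h'.bounded
    rw [o.label_instr] at this
    exact ⟨_, this, h', by simp [e, Prim.code]⟩
  | opc o r a x =>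
    have h0 : Holds inp B s (RAMInstr.exec c (.const 3 x)) := h.setTmp _ _ hB.1
    have h1 := h0.setSc (c.pc + 2) r _ (o.fn_le hB.2 (h.sc_le a))
    have e := o.exec_instr (RAMInstr.exec c (.const 3 x)) r.reg a.reg 3
    rw [h0.sc] at e
    have e3 : (RAMInstr.exec c (.const 3 x)).reg 3 = x := by simp [RAMInstr.exec]
    rw [e3] at e
    have ep : (RAMInstr.exec c (.const 3 x)).pc + 1 = c.pc + 2 := rfl
    rw [ep] at e
    rw [← e] at h1
    have := Steps.single (P := P) (c := RAMInstr.exec c (.const 3 x)) hP.tail.head h1.bounded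
    rw [o.label_instr] at this
    exact ⟨_, .cons (i := .const 3 x) hP.head h0.bounded this, h1, by simp [e, Prim.code]⟩
  | read r a =>
    have h' := h.setSc (c.pc + 1) r _ hB
    have e : RAMInstr.exec c (.read r.reg a.reg) = { c with
        pc := c.pc + 1
        reg := Function.update c.reg r.reg (inp (s.sc a)) } := by
      simp [RAMInstr.exec, h.sc, h.inp]
    rw [← e] at h'
    exact ⟨_, .single (i := .read r.reg a.reg) hP.head h'.bounded, h', rfl⟩
  | getV r a =>
    obtain ⟨c₁, st, h₁, p₁, r₁⟩ := steps_location h 1 a hP.left hB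
    have h2 := h₁.setSc (c.pc + 6) r (s.V (s.sc a)) (h₁.V _ ▸ (h₁.bounded _).1)
    have e : RAMInstr.exec c₁ (.load r.reg 3) = { c₁ with
        pc := c.pc + 6
        reg := Function.update c₁.reg r.reg (s.V (s.sc a)) } := by
      simp [RAMInstr.exec, r₁, h₁.V, p₁]
    rw [← e] at h2
    refine ⟨_, st.append (.single (i := .load r.reg 3) ?_ h2.bounded), h2, by rw [e]; rfl⟩
    rw [p₁]; exact hP.right.head
  | setV a r =>
    obtain ⟨c₁, st, h₁, p₁, r₁⟩ := steps_location h 1 a hP.left hB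
    have h2 := h₁.setV (c.pc + 6) (s.sc a) (s.sc r) (h₁.sc_le _)
    have e : RAMInstr.exec c₁ (.store 3 r.reg) = { c₁ with
        pc := c.pc + 6
        reg := Function.update c₁.reg (4 * s.sc a + 1) (s.sc r) } := by
      simp [RAMInstr.exec, r₁, h₁.sc, p₁]
    rw [← e] at h2
    refine ⟨_, st.append (.single (i := .store 3 r.reg) ?_ h2.bounded), h2, by rw [e]; rfl⟩
    rw [p₁]; exact hP.right.head
  | getW r a =>
    obtain ⟨c₁, st, h₁, p₁, r₁⟩ := steps_location h 2 a hP.left hB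
    have h2 := h₁.setSc (c.pc + 6) r (s.W (s.sc a)) (h₁.W _ ▸ (h₁.bounded _).1)
    have e : RAMInstr.exec c₁ (.load r.reg 3) = { c₁ with
        pc := c.pc + 6
        reg := Function.update c₁.reg r.reg (s.W (s.sc a)) } := by
      simp [RAMInstr.exec, r₁, h₁.W, p₁]
    rw [← e] at h2
    refine ⟨_, st.append (.single (i := .load r.reg 3) ?_ h2.bounded), h2, by rw [e]; rfl⟩
    rw [p₁]; exact hP.right.head
  | setW a r =>
    obtain ⟨c₁, st, h₁, p₁, r₁⟩ := steps_location h 2 a hP.left hB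
    have h2 := h₁.setW (c.pc + 6) (s.sc a) (s.sc r) (h₁.sc_le _)
    have e : RAMInstr.exec c₁ (.store 3 r.reg) = { c₁ with
        pc := c.pc + 6
        reg := Function.update c₁.reg (4 * s.sc a + 2) (s.sc r) } := by
      simp [RAMInstr.exec, r₁, h₁.sc, p₁]
    rw [← e] at h2
    refine ⟨_, st.append (.single (i := .store 3 r.reg) ?_ h2.bounded), h2, by rw [e]; rfl⟩
    rw [p₁]; exact hP.right.head
  | setOut a r =>
    have h' := h.setOut (c.pc + 1) (s.sc a) (s.sc r) (h.sc_le _)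
    have e : RAMInstr.exec c (.setOut a.reg r.reg) = { c with
        pc := c.pc + 1
        out := Function.update c.out (s.sc a) (s.sc r) } := by
      simp [RAMInstr.exec, h.sc]
    rw [← e] at h'
    exact ⟨_, .single (i := .setOut a.reg r.reg) hP.head h'.bounded, h', rfl⟩

/-- The compiled code has the behaviour of the structured program. -/
theorem Exec.steps {inp : ℕ → ℕ} {B : ℕ} {P : RAMProgram} {p : Cmd} {s s' : Store} {τ : Trace}
    (h : Exec inp B p s τ s') :
    ∀ c : RAMConfig, Holds inp B s c → CodeAt P c.pc (p.compile c.pc) →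
      ∃ c', Steps P B c τ c' ∧ Holds inp B s' c' ∧ c'.pc = c.pc + (p.compile c.pc).length := by
  induction h with
  | skip s => exact fun c hc _ => ⟨c, .nil _, hc, rfl⟩
  | prim p s hB => exact fun c hc hP => p.steps hc hP hB
  | output s =>
    intro c hc hP
    have h1 : Holds inp B s (RAMInstr.exec c .output) := hc.jump _
    have := Steps.single (P := P) (i := .output) hP.head h1.bounded
    rw [RAMInstr.label, hc.out] at this
    exact ⟨_, this, h1, rfl⟩
  | seq _ _ ih₁ ih₂ =>
    intro c hc hP
    obtain ⟨c₁, st₁, h₁, p₁⟩ := ih₁ c hc hP.left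
    obtain ⟨c₂, st₂, h₂, p₂⟩ := ih₂ c₁ h₁ (by rw [p₁]; exact hP.right)
    refine ⟨c₂, st₁.append st₂, h₂, ?_⟩
    rw [p₂, p₁]
    simp [Cmd.compile, add_assoc]
  | @ifz_zero r a b s s' τ hz _ ih =>
    intro c hc hP
    set l := c.pc + 1 + (b.compile (c.pc + 1)).length + 1 with hl
    have e : RAMInstr.exec c (.jumpZero r.reg l) = { c with pc := l } := by
      simp [RAMInstr.exec, hc.sc, hz]
    have h1 := hc.jump l
    have hP' : CodeAt P l (a.compile l) := by
      have := hP.right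
      simpa [hl, add_assoc, add_comm, add_left_comm] using this
    obtain ⟨c₁, st₁, h₁, p₁⟩ := ih _ h1 hP'
    rw [← e] at st₁ h1
    refine ⟨c₁, .cons (i := .jumpZero r.reg l) hP.left.left.head h1.bounded st₁, h₁, ?_⟩
    rw [p₁]
    simp [Cmd.compile, ← hl]
    omega
  | @ifz_ne r a b s s' τ hz _ ih =>
    intro c hc hP
    set l := c.pc + 1 + (b.compile (c.pc + 1)).length + 1 with hl
    have e : RAMInstr.exec c (.jumpZero r.reg l) = { c with pc := c.pc + 1 } := by
      simp [RAMInstr.exec, hc.sc, hz]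
    have h1 := hc.jump (c.pc + 1)
    obtain ⟨c₁, st₁, h₁, p₁⟩ := ih _ h1 hP.left.left.right
    rw [← e] at st₁ h1
    have h2 := h₁.jump (l + (a.compile l).length)
    refine ⟨_, .cons (i := .jumpZero r.reg l) hP.left.left.head h1.bounded
      (st₁.append (.single (i := .jump (l + (a.compile l).length)) ?_ h2.bounded)), h2, ?_⟩
    · rw [p₁]
      have := hP.left.right.head
      rw [← hl] at this
      simpa [add_assoc, add_comm, add_left_comm] using this
    · simp [Cmd.compile, RAMInstr.exec, hl]
      omega
  | @loop_zero r b s hz =>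
    intro c hc hP
    set l := c.pc + 1 + (b.compile (c.pc + 1)).length + 1 with hl
    have e : RAMInstr.exec c (.jumpZero r.reg l) = { c with pc := l } := by
      simp [RAMInstr.exec, hc.sc, hz]
    have h1 := hc.jump l
    rw [← e] at h1
    refine ⟨_, .single (i := .jumpZero r.reg l) hP.left.left.head h1.bounded, h1, ?_⟩
    rw [e]
    simp [Cmd.compile]
    omega
  | @loop_ne r b s s₁ s₂ τ₁ τ₂ hz _ _ ih₁ ih₂ =>
    intro c hc hP
    set l := c.pc + 1 + (b.compile (c.pc + 1)).length + 1 with hl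
    have e : RAMInstr.exec c (.jumpZero r.reg l) = { c with pc := c.pc + 1 } := by
      simp [RAMInstr.exec, hc.sc, hz]
    have h1 := hc.jump (c.pc + 1)
    obtain ⟨c₁, st₁, h₁, p₁⟩ := ih₁ _ h1 hP.left.right
    rw [← e] at st₁ h1
    have h2 := h₁.jump c.pc
    -- The jump returns to the line where the same loop stands, so the hypothesis on the code serves
    -- for the remaining rounds too.
    obtain ⟨c₂, st₂, h₃, p₂⟩ := ih₂ _ h2 hP
    refine ⟨c₂, .cons (i := .jumpZero r.reg l) hP.left.left.head h1.bounded
      (st₁.append (.cons (i := .jump c.pc) ?_ h2.bounded st₂)), h₃, p₂⟩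
    rw [p₁]
    have := hP.right.head
    simpa [add_assoc, add_comm, add_left_comm] using this


/-! ### Runs of compiled programs -/

theorem Steps.iterate {P : RAMProgram} {B : ℕ} {c c' : RAMConfig} {τ : Trace}
    (h : Steps P B c τ c') : P.step^[τ.length] c = c' := by
  induction h with
  | nil => rfl
  | @cons c c' i τ hi _ _ ih =>
    rw [List.length_cons, Function.iterate_succ_apply, ← ih]
    simp [RAMProgram.step, hi]

theorem Steps.getElem {P : RAMProgram} {B : ℕ} {c c' : RAMConfig} {τ : Trace}
    (h : Steps P B c τ c') : ∀ t < τ.length, ∃ i, P[(P.step^[t] c).pc]? = some i ∧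
      τ[t]? = some (i.label (P.step^[t] c)) := by
  induction h with
  | nil => simp
  | @cons c c' i τ hi _ _ ih =>
    rintro (_ | t) ht
    · exact ⟨i, hi, rfl⟩
    · obtain ⟨j, hj⟩ := ih t (by simpa using ht)
      refine ⟨j, ?_⟩
      have : P.step c = i.exec c := by simp [RAMProgram.step, hi]
      rw [Function.iterate_succ_apply, this]
      simpa using hj

theorem Steps.bounded {P : RAMProgram} {B : ℕ} {c c' : RAMConfig} {τ : Trace}
    (h : Steps P B c τ c') (hc : c.Bounded B) :
    ∀ t ≤ τ.length, (P.step^[t] c).Bounded B := by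
  induction h with
  | nil => simpa using hc
  | @cons c c' i τ hi hb _ ih =>
    rintro (_ | t) ht
    · exact hc
    · have : P.step c = i.exec c := by simp [RAMProgram.step, hi]
      rw [Function.iterate_succ_apply, this]
      exact ih hb t (by simpa using ht)

/-- The store at the start. -/
def Store.init : Store := ⟨fun _ => 0, fun _ => 0, fun _ => 0, fun _ => 0⟩

section Run

variable {w : List ℕ} {B : ℕ} {p : Cmd} {s : Store} {τ : Trace}

theorem Exec.run_steps (h : Exec (fun i => w.getD i 0) B p .init τ s) :
    ∃ c', Steps (p.compile 0) B (RAMProgram.run (p.compile 0) w 0) τ c' ∧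
      Holds (fun i => w.getD i 0) B s c' ∧ c'.pc = (p.compile 0).length := by
  have := h.steps (P := p.compile 0) (RAMProgram.run (p.compile 0) w 0)
    ⟨rfl, fun _ => rfl, fun _ => rfl, fun _ => rfl, rfl, fun _ => ⟨Nat.zero_le _, Nat.zero_le _⟩⟩
    (fun i x hx => by simpa [RAMProgram.run] using hx)
  simpa [RAMProgram.run] using this

/-- The program counter ends just past the last line, and there `step` is the identity. -/
theorem Exec.run_of_le (h : Exec (fun i => w.getD i 0) B p .init τ s) {t : ℕ} (ht : τ.length ≤ t) :
    RAMProgram.run (p.compile 0) w t = RAMProgram.run (p.compile 0) w τ.length ∧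
    RAMProgram.Halted (p.compile 0) w t := by
  obtain ⟨c', st, hc, hpc⟩ := h.run_steps
  have hn : (p.compile 0)[c'.pc]? = none := by simp [hpc]
  have hstep : RAMProgram.step (p.compile 0) c' = c' := by simp [RAMProgram.step, hn]
  have e : RAMProgram.run (p.compile 0) w τ.length = c' := st.iterate
  have e' : RAMProgram.run (p.compile 0) w t = c' := by
    obtain ⟨k, rfl⟩ := Nat.exists_eq_add_of_le ht
    rw [RAMProgram.run, add_comm, Function.iterate_add_apply]
    exact (congrArg _ e).trans (Function.iterate_fixed hstep k)
  exact ⟨e'.trans e.symm, by rw [RAMProgram.Halted, e']; exact hn⟩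

theorem Exec.reg_zero (h : Exec (fun i => w.getD i 0) B p .init τ s) :
    (RAMProgram.run (p.compile 0) w τ.length).reg 0 = s.sc .ans := by
  obtain ⟨c', st, hc, hpc⟩ := h.run_steps
  have e : RAMProgram.run (p.compile 0) w τ.length = c' := st.iterate
  rw [e]
  exact hc.sc .ans

theorem Exec.wordsBounded (h : Exec (fun i => w.getD i 0) B p .init τ s) :
    RAMProgram.WordsBounded (p.compile 0) w B := by
  obtain ⟨c', st, hc, hpc⟩ := h.run_steps
  have hb := st.bounded fun _ => ⟨Nat.zero_le _, Nat.zero_le _⟩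
  intro t
  rcases le_total t τ.length with ht | ht
  · exact hb t ht
  · rw [(h.run_of_le ht).1]
    exact hb _ le_rfl

/-- This transfers every question about output times and output words to positions in the trace;
beyond the trace the machine has stopped. -/
theorem Exec.outputs_iff (h : Exec (fun i => w.getD i 0) B p .init τ s) (t : ℕ) (u : List ℕ) :
    (RAMProgram.Outputs (p.compile 0) w t ∧ RAMProgram.outputWord (p.compile 0) w t = u) ↔
      τ[t]? = some (some u) := by
  obtain ⟨c', st, hc, hpc⟩ := h.run_steps
  rcases lt_or_ge t τ.length with ht | ht
  · obtain ⟨i, hi, hτ⟩ := st.getElem t ht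
    have hi' : (p.compile 0)[(RAMProgram.run (p.compile 0) w t).pc]? = some i := hi
    rw [hτ, RAMProgram.Outputs, hi', Option.some_inj, Option.some_inj]
    constructor
    · rintro ⟨rfl, rfl⟩
      rfl
    · intro hl
      cases i <;> simp only [RAMInstr.label, reduceCtorEq, Option.some_inj] at hl
      exact ⟨rfl, hl⟩
  · have := (h.run_of_le ht).2
    rw [RAMProgram.Halted] at this
    rw [RAMProgram.Outputs, this, List.getElem?_eq_none ht]
    simp

end Run

/-! ### Traces with bounded delay -/

/-- The trace `τ` outputs the words of `L` in this order, with at most `g₀` steps before the first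
output and at most `δ` steps between the outputs and after the last one. -/
inductive Delayed (δ : ℕ) : ℕ → List (List ℕ) → Trace → Prop
  | nil {g g₀} : g ≤ g₀ → Delayed δ g₀ [] (List.replicate g none)
  | cons {g g₀ w L τ} : g ≤ g₀ → Delayed δ δ L τ →
      Delayed δ g₀ (w :: L) (List.replicate g none ++ some w :: τ)

theorem getElem?_replicate_append_cons {g : ℕ} {w u : List ℕ} {τ : Trace} {t : ℕ} :
    (List.replicate g none ++ some w :: τ)[t]? = some (some u) ↔
      (t = g ∧ w = u) ∨ ∃ t', t = g + 1 + t' ∧ τ[t']? = some (some u) := by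
  rcases lt_trichotomy t g with h | rfl | h
  · rw [List.getElem?_append_left (by simpa using h)]
    simp [h]
    constructor
    · omega
    · intros; omega
  · simp
    intros; omega
  · obtain ⟨t', rfl⟩ := Nat.exists_eq_add_of_le (Nat.succ_le_of_lt h)
    rw [List.getElem?_append_right (by simp; omega)]
    have : g.succ + t' - (List.replicate g (none : Option (List ℕ))).length = t' + 1 := by
      simp; omega
    rw [this]
    simp
    omega

namespace Delayed

variable {δ g₀ : ℕ} {L : List (List ℕ)} {τ : Trace}

theorem mem_iff (h : Delayed δ g₀ L τ) (u : List ℕ) :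
    u ∈ L ↔ ∃ t : ℕ, τ[t]? = some (some u) := by
  induction h with
  | nil => simp [List.getElem?_replicate]
  | cons _ _ ih =>
    simp only [getElem?_replicate_append_cons, List.mem_cons, ih]
    constructor
    · rintro (rfl | ⟨t, ht⟩)
      · exact ⟨_, Or.inl ⟨rfl, rfl⟩⟩
      · exact ⟨_, Or.inr ⟨t, rfl, ht⟩⟩
    · rintro ⟨t, ⟨-, rfl⟩ | ⟨t', -, ht⟩⟩
      · exact Or.inl rfl
      · exact Or.inr ⟨t', ht⟩

theorem index_unique (h : Delayed δ g₀ L τ) (hL : L.Nodup) {u : List ℕ} {s t : ℕ}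
    (hs : τ[s]? = some (some u)) (ht : τ[t]? = some (some u)) : s = t := by
  induction h generalizing s t with
  | nil => simp [List.getElem?_replicate] at hs
  | cons _ h ih =>
    rw [getElem?_replicate_append_cons] at hs ht
    rw [List.nodup_cons, h.mem_iff] at hL
    rcases hs with ⟨rfl, rfl⟩ | ⟨s', rfl, hs⟩ <;> rcases ht with ⟨rfl, h'⟩ | ⟨t', rfl, ht⟩
    · rfl
    · exact (hL.1 ⟨_, ht⟩).elim
    · subst h'
      exact (hL.1 ⟨_, hs⟩).elim
    · rw [ih hL.2 hs ht]

theorem first (h : Delayed δ g₀ L τ) :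
    ∃ t : ℕ, t ≤ g₀ ∧ ((∃ u, τ[t]? = some (some u)) ∨ t = τ.length) := by
  cases h with
  | @nil g _ hg => exact ⟨g, hg, Or.inr (by simp)⟩
  | @cons g _ w _ _ hg _ =>
    exact ⟨g, hg, Or.inl ⟨w, getElem?_replicate_append_cons.2 (Or.inl ⟨rfl, rfl⟩)⟩⟩

/-- `δ` counts the silent steps between two events, while the difference of their times includes the
output step itself; hence `δ + 1`. -/
theorem next (h : Delayed δ g₀ L τ) {s : ℕ} {u : List ℕ} (hs : τ[s]? = some (some u)) :
    ∃ t : ℕ, s < t ∧ t ≤ s + (δ + 1) ∧ ((∃ u, τ[t]? = some (some u)) ∨ t = τ.length) := by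
  induction h generalizing s with
  | nil => simp [List.getElem?_replicate] at hs
  | @cons g _ w L τ _ h ih =>
    have key : ∀ t, (∃ u, τ[t]? = some (some u)) ∨ t = τ.length →
        (∃ u, (List.replicate g none ++ some w :: τ)[g + 1 + t]? = some (some u)) ∨
          g + 1 + t = (List.replicate g none ++ some w :: τ).length := by
      rintro t (⟨u, hu⟩ | rfl)
      · exact Or.inl ⟨u, getElem?_replicate_append_cons.2 (Or.inr ⟨t, rfl, hu⟩)⟩
      · exact Or.inr (by simp; omega)
    rcases getElem?_replicate_append_cons.1 hs with ⟨rfl, rfl⟩ | ⟨s', rfl, hs'⟩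
    · obtain ⟨t, ht, h⟩ := h.first
      exact ⟨_, by omega, by omega, key t h⟩
    · obtain ⟨t, h1, h2, h⟩ := ih hs'
      exact ⟨_, by omega, by omega, key t h⟩

theorem mono {g₁ : ℕ} (h : Delayed δ g₀ L τ) (hg : g₀ ≤ g₁) : Delayed δ g₁ L τ := by
  cases h with
  | nil h => exact .nil (h.trans hg)
  | cons h h' => exact .cons (h.trans hg) h'

theorem replicate_append (h : Delayed δ g₀ L τ) (k : ℕ) :
    Delayed δ (k + g₀) L (List.replicate k none ++ τ) := by
  cases h with
  | nil h =>
    rw [List.replicate_append_replicate]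
    exact .nil (by omega)
  | cons h h' =>
    rw [← List.append_assoc, List.replicate_append_replicate]
    exact .cons (by omega) h'

end Delayed

/-- A program that executes without output and in polynomial time decides a problem of `P`. -/
theorem InP.of_exec {α : Type*} {enc : α → List ℕ} {size : α → ℕ} {yes : α → Prop} (p : Cmd)
    (q : Polynomial ℕ)
    (h : ∀ a, ∃ τ s, Exec (fun i => (enc a).getD i 0) (q.eval (size a)) p .init τ s ∧
      τ.length ≤ q.eval (size a) ∧ (yes a → s.sc .ans = 1) ∧ (¬ yes a → s.sc .ans = 0)) :
    InP enc size yes := by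
  refine ⟨p.compile 0, q, fun a => ?_⟩
  obtain ⟨τ, s, he, hl, h1, h0⟩ := h a
  refine ⟨he.wordsBounded, τ.length, hl, (he.run_of_le le_rfl).2, ?_⟩
  rw [he.reg_zero]
  exact ⟨h1, h0⟩

theorem EnumerableWithDelay.of_exec {α : Type*} {enc : α → List ℕ} {size : α → ℕ}
    {A : α → Set (List ℕ)} {δ : α → ℕ} (p : Cmd) (q : Polynomial ℕ)
    (h : ∀ a, ∃ τ s L, Exec (fun i => (enc a).getD i 0) (q.eval (size a)) p .init τ s ∧
      Delayed (δ a) (q.eval (size a)) L τ ∧ L.Nodup ∧ ∀ u, u ∈ L ↔ u ∈ A a) :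
    EnumerableWithDelay enc size A (fun a => δ a + 1) := by
  refine ⟨p.compile 0, q, fun a => ?_⟩
  obtain ⟨τ, s, L, he, hd, hnd, hA⟩ := h a
  have key : ∀ t, (∃ u, τ[t]? = some (some u)) ∨ t = τ.length →
      RAMProgram.Outputs (p.compile 0) (enc a) t ∨ RAMProgram.Halted (p.compile 0) (enc a) t := by
    rintro t (⟨u, hu⟩ | rfl)
    · exact Or.inl ((he.outputs_iff t u).2 hu).1
    · exact Or.inr (he.run_of_le le_rfl).2
  refine ⟨he.wordsBounded, fun u => ?_, fun s t hs ht hst => ?_, ?_, fun s hs => ?_⟩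
  · rw [← hA, hd.mem_iff]
    exact exists_congr fun t => (he.outputs_iff t u).symm
  · exact hd.index_unique hnd ((he.outputs_iff s _).1 ⟨hs, rfl⟩)
      ((he.outputs_iff t _).1 ⟨ht, hst.symm⟩)
  · obtain ⟨t, ht, h⟩ := hd.first
    exact ⟨t, ht, key t h⟩
  · obtain ⟨t, h1, h2, h⟩ := hd.next ((he.outputs_iff s _).1 ⟨hs, rfl⟩)
    exact ⟨t, h1, h2, key t h⟩


/-! ### Timed total correctness -/

/-- From `s` the program `c` executes without output in at most `t` steps, and then `Q` holds. -/
def Trip (inp : ℕ → ℕ) (B : ℕ) (c : Cmd) (t : ℕ) (s : Store) (Q : Store → Prop) : Prop :=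
  ∃ k ≤ t, ∃ s', Exec inp B c s (List.replicate k none) s' ∧ Q s'

/-- `s'` agrees with `s` on what `c` cannot modify. -/
structure Frame (c : Cmd) (s s' : Store) : Prop where
  sc : ∀ x, ¬ c.Writes x → s'.sc x = s.sc x
  V : ¬ c.WritesV → s'.V = s.V
  W : ¬ c.WritesW → s'.W = s.W

/-- A sequence of assignments. -/
def block : List Prim → Cmd
  | [] => .skip
  | p :: L => .seq (.prim p) (block L)

def blockExec (inp : ℕ → ℕ) : List Prim → Store → Store
  | [], s => s
  | p :: L, s => blockExec inp L (p.exec inp s)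

def blockOk (inp : ℕ → ℕ) (B : ℕ) : List Prim → Store → Prop
  | [], _ => True
  | p :: L, s => p.Ok inp B s ∧ blockOk inp B L (p.exec inp s)

namespace Trip

variable {inp : ℕ → ℕ} {B : ℕ} {c a b : Cmd} {t t₁ t₂ : ℕ} {s : Store} {Q Q' : Store → Prop}
  {r : Slot}

theorem mono (h : Trip inp B c t₁ s Q) (ht : t₁ ≤ t₂) (hQ : ∀ s', Q s' → Q' s') :
    Trip inp B c t₂ s Q' := by
  obtain ⟨k, hk, s', he, hs⟩ := h
  exact ⟨k, hk.trans ht, s', he, hQ _ hs⟩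

theorem time (h : Trip inp B c t₁ s Q) (ht : t₁ ≤ t₂) : Trip inp B c t₂ s Q :=
  h.mono ht fun _ => id

/-- Any specification may be strengthened by what the syntax of the program guarantees. -/
theorem frame (h : Trip inp B c t s Q) : Trip inp B c t s (fun s' => Q s' ∧ Frame c s s') := by
  obtain ⟨k, hk, s', he, hs⟩ := h
  exact ⟨k, hk, s', he, hs, fun _ => he.sc_eq, he.V_eq, he.W_eq⟩

theorem skip (h : Q s) : Trip inp B .skip 0 s Q := ⟨0, le_rfl, s, .skip s, h⟩

theorem prim {p : Prim} (hp : p.Ok inp B s) (h : Q (p.exec inp s)) :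
    Trip inp B (.prim p) 6 s Q :=
  ⟨_, p.code_length_le, _, .prim p s hp, h⟩

theorem seq (h : Trip inp B a t₁ s (fun s' => Trip inp B b t₂ s' Q)) :
    Trip inp B (.seq a b) (t₁ + t₂) s Q := by
  obtain ⟨k₁, h₁, s₁, e₁, k₂, h₂, s₂, e₂, hQ⟩ := h
  refine ⟨k₁ + k₂, by omega, s₂, ?_, hQ⟩
  rw [← List.replicate_append_replicate]
  exact .seq e₁ e₂

theorem block {L : List Prim} (hL : blockOk inp B L s) (h : Q (blockExec inp L s)) :
    Trip inp B (block L) (6 * L.length) s Q := by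
  induction L generalizing s with
  | nil => exact skip h
  | cons p L ih => exact (seq (prim hL.1 (ih hL.2 h))).time (by simp; omega)

theorem ifz (h₀ : s.sc r = 0 → Trip inp B a t s Q) (h₁ : s.sc r ≠ 0 → Trip inp B b t s Q) :
    Trip inp B (.ifz r a b) (t + 2) s Q := by
  by_cases hr : s.sc r = 0
  · obtain ⟨k, hk, s', e, hQ⟩ := h₀ hr
    exact ⟨k + 1, by omega, s', .ifz_zero hr e, hQ⟩
  · obtain ⟨k, hk, s', e, hQ⟩ := h₁ hr
    refine ⟨k + 2, by omega, s', ?_, hQ⟩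
    have := Exec.ifz_ne (a := a) hr e
    rwa [List.cons_append, ← List.replicate_succ', ← List.replicate_succ] at this

/-- The overhead `2` of a round is the test and the jump back. -/
theorem loop (h₀ : s.sc r = 0 → Q s)
    (h₁ : s.sc r ≠ 0 → Trip inp B b t₁ s (fun s' => Trip inp B (.loop r b) t₂ s' Q)) :
    Trip inp B (.loop r b) (t₁ + t₂ + 2) s Q := by
  by_cases hr : s.sc r = 0
  · exact ⟨1, by omega, s, .loop_zero hr, h₀ hr⟩
  · obtain ⟨k₁, hk₁, s₁, e₁, k₂, hk₂, s₂, e₂, hQ⟩ := h₁ hr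
    refine ⟨k₁ + 1 + (k₂ + 1), by omega, s₂, ?_, hQ⟩
    have := Exec.loop_ne hr e₁ e₂
    rwa [← List.replicate_succ, ← List.replicate_succ, List.replicate_append_replicate] at this

/-- A loop with invariant `I i`, where `i` bounds the number of the remaining rounds. -/
theorem loop_inv (I : ℕ → Store → Prop) {i : ℕ} (hs : I i s)
    (hb : ∀ i s, I i s → s.sc r ≠ 0 → ∃ i', i = i' + 1 ∧ Trip inp B b t s (I i')) :
    Trip inp B (.loop r b) (i * (t + 2) + 2) s (fun s' => ∃ i', I i' s' ∧ s'.sc r = 0) := by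
  induction i generalizing s with
  | zero =>
    refine (loop (t₁ := 0) (t₂ := 0) (fun h => ⟨0, hs, h⟩) fun h => ?_).time (by omega)
    obtain ⟨i', h', -⟩ := hb 0 s hs h
    omega
  | succ i ih =>
    refine (loop (t₁ := t) (t₂ := i * (t + 2) + 2) (fun h => ⟨_, hs, h⟩) fun h => ?_).time
      (by rw [Nat.succ_mul]; omega)
    obtain ⟨i', h', h''⟩ := hb _ s hs h
    obtain rfl : i = i' := by omega
    exact h''.mono le_rfl fun s' hs' => ih hs'

end Trip

/-- For `c = N - 1, …, 0`. -/
def forDown (c N : Slot) (body : Cmd) : Cmd :=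
  .seq (.prim (.copy c N)) (.loop c (.seq (.prim (.opc .sub c c 1)) body))

/-- `I i` describes the state when `i` rounds remain. The counter is decremented before the body,
which therefore sees `n - 1, …, 0` and has to preserve it. As the loop itself changes the counter,
`I` must not depend on it. A round costs `8` more than its body: the decrement, the test and the
jump. -/
theorem Trip.forDown {inp : ℕ → ℕ} {B t n : ℕ} {c N : Slot} {body : Cmd} {s : Store}
    (I : ℕ → Store → Prop) (hB : 1 ≤ B) (hN : s.sc N = n) (hs : I n s)
    (hset : ∀ i s v, I i s → I i { s with sc := Function.update s.sc c v })
    (hb : ∀ i < n, ∀ s, I (i + 1) s → s.sc c = i →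
      Trip inp B body t s (fun s' => I i s' ∧ s'.sc c = i)) :
    Trip inp B (forDown c N body) (n * (t + 8) + 8) s (I 0) := by
  refine (Trip.seq (t₁ := 6) (t₂ := n * (6 + t + 2) + 2) (Trip.prim (p := .copy c N) trivial ?_)).time ?_
  · refine (Trip.loop_inv (t := 6 + t) (fun i s => I i s ∧ s.sc c = i ∧ i ≤ n)
      ⟨hset _ _ _ hs, by simp [hN], le_rfl⟩ ?_).mono le_rfl ?_
    · rintro i s ⟨hi, hc, hin⟩ hr
      obtain ⟨i', rfl⟩ := Nat.exists_eq_succ_of_ne_zero (hc ▸ hr)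
      refine ⟨i', rfl, Trip.seq (Trip.prim (p := .opc .sub c c 1) ⟨hB, trivial⟩ ?_)⟩
      refine (hb i' hin _ (hset _ _ _ hi) (by simp [ArithOp.fn, hc])).mono le_rfl ?_
      rintro s' ⟨h1, h2⟩
      exact ⟨h1, h2, (Nat.le_succ _).trans hin⟩
    · rintro s' ⟨i, ⟨hi, hc, -⟩, h0⟩
      obtain rfl : i = 0 := hc.symm.trans h0
      exact hi
  · have : 6 + t + 2 = t + 8 := by omega
    rw [this]
    omega

/-- `val := g tmp`, for a function given by its table. -/
def table : ℕ → (ℕ → ℕ) → Cmd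
  | 0, _ => .skip
  | N + 1, g => .ifz .tmp (.prim (.const .val (g 0)))
      (.seq (.prim (.opc .sub .tmp .tmp 1)) (table N fun x => g (x + 1)))

theorem table_writes {N : ℕ} {g : ℕ → ℕ} {x : Slot} (h : (table N g).Writes x) :
    x = .tmp ∨ x = .val := by
  induction N generalizing g with
  | zero => exact h.elim
  | succ N ih =>
    simp only [table, Cmd.Writes] at h
    rcases h with h | h | h
    · exact Or.inr h
    · exact Or.inl h
    · exact ih h

theorem table_not_writesV (N : ℕ) (g : ℕ → ℕ) : ¬ (table N g).WritesV := by
  induction N generalizing g with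
  | zero => exact id
  | succ N ih => simp [table, Cmd.WritesV, ih]

theorem table_not_writesW (N : ℕ) (g : ℕ → ℕ) : ¬ (table N g).WritesW := by
  induction N generalizing g with
  | zero => exact id
  | succ N ih => simp [table, Cmd.WritesW, ih]

/-- The function is unrolled into a cascade of `N` tests, each costing at most a branch and a
decrement. Nothing is assumed about how `g` is obtained, so an arbitrary finite table can be built
into a program. -/
theorem Trip.table {inp : ℕ → ℕ} {B N : ℕ} {g : ℕ → ℕ} {s : Store} (hB : 1 ≤ B)
    (hg : ∀ x < N, g x ≤ B) (hs : s.sc .tmp < N) :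
    Trip inp B (table N g) (8 * N) s (fun s' => s'.sc .val = g (s.sc .tmp)) := by
  induction N generalizing g s with
  | zero => exact (Nat.not_lt_zero _ hs).elim
  | succ N ih =>
    refine (Trip.ifz (t := 6 + 8 * N) (fun h => ?_) (fun h => ?_)).time (by omega)
    · exact (Trip.prim (p := .const .val (g 0)) (hg 0 (Nat.succ_pos _)) (by simp [Prim.exec, h])).time (by omega)
    · refine Trip.seq (Trip.prim (p := .opc .sub .tmp .tmp 1) ⟨hB, trivial⟩ ?_)
      refine (ih (g := fun x => g (x + 1)) (fun x hx => hg _ (by omega)) ?_).mono le_rfl ?_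
      · simp [Prim.exec, ArithOp.fn]; omega
      · intro s' hs'
        rw [hs']
        simp only [Prim.exec, ArithOp.fn, Function.update_self]
        congr 1
        omega

/-! ### Nested loops -/

/-- The pairs obtained from `(a, u)` by appending `j` digits `i < N` to `a` in base `n` and the
corresponding digits `v i` to `u` in base `d`. -/
def paths (n d N : ℕ) (v : ℕ → ℕ) : ℕ → ℕ → ℕ → Set (ℕ × ℕ)
  | 0, a, u => {(a, u)}
  | j + 1, a, u => {p | ∃ i < N, p ∈ paths n d N v j (a * n + i) (u * d + v i)}

/-- The body is executed for all choices of `j` digits, with the pairs of `paths` in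
`addr 0`, `word 0`. -/
def nest (d : ℕ) (N : Slot) (body : Cmd) : ℕ → Cmd
  | 0 => body
  | j + 1 => forDown (.cnt j) N (.seq (block
      [.op .mul (.addr j) (.addr (j + 1)) .dim, .op .add (.addr j) (.addr j) (.cnt j),
        .getV .tmp (.cnt j),
        .opc .mul (.word j) (.word (j + 1)) d, .op .add (.word j) (.word j) .tmp])
      (nest d N body j))

theorem nest_writes {d : ℕ} {N : Slot} {body : Cmd} {j : ℕ} {x : Slot}
    (h : (nest d N body j).Writes x) :
    body.Writes x ∨ x = .tmp ∨ ∃ i < j, x = .cnt i ∨ x = .addr i ∨ x = .word i := by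
  induction j with
  | zero => exact Or.inl h
  | succ j ih =>
    simp only [nest, forDown, block, Cmd.Writes, or_false] at h
    rcases h with h | h | h | h
    · exact Or.inr (Or.inr ⟨j, by omega, Or.inl h⟩)
    · exact Or.inr (Or.inr ⟨j, by omega, Or.inl h⟩)
    · rcases h with h | h | h | h | h
      · exact Or.inr (Or.inr ⟨j, by omega, Or.inr (Or.inl h)⟩)
      · exact Or.inr (Or.inr ⟨j, by omega, Or.inr (Or.inl h)⟩)
      · exact Or.inr (Or.inl h)
      · exact Or.inr (Or.inr ⟨j, by omega, Or.inr (Or.inr h)⟩)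
      · exact Or.inr (Or.inr ⟨j, by omega, Or.inr (Or.inr h)⟩)
    · rcases ih h with h | h | ⟨i, hi, h⟩
      · exact Or.inl h
      · exact Or.inr (Or.inl h)
      · exact Or.inr (Or.inr ⟨i, by omega, h⟩)

/-- The variables that nested loops use internally. -/
def Slot.IsLoop : Slot → Prop
  | .tmp | .val | .cnt _ | .addr _ | .word _ => True
  | _ => False

/-- `30` pays for the five assignments that append a digit, the two `8` for the loop. -/
def nestTime (N t : ℕ) : ℕ → ℕ
  | 0 => t
  | j + 1 => N * (30 + nestTime N t j + 8) + 8

/-- `I X` means that the pairs in `X` have been treated; one execution of the body adds one pair.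
`M` and `U` bound the completed numbers: `j` further digits keep a number `a` below `(a + 1) * n ^
j`. The digit range `N` is separate from the base `n` because the test of a level uses only the
coordinates up to that level. -/
theorem Trip.nest {inp : ℕ → ℕ} {B n d N M U t : ℕ} {v : ℕ → ℕ} {N₀ : Slot} {body : Cmd}
    (I : Set (ℕ × ℕ) → Store → Prop) (hMB : M ≤ B) (hUB : U ≤ B) (hdB : d ≤ B)
    (hnB : 4 * n + 1 ≤ B) (hNn : N ≤ n) (hv : ∀ i < N, v i < d)
    (hI : ∀ X s, I X s → s.sc .dim = n ∧ s.sc N₀ = N ∧ ∀ i < N, s.V i = v i)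
    (hframe : ∀ X s s', I X s → s'.V = s.V → s'.W = s.W →
      (∀ x : Slot, ¬ x.IsLoop → s'.sc x = s.sc x) → I X s')
    (hwr : ∀ i, ¬ body.Writes (.cnt i) ∧ ¬ body.Writes (.addr i) ∧ ¬ body.Writes (.word i))
    (hbody : ∀ X s, I X s → s.sc (.addr 0) < M → s.sc (.word 0) < U →
      Trip inp B body t s (I (insert (s.sc (.addr 0), s.sc (.word 0)) X)))
    (j : ℕ) : ∀ X s, I X s → (s.sc (.addr j) + 1) * n ^ j ≤ M → (s.sc (.word j) + 1) * d ^ j ≤ U →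
      Trip inp B (nest d N₀ body j) (nestTime N t j) s
        (I (X ∪ paths n d N v j (s.sc (.addr j)) (s.sc (.word j)))) := by
  induction j with
  | zero =>
    intro X s hs h1 h2
    have := hbody X s hs (by simpa using h1) (by simpa using h2)
    simpa [paths, Set.union_singleton, nestTime, _root_.nest] using this
  | succ j ih =>
    intro X s hs h1 h2
    set a := s.sc (.addr (j + 1)) with ha
    set u := s.sc (.word (j + 1)) with hu
    -- The counter decreases, so the digits already treated are those `k ≥ i`.
    refine (Trip.forDown (fun i s => I (X ∪ {p | ∃ k < N, i ≤ k ∧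
      p ∈ paths n d N v j (a * n + k) (u * d + v k)}) s ∧ s.sc (.addr (j + 1)) = a ∧
      s.sc (.word (j + 1)) = u) (n := N) (t := 30 + nestTime N t j) (by omega)
      (hI _ _ hs).2.1 ?_ ?_ ?_).mono le_rfl ?_
    · refine ⟨?_, ha.symm, hu.symm⟩
      convert hs using 1
      ext p
      simp only [Set.mem_union, Set.mem_ofPred_eq, or_iff_left_iff_imp]
      rintro ⟨k, h, h', -⟩
      omega
    · rintro i s x ⟨h, h', h''⟩
      refine ⟨hframe _ _ _ h rfl rfl fun y hy => ?_, by simpa using h', by simpa using h''⟩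
      have : y ≠ .cnt j := by rintro rfl; exact hy trivial
      simp [Function.update_of_ne this]
    · rintro i hi s ⟨hIs, ha', hu'⟩ hc
      obtain ⟨hdim, -, hV⟩ := hI _ _ hIs
      have hn : 1 ≤ n := by omega
      have hd : 1 ≤ d := by have := hv i hi; omega
      -- Since `i < N ≤ n`, one has `a * n + i + 1 ≤ (a + 1) * n`: the appended digit uses up one
      -- factor `n` of the budget.
      have h1' : (a * n + i + 1) * n ^ j ≤ M := by
        refine le_trans ?_ h1
        rw [pow_succ', ← mul_assoc]
        gcongr
        rw [add_mul]; omega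
      have h2' : (u * d + v i + 1) * d ^ j ≤ U := by
        refine le_trans ?_ h2
        rw [pow_succ', ← mul_assoc]
        gcongr
        have := hv i hi
        rw [add_mul]; omega
      have b1 : a * n + i + 1 ≤ M := (Nat.le_mul_of_pos_right _ (by positivity)).trans h1'
      have b2 : u * d + v i + 1 ≤ U := (Nat.le_mul_of_pos_right _ (by positivity)).trans h2'
      refine Trip.seq (Trip.block ?_ ?_)
      · simp [blockOk, Prim.Ok, Prim.exec, ArithOp.Ok, ArithOp.fn, ha', hu',
          hdim, hc, hV i hi]
        omega
      · set s₁ := blockExec inp [.op .mul (.addr j) (.addr (j + 1)) .dim,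
          .op .add (.addr j) (.addr j) (.cnt j), .getV .tmp (.cnt j),
          .opc .mul (.word j) (.word (j + 1)) d, .op .add (.word j) (.word j) .tmp] s with hs₁
        have e1 : s₁.sc (.addr j) = a * n + i := by
          simp [s₁, blockExec, Prim.exec, ArithOp.fn, ha', hdim, hc]
        have e2 : s₁.sc (.word j) = u * d + v i := by
          simp [s₁, blockExec, Prim.exec, ArithOp.fn, hu', hc, hV i hi]
        have e3 : s₁.sc (.addr (j + 1)) = a := by
          simp [s₁, blockExec, Prim.exec, ArithOp.fn, ha']
        have e4 : s₁.sc (.word (j + 1)) = u := by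
          simp [s₁, blockExec, Prim.exec, ArithOp.fn, hu']
        have e5 : s₁.sc (.cnt j) = i := by
          simp [s₁, blockExec, Prim.exec, ArithOp.fn, hc]
        have e6 := hframe _ _ s₁ hIs rfl rfl fun x hx => by
          have : ∀ y : Slot, y.IsLoop → x ≠ y := fun y hy h => hx (h ▸ hy)
          simp [s₁, blockExec, Prim.exec, Function.update_of_ne, this (.addr j) trivial,
            this (.word j) trivial, this .tmp trivial]
        refine (ih _ s₁ e6 (by rw [e1]; exact h1') (by rw [e2]; exact h2')).frame.mono le_rfl ?_
        rintro s' ⟨hs', hf⟩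
        -- The inner loops write only `tmp`, loop variables of index below `j`, and what the body
        -- writes; the counter `j` and the prefixes of index `j + 1` survive.
        have keep : ∀ x, ¬ body.Writes x → x ≠ .tmp → (∀ i < j, x ≠ .cnt i ∧ x ≠ .addr i ∧
            x ≠ .word i) → s'.sc x = s₁.sc x := fun x h1 h2 h3 => hf.sc x fun h => by
          rcases nest_writes h with h | h | ⟨i, hi, h⟩
          · exact h1 h
          · exact h2 h
          · have := h3 i hi
            tauto
        refine ⟨⟨?_, ?_, ?_⟩, ?_⟩
        · convert hs' using 1
          rw [e1, e2]
          ext p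
          simp only [Set.mem_union, Set.mem_ofPred_eq, or_assoc]
          refine or_congr_right ⟨?_, ?_⟩
          · rintro ⟨k, h, h', hp⟩
            rcases Nat.eq_or_lt_of_le h' with rfl | h''
            · exact Or.inr hp
            · exact Or.inl ⟨k, h, h'', hp⟩
          · rintro (⟨k, h, h', hp⟩ | hp)
            · exact ⟨k, h, by omega, hp⟩
            · exact ⟨i, hi, le_rfl, hp⟩
        · rw [keep _ (hwr _).2.1 (by simp) (fun i hi => by simp; omega), e3]
        · rw [keep _ (hwr _).2.2 (by simp) (fun i hi => by simp; omega), e4]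
        · rw [keep _ (hwr _).1 (by simp) (fun i hi => by simp; omega), e5]
    · rintro s' ⟨h, -, -⟩
      simpa [paths] using h


/-! ### The table of projections and the test of one coordinate -/

/-- The values and addresses that depend on `n`, `d` and `r` fit into the registers. -/
structure Fits (n d r B : ℕ) : Prop where
  table : 2 ^ d ^ (r + 1) * d ^ (r + 1) ≤ B
  mask : 2 ^ d ^ (r + 1) ≤ B
  base : d + 1 ≤ B
  power : d ^ (r + 1) ≤ B
  addr : 4 * n ^ (r + 1) + 2 ≤ B
  dim : 4 * n + 5 ≤ B

/-- `val := g W[addr 0] (word 0)`. -/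
def lookup (U : ℕ) (g : ℕ → ℕ → ℕ) : Cmd :=
  .seq (block [.getW .tmp (.addr 0), .opc .mul .tmp .tmp U, .op .add .tmp .tmp (.word 0)])
    (table (2 ^ U * U) fun x => g (x / U) (x % U))

theorem lookup_writes {U : ℕ} {g : ℕ → ℕ → ℕ} {x : Slot} (h : (lookup U g).Writes x) :
    x = .tmp ∨ x = .val := by
  simp only [lookup, block, Cmd.Writes, or_false] at h
  rcases h with h | h
  · tauto
  · exact table_writes h

/-- A mask `q < 2 ^ U` and an element `u < U` are packed as `q * U + u`, and division by `U`
recovers them. The table has `2 ^ U * U` entries, so for fixed `U` a lookup takes constant time. -/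
theorem Trip.lookup {inp : ℕ → ℕ} {B U : ℕ} {g : ℕ → ℕ → ℕ} {s : Store} (hT : 2 ^ U * U ≤ B)
    (hB : 1 ≤ B) (hg : ∀ q < 2 ^ U, ∀ u < U, g q u ≤ B) (ha : 4 * s.sc (.addr 0) + 2 ≤ B)
    (hW : s.W (s.sc (.addr 0)) < 2 ^ U) (hu : s.sc (.word 0) < U) :
    Trip inp B (lookup U g) (18 + 8 * (2 ^ U * U)) s (fun s' =>
      s'.sc .val = g (s.W (s.sc (.addr 0))) (s.sc (.word 0)) ∧ s'.V = s.V ∧ s'.W = s.W ∧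
      ∀ x : Slot, x ≠ .tmp → x ≠ .val → s'.sc x = s.sc x) := by
  set q := s.W (s.sc (.addr 0)) with hq
  set u := s.sc (.word 0) with hu'
  have hU : 0 < U := by omega
  have hlt : q * U + u < 2 ^ U * U := by
    calc q * U + u < (q + 1) * U := by rw [add_mul]; omega
      _ ≤ _ := Nat.mul_le_mul_right _ hW
  have key : Trip inp B (_root_.lookup U g) (18 + 8 * (2 ^ U * U)) s
      (fun s' => s'.sc .val = g q u) := by
    refine Trip.seq (Trip.block ?_ ?_)
    · have h1 : U ≤ B := (Nat.le_mul_of_pos_left _ (by positivity)).trans hT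
      simp [blockOk, Prim.Ok, Prim.exec, ArithOp.Ok, ArithOp.fn, ← hq, ← hu']
      omega
    · refine (Trip.table hB (fun x hx => ?_) ?_).mono le_rfl ?_
      · exact hg _ (Nat.div_lt_of_lt_mul (by rwa [mul_comm])) _ (Nat.mod_lt _ hU)
      · simpa [blockExec, Prim.exec, ArithOp.fn, ← hq, ← hu'] using hlt
      · intro s' hs'
        rw [hs']
        have : (q * U + u) / U = q := by
          rw [mul_comm, Nat.mul_add_div hU, Nat.div_eq_of_lt hu, add_zero]
        have h2 : (q * U + u) % U = u := by
          rw [mul_comm, Nat.mul_add_mod, Nat.mod_eq_of_lt hu]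
        simp [blockExec, Prim.exec, ArithOp.fn, ← hq, ← hu', this, h2]
  refine key.frame.mono le_rfl ?_
  rintro s' ⟨h, hf⟩
  refine ⟨h, hf.V ?_, hf.W ?_, fun x h1 h2 => hf.sc x fun h => ?_⟩
  · simp [_root_.lookup, _root_.block, Cmd.WritesV, table_not_writesV]
  · simp [_root_.lookup, _root_.block, Cmd.WritesW, table_not_writesW]
  · rcases lookup_writes h with h | h
    · exact h1 h
    · exact h2 h

/-- `W[addr 0]` receives the element `word 0`, as a bit mask. -/
def mark (U : ℕ) : Cmd :=
  .seq (lookup U fun q u => q ||| 2 ^ u) (block [.setW (.addr 0) .val])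

def markTime (U : ℕ) : ℕ := 18 + 8 * (2 ^ U * U) + 6

theorem Trip.mark {inp : ℕ → ℕ} {B U : ℕ} {s : Store} (hT : 2 ^ U * U ≤ B) (hB : 2 ^ U ≤ B)
    (ha : 4 * s.sc (.addr 0) + 2 ≤ B) (hW : s.W (s.sc (.addr 0)) < 2 ^ U)
    (hu : s.sc (.word 0) < U) :
    Trip inp B (mark U) (markTime U) s (fun s' =>
      s'.W = Function.update s.W (s.sc (.addr 0))
        (s.W (s.sc (.addr 0)) ||| 2 ^ s.sc (.word 0)) ∧ s'.V = s.V ∧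
      ∀ x : Slot, x ≠ .tmp → x ≠ .val → s'.sc x = s.sc x) := by
  refine Trip.seq ((Trip.lookup hT (Nat.one_le_two_pow.trans hB) ?_ ha hW hu).mono le_rfl ?_)
  · exact fun q hq u hu => (Nat.or_lt_two_pow hq (Nat.pow_lt_pow_right (by omega) hu)).le.trans hB
  · rintro s' ⟨h1, h2, h3, h4⟩
    have e := h4 (.addr 0) (by simp) (by simp)
    refine Trip.block ?_ ?_
    · simpa [blockOk, Prim.Ok, e] using ha
    · simp only [blockExec, Prim.exec, h1, h2, h3, e]
      exact ⟨trivial, trivial, h4⟩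

/-- Record the projections of the vector `V` to all tuples of `r + 1` coordinates. -/
def markAll (d r : ℕ) : Cmd :=
  .seq (block [.const (.addr (r + 1)) 0, .const (.word (r + 1)) 0])
    (nest d .dim (mark (d ^ (r + 1))) (r + 1))

def markAllTime (n d r : ℕ) : ℕ := 12 + nestTime n (markTime (d ^ (r + 1))) (r + 1)

section

variable {inp : ℕ → ℕ} {B n d r : ℕ} {s : Store}

theorem Trip.markAll (hB : Fits n d r B) (hdim : s.sc .dim = n) (hV : ∀ i < n, s.V i < d)
    (hW : ∀ a, s.W a < 2 ^ d ^ (r + 1)) :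
    Trip inp B (markAll d r) (markAllTime n d r) s (fun s' => s'.V = s.V ∧
      (∀ x : Slot, ¬ x.IsLoop → s'.sc x = s.sc x) ∧ (∀ a, s'.W a < 2 ^ d ^ (r + 1)) ∧
      ∀ a u, (s'.W a).testBit u ↔
        (s.W a).testBit u ∨ (a, u) ∈ paths n d n s.V (r + 1) 0 0) := by
  have := hB.addr
  have := hB.dim
  have := hB.base
  refine Trip.seq (Trip.block (by simp [blockOk, Prim.Ok]) ?_)
  set s₁ := blockExec inp [.const (.addr (r + 1)) 0, .const (.word (r + 1)) 0] s with hs₁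
  -- Here `X` is the set of pairs (address, tuple) whose bit has been set, in addition to the bits
  -- present at the start.
  refine (Trip.nest (N := n) (M := n ^ (r + 1)) (U := d ^ (r + 1)) (v := s.V)
    (fun X s' => s'.V = s.V ∧
      (∀ x : Slot, ¬ x.IsLoop → s'.sc x = s.sc x) ∧ (∀ a, s'.W a < 2 ^ d ^ (r + 1)) ∧
      ∀ a u, (s'.W a).testBit u ↔ (s.W a).testBit u ∨ (a, u) ∈ X)
    (by omega) hB.power (by omega) (by omega) le_rfl hV ?_ ?_ ?_ ?_ (r + 1) ∅ s₁ ?_ ?_ ?_).mono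
    le_rfl ?_
  · rintro X s' ⟨h1, h2, -⟩
    have := h2 .dim id
    exact ⟨by omega, by omega, fun i _ => by rw [h1]⟩
  · rintro X s' s'' ⟨h1, h2, h3, h4⟩ h5 h6 h7
    rw [h6]
    exact ⟨h5.trans h1, fun x hx => (h7 x hx).trans (h2 x hx), h3, h4⟩
  · intro i
    simp only [_root_.mark, _root_.block, Cmd.Writes, or_false]
    refine ⟨fun h => ?_, fun h => ?_, fun h => ?_⟩ <;> simpa using lookup_writes h
  · rintro X s' ⟨h1, h2, h3, h4⟩ h5 h6
    refine (Trip.mark hB.table hB.mask (by omega) (h3 _) h6).mono le_rfl ?_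
    rintro s'' ⟨h7, h8, h9⟩
    refine ⟨h8.trans h1, fun x hx => ?_, fun a => ?_, fun a u => ?_⟩
    · rw [h9 x (by rintro rfl; exact hx trivial) (by rintro rfl; exact hx trivial), h2 x hx]
    · rw [h7]
      rcases eq_or_ne a (s'.sc (.addr 0)) with rfl | ha
      · rw [Function.update_self]
        exact Nat.or_lt_two_pow (h3 _) (Nat.pow_lt_pow_right (by omega) h6)
      · rw [Function.update_of_ne ha]
        exact h3 a
    · rw [h7]
      rcases eq_or_ne a (s'.sc (.addr 0)) with rfl | ha
      · rw [Function.update_self, Nat.testBit_or, Nat.testBit_two_pow]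
        simp [h4, Set.mem_insert_iff]
        tauto
      · rw [Function.update_of_ne ha, h4]
        simp [Set.mem_insert_iff, ha]
  · refine ⟨rfl, fun x hx => ?_, hW, by simp [s₁, blockExec, Prim.exec]⟩
    have : ∀ y : Slot, y.IsLoop → x ≠ y := fun y hy h => hx (h ▸ hy)
    simp [s₁, blockExec, Prim.exec, Function.update_of_ne, this (.addr (r + 1)) trivial,
      this (.word (r + 1)) trivial]
  · simp [s₁, blockExec, Prim.exec]
  · simp [s₁, blockExec, Prim.exec]
  · intro s' hs'
    simpa [s₁, blockExec, Prim.exec] using hs'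

/-- Read a vector from the input, from position `ptr` on. -/
def loadRow : Cmd :=
  forDown .lvl .dim (block [.op .add .tmp .ptr .lvl, .read .tmp .tmp, .setV .lvl .tmp])

theorem Trip.loadRow (hn : 4 * n + 1 ≤ B) {p : ℕ} (hdim : s.sc .dim = n) (hp : s.sc .ptr = p)
    (hpB : p + n ≤ B) (hinp : ∀ j < n, inp (p + j) ≤ B) :
    Trip inp B loadRow (n * 26 + 8) s (fun s' => (∀ j < n, s'.V j = inp (p + j)) ∧
      s'.W = s.W ∧ ∀ x : Slot, x ≠ .tmp → x ≠ .lvl → s'.sc x = s.sc x) := by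
  refine (Trip.forDown (t := 18) (fun i s' => (∀ j < n, i ≤ j → s'.V j = inp (p + j)) ∧
      s'.W = s.W ∧ ∀ x : Slot, x ≠ .tmp → x ≠ .lvl → s'.sc x = s.sc x) (by omega) hdim
      ⟨by omega, rfl, fun _ _ _ => rfl⟩ ?_ ?_).mono (by omega) ?_
  · rintro i s' v ⟨h1, h2, h3⟩
    refine ⟨h1, h2, fun x hx hx' => ?_⟩
    simp [Function.update_of_ne hx', h3 x hx hx']
  · rintro i hi s' ⟨h1, h2, h3⟩ hl
    have e := h3 .ptr (by simp) (by simp)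
    refine Trip.block ?_ ?_
    · simp only [blockOk, Prim.Ok, Prim.exec, ArithOp.Ok, ArithOp.fn, e, hp, hl]
      have := hinp i hi
      simp [hl, this]
      omega
    · refine ⟨⟨fun j hj hij => ?_, h2, fun x hx hx' => ?_⟩, by simp [blockExec, Prim.exec, hl]⟩
      · rcases Nat.eq_or_lt_of_le hij with rfl | hij
        · simp [blockExec, Prim.exec, ArithOp.fn, hl, e, hp]
        · have : j ≠ i := by omega
          simp [blockExec, Prim.exec, hl, Function.update_of_ne this, h1 j hj hij]
      · simp [blockExec, Prim.exec, Function.update_of_ne hx, h3 x hx hx']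
  · rintro s' ⟨h1, h2, h3⟩
    exact ⟨fun j hj => h1 j hj (Nat.zero_le _), h2, h3⟩

/-- Record the projections of all vectors of the input. -/
def precompute (d r : ℕ) : Cmd :=
  forDown .row .rows (.seq loadRow (.seq (block [.op .add .ptr .ptr .dim]) (markAll d r)))

def precomputeTime (n m d r : ℕ) : ℕ := m * (n * 26 + 8 + (6 + markAllTime n d r) + 8) + 8

theorem Trip.precompute (hB : Fits n d r B) {m p : ℕ} (hdim : s.sc .dim = n)
    (hrows : s.sc .rows = m) (hp : s.sc .ptr = p) (hpB : p + m * n ≤ B)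
    (hinp : ∀ k < m, ∀ j < n, inp (p + k * n + j) < d) (hW : ∀ a, s.W a = 0) :
    Trip inp B (precompute d r) (precomputeTime n m d r) s (fun s' =>
      (∀ a, s'.W a < 2 ^ d ^ (r + 1)) ∧
      (∀ a u, (s'.W a).testBit u ↔
        ∃ k < m, (a, u) ∈ paths n d n (fun j => inp (p + k * n + j)) (r + 1) 0 0) ∧
      s'.sc .dim = n ∧ s'.sc .rows = m) := by
  have := hB.base
  have := hB.dim
  -- The loop counts down while `ptr` moves up: with `i` rounds left, the recorded rows are those
  -- with `k < m - i`.
  refine (Trip.forDown (t := n * 26 + 8 + (6 + markAllTime n d r)) (fun i s' =>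
      (∀ a, s'.W a < 2 ^ d ^ (r + 1)) ∧
      (∀ a u, (s'.W a).testBit u ↔
        ∃ k < m, i + k < m ∧ (a, u) ∈ paths n d n (fun j => inp (p + k * n + j)) (r + 1) 0 0) ∧
      s'.sc .dim = n ∧ s'.sc .rows = m ∧ s'.sc .ptr = p + (m - i) * n) (by omega) hrows
      ?_ ?_ ?_).mono le_rfl ?_
  · refine ⟨fun a => by simp [hW], fun a u => ?_, hdim, hrows, by simp [hp]⟩
    simp only [hW, Nat.zero_testBit, Bool.false_eq_true, false_iff]
    rintro ⟨k, h1, h2, -⟩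
    omega
  · rintro i s' v ⟨h1, h2, h3, h4, h5⟩
    exact ⟨h1, h2, by simpa using h3, by simpa using h4, by simpa using h5⟩
  · rintro i hi s' ⟨h1, h2, h3, h4, h5⟩ h6
    obtain ⟨k, rfl⟩ : ∃ k, m = i + 1 + k := Nat.exists_eq_add_of_le hi
    have hk : i + 1 + k - (i + 1) = k := by omega
    have hk' : i + 1 + k - i = k + 1 := by omega
    rw [hk] at h5
    have hle : p + k * n + n ≤ B := by
      refine le_trans ?_ hpB
      rw [add_assoc, ← Nat.succ_mul]
      gcongr
      omega
    refine Trip.seq ((Trip.loadRow (by omega) h3 h5 hle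
      fun j hj => (hinp k (by omega) j hj).le.trans (by omega)).mono le_rfl ?_)
    rintro s₁ ⟨hV, hW₁, hsc⟩
    have e1 := hsc .ptr (by simp) (by simp)
    have e2 := hsc .dim (by simp) (by simp)
    have e3 := hsc .rows (by simp) (by simp)
    have e4 := hsc .row (by simp) (by simp)
    refine Trip.seq (Trip.block ?_ ?_)
    · simpa [blockOk, Prim.Ok, ArithOp.Ok, e1, e2, h5, h3] using hle
    · refine (Trip.markAll hB (by simp [blockExec, Prim.exec, e2, h3]) (fun j hj => ?_)
        (fun a => ?_)).mono le_rfl ?_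
      · simpa [blockExec, Prim.exec, hV j hj] using hinp k (by omega) j hj
      · simpa [blockExec, Prim.exec, hW₁] using h1 a
      · rintro s₂ ⟨-, hsc₂, hW₂, hb⟩
        refine ⟨⟨hW₂, fun a u => ?_, ?_, ?_, ?_⟩, ?_⟩
        · rw [hb]
          simp only [blockExec, Prim.exec, hW₁, h2]
          -- Paths consult only the indices below `N`, so the loaded array may be replaced by the
          -- row of the input, with which it agrees only there.
          have hc : ∀ (N j a u : ℕ) (v v' : ℕ → ℕ), (∀ i < N, v i = v' i) →
              paths n d N v j a u = paths n d N v' j a u := by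
            intro N j
            induction j with
            | zero => intros; rfl
            | succ j ih =>
              intro a u v v' h
              ext q
              exact exists_congr fun i => and_congr_right fun hi => by rw [h i hi, ih _ _ v v' h]
          rw [hc n (r + 1) 0 0 s₁.V _ hV]
          constructor
          · rintro (⟨k', h, h', hm⟩ | hm)
            · exact ⟨k', h, by omega, hm⟩
            · exact ⟨k, by omega, by omega, hm⟩
          · rintro ⟨k', h, h', hm⟩
            rcases Nat.lt_or_ge k' k with hk | hk
            · exact Or.inl ⟨k', h, by omega, hm⟩
            · obtain rfl : k = k' := by omega
              exact Or.inr hm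
        · rw [hsc₂ _ id]
          simp [blockExec, Prim.exec, e2, h3]
        · rw [hsc₂ _ id]
          simp [blockExec, Prim.exec, e3, h4]
        · rw [hsc₂ _ id]
          simp [blockExec, Prim.exec, ArithOp.fn, e1, e2, h5, h3]
          rw [hk']
          ring
        · rw [hsc₂ _ id]
          simp [blockExec, Prim.exec, e4, h6]
  · rintro s' ⟨h1, h2, h3, h4, -⟩
    refine ⟨h1, fun a u => ?_, h3, h4⟩
    rw [h2]
    simp

/-! ### The test of one level -/

/-- All projections of `v` to `r + 1` coordinates that are at most `l`, and one of which is `l`,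
are allowed by `ok`, given the table `W` of the sets of projections. -/
def LevelOk (n d r : ℕ) (ok : ℕ → ℕ → Prop) (W v : ℕ → ℕ) (l : ℕ) : Prop :=
  ∀ p ∈ paths n d (l + 1) v r l (v l), ok (W p.1) p.2

open scoped Classical in
/-- `flag := 0` if `word 0` is not allowed by `ok`. -/
noncomputable def test (U : ℕ) (ok : ℕ → ℕ → Prop) : Cmd :=
  .seq (lookup U fun q u => if ok q u then 1 else 0) (block [.op .mul .flag .flag .val])

/-- `flag := 1` if level `lvl` is fine, `flag := 0` otherwise. -/
noncomputable def check (d r : ℕ) (ok : ℕ → ℕ → Prop) : Cmd :=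
  .seq (block [.const .flag 1, .opc .add .top .lvl 1, .copy (.addr r) .lvl,
      .getV (.word r) .lvl])
    (nest d .top (test (d ^ (r + 1)) ok) r)

/-- `markTime` reappears because `test`, like `mark`, is one lookup followed by one assignment.
There are `r` nested loops only, since the first coordinate of every tuple is the level itself. -/
def checkTime (n d r : ℕ) : ℕ := 24 + nestTime n (markTime (d ^ (r + 1))) r

theorem nestTime_mono {N N' t : ℕ} (h : N ≤ N') (j : ℕ) : nestTime N t j ≤ nestTime N' t j := by
  induction j with
  | zero => exact le_rfl
  | succ j ih => unfold nestTime; gcongr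

/-- `flag` starts at `1` and is multiplied by the `0`/`1` answers of the lookups, so it computes
their conjunction. The digits range below `top = l + 1`. -/
theorem Trip.check {ok : ℕ → ℕ → Prop} (hB : Fits n d r B) {l : ℕ} (hln : l < n)
    (hdim : s.sc .dim = n) (hl : s.sc .lvl = l) (hV : ∀ i ≤ l, s.V i < d)
    (hW : ∀ a, s.W a < 2 ^ d ^ (r + 1)) :
    Trip inp B (check d r ok) (checkTime n d r) s (fun s' =>
      (s'.sc .flag = 1 ∧ LevelOk n d r ok s.W s.V l ∨
        s'.sc .flag = 0 ∧ ¬ LevelOk n d r ok s.W s.V l) ∧ s'.V = s.V ∧ s'.W = s.W ∧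
      ∀ x : Slot, ¬ x.IsLoop → x ≠ .flag → x ≠ .top → s'.sc x = s.sc x) := by
  have := hB.addr
  have := hB.dim
  have := hB.base
  have hle : nestTime (l + 1) (markTime (d ^ (r + 1))) r ≤
      nestTime n (markTime (d ^ (r + 1))) r := nestTime_mono hln r
  refine (Trip.seq (t₂ := nestTime (l + 1) (markTime (d ^ (r + 1))) r) (Trip.block ?_ ?_)).time
    (Nat.add_le_add_left hle _)
  · simp [blockOk, Prim.Ok, Prim.exec, ArithOp.Ok, hl]
    omega
  set s₁ := blockExec inp [.const .flag 1, .opc .add .top .lvl 1, .copy (.addr r) .lvl,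
      .getV (.word r) .lvl] s with hs₁
  have e1 : s₁.sc (.addr r) = l := by simp [s₁, blockExec, Prim.exec, hl]
  have e2 : s₁.sc (.word r) = s.V l := by simp [s₁, blockExec, Prim.exec, hl]
  have e3 : s₁.sc .top = l + 1 := by simp [s₁, blockExec, Prim.exec, ArithOp.fn, hl]
  have e4 : s₁.sc .flag = 1 := by simp [s₁, blockExec, Prim.exec]
  have e5 : ∀ x : Slot, ¬ x.IsLoop → x ≠ .flag → x ≠ .top → s₁.sc x = s.sc x := by
    intro x hx h1 h2
    have : ∀ y : Slot, y.IsLoop → x ≠ y := fun y hy h => hx (h ▸ hy)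
    simp [s₁, blockExec, Prim.exec, Function.update_of_ne, this (.addr r) trivial,
      this (.word r) trivial, h1, h2]
  refine (Trip.nest (N := l + 1) (M := n ^ (r + 1)) (U := d ^ (r + 1)) (v := s.V)
    (fun X s' => (s'.sc .flag = 1 ∧ (∀ p ∈ X, ok (s.W p.1) p.2) ∨
        s'.sc .flag = 0 ∧ ¬ ∀ p ∈ X, ok (s.W p.1) p.2) ∧ s'.V = s.V ∧ s'.W = s.W ∧
      s'.sc .top = l + 1 ∧
      ∀ x : Slot, ¬ x.IsLoop → x ≠ .flag → x ≠ .top → s'.sc x = s.sc x)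
    (by omega) hB.power (by omega) (by omega) hln (fun i hi => hV i (by omega)) ?_ ?_ ?_ ?_ r ∅ s₁
    ?_ ?_ ?_).mono le_rfl ?_
  · rintro X s' ⟨-, h1, -, h2, h3⟩
    exact ⟨(h3 .dim id (by simp) (by simp)).trans hdim, h2, fun i _ => by rw [h1]⟩
  · rintro X s' s'' ⟨h1, h2, h3, h4, h5⟩ h6 h7 h8
    rw [h6, h7, h8 _ id, h8 _ id]
    exact ⟨h1, h2, h3, h4, fun x hx h h' => (h8 x hx).trans (h5 x hx h h')⟩
  · intro i
    simp only [test, _root_.block, Cmd.Writes, or_false, reduceCtorEq]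
    refine ⟨fun h => ?_, fun h => ?_, fun h => ?_⟩ <;> simpa using lookup_writes h
  · rintro X s' ⟨h1, h2, h3, h4, h5⟩ h6 h7
    refine Trip.seq ((Trip.lookup hB.table (by omega) (fun q _ u _ => ?_) (by omega)
      (by rw [h3]; exact hW _) h7).mono le_rfl ?_)
    · split_ifs <;> omega
    · rintro s'' ⟨h8, h9, h10, h11⟩
      rw [h3] at h8
      have e := h11 .flag (by simp) (by simp)
      refine Trip.block ?_ ?_
      · simp only [blockOk, Prim.Ok, ArithOp.Ok, e, h8, and_true]
        rcases h1 with ⟨h1, -⟩ | ⟨h1, -⟩ <;> split_ifs <;> (simp [h1]; try omega)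
      · refine ⟨?_, h9.trans h2, h10.trans h3, ?_, fun x hx hx' hx'' => ?_⟩
        · simp only [blockExec, Prim.exec, ArithOp.fn, e, h8, Function.update_self,
            Set.forall_mem_insert]
          by_cases ho : ok (s.W (s'.sc (.addr 0))) (s'.sc (.word 0))
          · simp only [ho, if_true, mul_one, true_and]
            exact h1
          · simp [ho]
        · simp [blockExec, Prim.exec, h11, h4]
        · have h12 : x ≠ .tmp := by rintro rfl; exact hx trivial
          have h13 : x ≠ .val := by rintro rfl; exact hx trivial
          simp [blockExec, Prim.exec, hx', h11 x h12 h13, h5 x hx hx' hx'']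
  · exact ⟨Or.inl ⟨e4, by simp⟩, rfl, rfl, e3, e5⟩
  -- The tuple already has its first digit `l < n`, so `(l + 1) * n ^ r ≤ n ^ (r + 1)`.
  · rw [e1, pow_succ']
    gcongr
    omega
  · rw [e2, pow_succ']
    gcongr
    exact hV l le_rfl
  · rintro s' ⟨h1, h2, h3, -, h5⟩
    rw [Set.empty_union, e1, e2] at h1
    exact ⟨h1, h2, h3, h5⟩

end


/-! ### Lexicographic enumeration -/

section Lists

open scoped Classical in
/-- The words of length `n = l + k` that extend the first `l` letters of `v` and whose prefixes
satisfy `P`, in lexicographic order. -/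
noncomputable def extensions (n d : ℕ) (P : (ℕ → ℕ) → ℕ → Prop) :
    ℕ → ℕ → (ℕ → ℕ) → List (List ℕ)
  | 0, _, v => [(List.range n).map v]
  | k + 1, l, v => (List.range' 0 d).flatMap fun c =>
      if P (Function.update v l c) l then
        extensions n d P k (l + 1) (Function.update v l c) else []

open scoped Classical in
/-- The words of length `n = l + 1 + k` that extend the first `l` letters of `v` and whose next
letter is at least `c`. -/
noncomputable def branches (n d : ℕ) (P : (ℕ → ℕ) → ℕ → Prop) (k l : ℕ) (v : ℕ → ℕ) (c : ℕ) :
    List (List ℕ) :=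
  (List.range' c (d - c)).flatMap fun c =>
    if P (Function.update v l c) l then extensions n d P k (l + 1) (Function.update v l c) else []

/-- The words that come after those which extend the first `l` letters of `v`. -/
noncomputable def after (n d : ℕ) (P : (ℕ → ℕ) → ℕ → Prop) : ℕ → (ℕ → ℕ) → List (List ℕ)
  | 0, _ => []
  | l + 1, v => branches n d P (n - (l + 1)) l v (v l + 1) ++ after n d P l v

variable {n d : ℕ} {P : (ℕ → ℕ) → ℕ → Prop} {k l c : ℕ} {u v v' : ℕ → ℕ}

/-- The condition on level `l` only depends on the letters up to `l`. -/
def IsLocal (P : (ℕ → ℕ) → ℕ → Prop) : Prop :=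
  ∀ l v v', (∀ i ≤ l, v i = v' i) → (P v l ↔ P v' l)

/-- The first `l` letters are acceptable. -/
def IsPrefix (d : ℕ) (P : (ℕ → ℕ) → ℕ → Prop) (l : ℕ) (v : ℕ → ℕ) : Prop :=
  ∀ j < l, v j < d ∧ P v j

theorem extensions_succ : extensions n d P (k + 1) l v = branches n d P k l v 0 := rfl

theorem branches_skip (h : ¬ P (Function.update v l c) l) :
    branches n d P k l v c = branches n d P k l v (c + 1) := by
  rcases Nat.lt_or_ge c d with hc | hc
  · have : d - c = (d - (c + 1)) + 1 := by omega
    rw [branches, this, List.range'_succ, List.flatMap_cons, if_neg h]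
    rfl
  · have h1 : d - c = 0 := by omega
    have h2 : d - (c + 1) = 0 := by omega
    simp [branches, h1, h2]

theorem branches_skip_all {c' : ℕ} (hc : c ≤ c')
    (h : ∀ x, c ≤ x → x < c' → ¬ P (Function.update v l x) l) :
    branches n d P k l v c = branches n d P k l v c' := by
  induction c', hc using Nat.le_induction with
  | base => rfl
  | succ m hm ih =>
    rw [ih fun x h1 h2 => h x h1 (by omega), branches_skip (h m hm (by omega))]

theorem branches_take (hc : c < d) (h : P (Function.update v l c) l) :
    branches n d P k l v c = extensions n d P k (l + 1) (Function.update v l c) ++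
      branches n d P k l v (c + 1) := by
  have : d - c = (d - (c + 1)) + 1 := by omega
  rw [branches, this, List.range'_succ, List.flatMap_cons, if_pos h]
  rfl

theorem branches_eq_nil (hc : d ≤ c) : branches n d P k l v c = [] := by
  have : d - c = 0 := by omega
  simp [branches, this]

theorem update_agree (h : ∀ i < l, v i = v' i) (c : ℕ) :
    ∀ i ≤ l, Function.update v l c i = Function.update v' l c i := by
  intro i hi
  rcases eq_or_ne i l with rfl | hne
  · simp
  · simp [Function.update_of_ne hne, h i (by omega)]

open scoped Classical in
-- Needed because the array keeps leftovers of earlier words at and beyond the current level.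
theorem extensions_congr (hP : IsLocal P) (hkl : k + l = n) (h : ∀ i < l, v i = v' i) :
    extensions n d P k l v = extensions n d P k l v' := by
  induction k generalizing l v v' with
  | zero =>
    obtain rfl : l = n := by omega
    simp only [extensions, List.cons.injEq, and_true]
    exact List.map_congr_left fun i hi => h i (List.mem_range.1 hi)
  | succ k ih =>
    have h' := update_agree h
    unfold extensions
    congr 1
    funext c
    exact if_congr (hP l _ _ (h' c)) (ih (by omega) fun i hi => h' c i (by omega)) rfl

open scoped Classical in
theorem branches_congr (hP : IsLocal P) (hkl : k + (l + 1) = n) (h : ∀ i < l, v i = v' i) :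
    branches n d P k l v c = branches n d P k l v' c := by
  have h' := update_agree h
  unfold branches
  congr 1
  funext c
  exact if_congr (hP l _ _ (h' c)) (extensions_congr hP hkl fun i hi => h' c i (by omega)) rfl

theorem after_congr (hP : IsLocal P) (hl : l ≤ n) (h : ∀ i < l, v i = v' i) :
    after n d P l v = after n d P l v' := by
  induction l with
  | zero => rfl
  | succ l ih =>
    rw [after, after, ih (by omega) fun i hi => h i (by omega), h l (by omega),
      branches_congr hP (by omega) fun i hi => h i (by omega)]

theorem isPrefix_congr (hP : IsLocal P) (h : ∀ i < l, v i = v' i) (hv : IsPrefix d P l v) :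
    IsPrefix d P l v' := fun j hj => by
  rw [← h j hj, ← hP j v v' fun i hi => h i (by omega)]
  exact hv j hj

theorem isPrefix_update (hP : IsLocal P) (hv : IsPrefix d P l v) (hc : c < d)
    (h : P (Function.update v l c) l) : IsPrefix d P (l + 1) (Function.update v l c) := by
  intro j hj
  rcases Nat.lt_succ_iff_lt_or_eq.1 hj with hj | rfl
  · exact isPrefix_congr hP (fun i hi => by simp [Function.update_of_ne hi.ne]) hv j hj
  · simpa using ⟨hc, h⟩

theorem mem_extensions (hP : IsLocal P) (hkl : k + l = n) (w : List ℕ) :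
    w ∈ extensions n d P k l v ↔ ∃ x : ℕ → ℕ, (∀ i < l, x i = v i) ∧
      (∀ i < n, l ≤ i → x i < d ∧ P x i) ∧ (List.range n).map x = w := by
  induction k generalizing l v with
  | zero =>
    obtain rfl : l = n := by omega
    simp only [extensions, List.mem_singleton]
    constructor
    · rintro rfl
      exact ⟨v, fun _ _ => rfl, fun i _ _ => by omega, rfl⟩
    · rintro ⟨x, hx, -, rfl⟩
      exact List.map_congr_left fun i hi => hx i (List.mem_range.1 hi)
  | succ k ih =>
    rw [extensions, List.mem_flatMap]
    constructor
    · rintro ⟨c, hc, hw⟩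
      split_ifs at hw with h
      · obtain ⟨x, h1, h2, rfl⟩ := (ih (by omega)).1 hw
        refine ⟨x, fun i hi => ?_, fun i hi hli => ?_, rfl⟩
        · rw [h1 i (by omega), Function.update_of_ne hi.ne]
        · rcases Nat.eq_or_lt_of_le hli with rfl | hli
          · refine ⟨?_, (hP l _ _ fun i hi => h1 i (by omega)).2 h⟩
            rw [h1 l (by omega), Function.update_self]
            simpa using hc
          · exact h2 i hi hli
      · simp at hw
    · rintro ⟨x, h1, h2, rfl⟩
      obtain ⟨hd, hx⟩ := h2 l (by omega) le_rfl
      have agree : ∀ i ≤ l, x i = Function.update v l (x l) i := fun i hi => by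
        rcases eq_or_ne i l with rfl | hne
        · simp
        · rw [Function.update_of_ne hne, h1 i (by omega)]
      refine ⟨x l, by simpa using hd, ?_⟩
      rw [if_pos ((hP l _ _ agree).1 hx)]
      exact (ih (by omega)).2 ⟨x, fun i hi => agree i (by omega),
        fun i hi hli => h2 i hi (by omega), rfl⟩

/-- Words that come from different letters at position `l` differ at that position. -/
theorem nodup_extensions (hP : IsLocal P) (hkl : k + l = n) :
    (extensions n d P k l v).Nodup := by
  induction k generalizing l v with
  | zero => simp [extensions]
  | succ k ih =>
    rw [extensions, List.nodup_flatMap]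
    constructor
    · intro c _
      split_ifs
      · exact ih (by omega)
      · exact List.nodup_nil
    · refine List.Pairwise.imp ?_ (List.nodup_range' (s := 0) (n := d))
      intro a b hab w ha hb
      simp only at ha hb
      split_ifs at ha hb with h1 h2
      · obtain ⟨x, hx, -, rfl⟩ := (mem_extensions hP (by omega) _).1 ha
        obtain ⟨y, hy, -, he⟩ := (mem_extensions hP (by omega) _).1 hb
        have := List.map_inj_left.1 he l (by simp; omega)
        rw [hx l (by omega), hy l (by omega), Function.update_self, Function.update_self] at this
        exact hab this.symm
      all_goals simp at ha hb

end Lists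

/-- The coordinates in question are below `l + 1`, whatever the rest of the array contains. -/
theorem levelOk_isLocal (n d r : ℕ) (ok : ℕ → ℕ → Prop) (W : ℕ → ℕ) :
    IsLocal (LevelOk n d r ok W) := by
  intro l v v' h
  have hc : ∀ j a u, paths n d (l + 1) v j a u = paths n d (l + 1) v' j a u := by
    intro j
    induction j with
    | zero => intros; rfl
    | succ j ih =>
      intro a u
      ext q
      exact exists_congr fun i => and_congr_right fun hi => by rw [h i (by omega), ih]
  rw [LevelOk, LevelOk, h l le_rfl, hc]

/-! ### The backtracking search -/

/-- Increase `cand` until it is an acceptable letter at level `lvl`, or `d`. -/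
noncomputable def scan (d r : ℕ) (ok : ℕ → ℕ → Prop) : Cmd :=
  .seq (block [.const .more d, .op .sub .more .more .cand])
    (.loop .more (.seq (block [.setV .lvl .cand]) (.seq (check d r ok)
      (.ifz .flag (block [.opc .add .cand .cand 1, .const .more d, .op .sub .more .more .cand])
        (block [.const .more 0])))))

def scanTime (n d r : ℕ) : ℕ := 12 + (d * (6 + (checkTime n d r + 20) + 2) + 2)

/-- The variables that survive a scan. -/
def Slot.Kept : Slot → Prop
  | .dim | .rows | .ptr | .row | .lvl | .go | .found | .ans => True
  | _ => False

section

variable {inp : ℕ → ℕ} {B n d r : ℕ} {s : Store} {ok : ℕ → ℕ → Prop}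

/-- While the search goes on, `more` is `d - cand`, which bounds the remaining rounds; on success it
is set to `0`. If no letter is acceptable, position `l` of the array may hold a rejected letter, so
only the positions below `l` are then guaranteed. -/
theorem Trip.scan (hB : Fits n d r B) {l c : ℕ} (hln : l < n) (hc : c ≤ d)
    (hdim : s.sc .dim = n) (hl : s.sc .lvl = l) (hcand : s.sc .cand = c)
    (hV : ∀ i < l, s.V i < d) (hW : ∀ a, s.W a < 2 ^ d ^ (r + 1)) :
    Trip inp B (scan d r ok) (scanTime n d r) s (fun s' => ∃ c', c ≤ c' ∧ c' ≤ d ∧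
      s'.sc .cand = c' ∧
      (∀ x, c ≤ x → x < c' → ¬ LevelOk n d r ok s.W (Function.update s.V l x) l) ∧
      (c' < d → LevelOk n d r ok s.W (Function.update s.V l c') l ∧
        s'.V = Function.update s.V l c') ∧
      (∀ i < l, s'.V i = s.V i) ∧ s'.W = s.W ∧ ∀ x : Slot, x.Kept → s'.sc x = s.sc x) := by
  have := hB.dim
  have := hB.base
  have ne : ∀ {x y : Slot}, x.Kept → ¬ y.Kept → x ≠ y := fun hx hy h => hy (h ▸ hx)
  refine Trip.seq (Trip.block ?_ ?_)
  · simp [blockOk, Prim.Ok, ArithOp.Ok]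
    omega
  refine Trip.mono (Trip.loop_inv (t := 6 + (checkTime n d r + 20)) (i := d)
    (fun i s' => (∃ c', c ≤ c' ∧ c' ≤ d ∧ s'.sc .cand = c' ∧
      (∀ x, c ≤ x → x < c' → ¬ LevelOk n d r ok s.W (Function.update s.V l x) l) ∧
      (s'.sc .more = d - c' ∧ d - c' ≤ i ∨ s'.sc .more = 0 ∧
        LevelOk n d r ok s.W (Function.update s.V l c') l ∧
        s'.V = Function.update s.V l c')) ∧
      (∀ i, i ≠ l → s'.V i = s.V i) ∧ s'.W = s.W ∧ ∀ x : Slot, x.Kept → s'.sc x = s.sc x)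
    ?_ ?_) le_rfl ?_
  · refine ⟨⟨c, le_rfl, hc, by simp [blockExec, Prim.exec, hcand], by omega, Or.inl ?_⟩,
      fun _ _ => rfl, rfl, fun x hx => ?_⟩
    · simp [blockExec, Prim.exec, ArithOp.fn, hcand]
    · simp [blockExec, Prim.exec, Function.update_of_ne, ne hx (y := .more) id]
  · rintro i s₁ ⟨⟨c', h1, h2, h3, h4, h5⟩, h6, h7, h8⟩ hr
    rcases h5 with ⟨h5, h5'⟩ | ⟨h5, -⟩
    swap
    · exact (hr h5).elim
    have hcd : c' < d := by omega
    refine ⟨i - 1, by omega, ?_⟩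
    have hl₁ : s₁.sc .lvl = l := (h8 .lvl trivial).trans hl
    have hV' : Function.update s₁.V l c' = Function.update s.V l c' := by
      funext i
      rcases eq_or_ne i l with rfl | hi
      · simp
      · simp [Function.update_of_ne hi, h6 i hi]
    refine Trip.seq (Trip.block (by simp [blockOk, Prim.Ok, hl₁]; omega) ?_)
    have e : blockExec inp [.setV .lvl .cand] s₁ =
        { s₁ with V := Function.update s.V l c' } := by
      simp [blockExec, Prim.exec, hl₁, h3, hV']
    rw [e]
    refine Trip.seq ((Trip.check (s := { s₁ with V := Function.update s.V l c' }) hB hln ((h8 .dim trivial).trans hdim) hl₁ (fun i hi => ?_)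
      (fun a => by rw [h7]; exact hW a)).mono le_rfl ?_)
    · rcases Nat.eq_or_lt_of_le hi with rfl | hi
      · simpa using hcd
      · simpa [Function.update_of_ne hi.ne] using hV i hi
    rintro s₂ ⟨hflag, hV₂, hW₂, hsc₂⟩
    simp only [h7] at hflag hW₂ hV₂
    have hcand₂ : s₂.sc .cand = c' := (hsc₂ _ id (by simp) (by simp)).trans h3
    have kept : ∀ x : Slot, x.Kept → s₂.sc x = s.sc x := fun x hx => by
      rw [hsc₂ x (by cases x <;> simp_all [Slot.Kept, Slot.IsLoop]) (ne hx id) (ne hx id)]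
      exact h8 x hx
    have off : ∀ i, i ≠ l → s₂.V i = s.V i := fun i hi => by
      rw [hV₂, Function.update_of_ne hi]
    refine Trip.ifz (t := 18) (fun h => ?_) (fun h => ?_)
    · have hno := (hflag.resolve_left fun h' => by omega).2
      refine Trip.block ?_ ⟨⟨c' + 1, by omega, hcd, ?_, fun x hx hx' => ?_, Or.inl ⟨?_, by omega⟩⟩,
        off, hW₂, fun x hx => ?_⟩
      · simp [blockOk, Prim.Ok, ArithOp.Ok, hcand₂]
        omega
      · simp [blockExec, Prim.exec, ArithOp.fn, hcand₂]
      · rcases Nat.lt_succ_iff_lt_or_eq.1 hx' with hx' | rfl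
        · exact h4 x hx hx'
        · exact hno
      · simp [blockExec, Prim.exec, ArithOp.fn, hcand₂]
      · simp [blockExec, Prim.exec, Function.update_of_ne, ne hx (y := .more) id,
          ne hx (y := .cand) id, kept x hx]
    · have hyes := (hflag.resolve_right fun h' => h h'.1).2
      refine (Trip.block (by simp [blockOk, Prim.Ok]) ⟨⟨c', h1, h2, ?_, h4, Or.inr ⟨?_, hyes, hV₂⟩⟩,
        off, hW₂, fun x hx => ?_⟩).time (by simp)
      · simp [blockExec, Prim.exec, hcand₂]
      · simp [blockExec, Prim.exec]
      · simp [blockExec, Prim.exec, Function.update_of_ne, ne hx (y := .more) id, kept x hx]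
  · rintro s' ⟨i, ⟨⟨c', h1, h2, h3, h4, h5⟩, h6, h7, h8⟩, h0⟩
    refine ⟨c', h1, h2, h3, h4, fun h => ?_, fun i hi => h6 i hi.ne, h7, h8⟩
    rcases h5 with ⟨h5, -⟩ | ⟨-, h5⟩
    · omega
    · exact h5

/-- Complete the first `lvl` letters in the lexicographically least way. -/
noncomputable def down (d r : ℕ) (ok : ℕ → ℕ → Prop) : Cmd :=
  .seq (block [.op .sub .go .dim .lvl])
    (.loop .go (.seq (block [.const .cand 0]) (.seq (scan d r ok)
      (block [.opc .add .lvl .lvl 1, .op .sub .go .dim .lvl]))))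

def downTime (n d r : ℕ) : ℕ := 6 + (n * (6 + (scanTime n d r + 12) + 2) + 2)

/-- The words still to be output when the first `lvl` letters are fixed. -/
structure Remaining (n d r : ℕ) (ok : ℕ → ℕ → Prop) (W : ℕ → ℕ) (l : ℕ) (L : List (List ℕ))
    (s : Store) : Prop where
  dim : s.sc .dim = n
  lvl : s.sc .lvl = l
  le : l ≤ n
  table : s.W = W
  pre : IsPrefix d (LevelOk n d r ok W) l s.V
  eq : extensions n d (LevelOk n d r ok W) (n - l) l s.V ++ after n d (LevelOk n d r ok W) l s.V = L

/-- Every acceptable prefix can be extended by an acceptable letter. -/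
def Extendable (n d : ℕ) (P : (ℕ → ℕ) → ℕ → Prop) : Prop :=
  ∀ l < n, ∀ v, IsPrefix d P l v → ∃ c < d, P (Function.update v l c) l

/-- Fixing the letter `c` only regroups the list: the words with letter `c` become the extensions of
the longer prefix, and those with larger letters join the words that come after it. -/
theorem Remaining.step {W : ℕ → ℕ} {l c : ℕ} {L : List (List ℕ)} {s' : Store}
    {v : ℕ → ℕ} (hln : l < n) (hpre : IsPrefix d (LevelOk n d r ok W) l v)
    (hok : LevelOk n d r ok W (Function.update v l c) l) (hc : c < d)
    (hV : s'.V = Function.update v l c) (hdim : s'.sc .dim = n) (hlvl : s'.sc .lvl = l + 1)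
    (hW : s'.W = W)
    (hL : branches n d (LevelOk n d r ok W) (n - (l + 1)) l v c ++
      after n d (LevelOk n d r ok W) l v = L) :
    Remaining n d r ok W (l + 1) L s' := by
  have hP := levelOk_isLocal n d r ok W
  refine ⟨hdim, hlvl, hln, hW, hV ▸ isPrefix_update hP hpre hc hok, ?_⟩
  rw [hV, ← hL, branches_take hc hok, List.append_assoc, after, Function.update_self]
  have h : ∀ i < l, Function.update v l c i = v i := fun i hi => by
    simp [Function.update_of_ne hi.ne]
  rw [after_congr hP hln.le h, branches_congr hP (by omega) h]

/-- Rejected letters contribute no words, so taking the least acceptable letter keeps the list `L`.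
One scan per level suffices because no prefix is a dead end. -/
theorem Trip.down (hB : Fits n d r B) {W : ℕ → ℕ} {l : ℕ} {L : List (List ℕ)}
    (hW : ∀ a, W a < 2 ^ d ^ (r + 1)) (hext : Extendable n d (LevelOk n d r ok W))
    (hs : Remaining n d r ok W l L s) :
    Trip inp B (down d r ok) (downTime n d r) s (Remaining n d r ok W n L) := by
  have := hB.dim
  refine Trip.seq (Trip.block (by simp [blockOk, Prim.Ok, ArithOp.Ok]) ?_)
  refine Trip.mono (Trip.loop_inv (t := 6 + (scanTime n d r + 12)) (i := n)
    (fun i s' => ∃ l, Remaining n d r ok W l L s' ∧ s'.sc .go = n - l ∧ n - l ≤ i)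
    ⟨l, ⟨by simp [blockExec, Prim.exec, hs.dim], by simp [blockExec, Prim.exec, hs.lvl], hs.le,
      hs.table, hs.pre, hs.eq⟩, by simp [blockExec, Prim.exec, ArithOp.fn, hs.dim, hs.lvl], by omega⟩
    ?_) le_rfl ?_
  · rintro i s₁ ⟨l, h1, h2, h3⟩ hr
    have hln : l < n := by omega
    refine ⟨i - 1, by omega, Trip.seq (Trip.block (by simp [blockOk, Prim.Ok])
      (Trip.seq (Trip.mono (Trip.scan hB hln (Nat.zero_le d) (by simp [blockExec, Prim.exec, h1.dim])
        (by simp [blockExec, Prim.exec, h1.lvl]) (by simp [blockExec, Prim.exec])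
        (fun i hi => (h1.pre i hi).1)
        (fun a => by simpa [blockExec, Prim.exec, h1.table] using hW a)) le_rfl ?_)))⟩
    rintro s₂ ⟨c, -, hcd, -, hno, hyes, -, hW₂, hk⟩
    simp only [blockExec, Prim.exec, h1.table] at hno hyes hW₂
    -- If the scan had failed, all letters would be rejected, against `Extendable`.
    have hc : c < d := by
      rcases Nat.eq_or_lt_of_le hcd with rfl | h
      · obtain ⟨x, hx, hx'⟩ := hext l hln s₁.V h1.pre
        exact (hno x (Nat.zero_le _) hx hx').elim
      · exact h
    have hdim : s₂.sc .dim = n := by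
      rw [hk .dim trivial]; simp [blockExec, Prim.exec, h1.dim]
    have hlvl : s₂.sc .lvl = l := by
      rw [hk .lvl trivial]; simp [blockExec, Prim.exec, h1.lvl]
    refine Trip.block (by simp [blockOk, Prim.Ok, ArithOp.Ok, hlvl]; omega) ⟨l + 1, ?_, ?_, ?_⟩
    · refine Remaining.step hln h1.pre (hyes hc).1 hc (hyes hc).2
        (by simp [blockExec, Prim.exec, hdim]) (by simp [blockExec, Prim.exec, ArithOp.fn, hlvl])
        hW₂ ?_
      rw [← branches_skip_all (Nat.zero_le c) hno, ← extensions_succ, ← h1.eq]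
      congr 2
      omega
    · simp [blockExec, Prim.exec, ArithOp.fn, hdim, hlvl]
    · omega
  · rintro s' ⟨i, ⟨l, h1, h2, -⟩, h0⟩
    obtain rfl : l = n := by have := h1.le; omega
    exact h1

/-- Pass to the lexicographically next prefix, if there is one (`found`). -/
noncomputable def up (d r : ℕ) (ok : ℕ → ℕ → Prop) : Cmd :=
  .seq (block [.const .found 0, .copy .lvl .dim, .copy .go .dim])
    (.loop .go (.seq (block [.opc .sub .lvl .lvl 1, .getV .cand .lvl, .opc .add .cand .cand 1])
      (.seq (scan d r ok) (.seq (block [.const .tmp d, .op .sub .tmp .tmp .cand])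
        (.ifz .tmp (block [.copy .go .lvl])
          (block [.const .found 1, .const .go 0, .opc .add .lvl .lvl 1]))))))

def upTime (n d r : ℕ) : ℕ := 18 + (n * (18 + (scanTime n d r + (12 + 20)) + 2) + 2)

/-- Effect of the passage to the next word: either no word remains, or `found ≠ 0`. -/
def Advanced (n d r : ℕ) (ok : ℕ → ℕ → Prop) (W : ℕ → ℕ) (L : List (List ℕ)) (s : Store) : Prop :=
  s.sc .found = 0 ∧ L = [] ∨ s.sc .found ≠ 0 ∧ ∃ l, Remaining n d r ok W l L s

/-- The list of later words stays the same while levels without a larger acceptable letter are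
abandoned. `go` holds the current level, so the loop ends either at level `0`, with nothing left, or
when a larger letter is found and `go` is cleared. There are at most `n` scans. -/
theorem Trip.up (hB : Fits n d r B) {W : ℕ → ℕ} (hW : ∀ a, W a < 2 ^ d ^ (r + 1))
    (hdim : s.sc .dim = n) (hsW : s.W = W) (hpre : IsPrefix d (LevelOk n d r ok W) n s.V) :
    Trip inp B (up d r ok) (upTime n d r) s
      (Advanced n d r ok W (after n d (LevelOk n d r ok W) n s.V)) := by
  have := hB.dim
  have := hB.base
  have hP := levelOk_isLocal n d r ok W
  set L := after n d (LevelOk n d r ok W) n s.V with hL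
  refine Trip.seq (Trip.block (by simp [blockOk, Prim.Ok]) ?_)
  refine Trip.mono (Trip.loop_inv (t := 18 + (scanTime n d r + (12 + 20))) (i := n)
    (fun i s' => s'.sc .dim = n ∧ s'.W = W ∧ ((s'.sc .found = 0 ∧ ∃ l, s'.sc .go = l ∧
        s'.sc .lvl = l ∧ l ≤ i ∧ l ≤ n ∧ IsPrefix d (LevelOk n d r ok W) l s'.V ∧
        after n d (LevelOk n d r ok W) l s'.V = L) ∨
      (s'.sc .go = 0 ∧ s'.sc .found ≠ 0 ∧ ∃ l, Remaining n d r ok W l L s')))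
    ⟨by simp [blockExec, Prim.exec, hdim], hsW, Or.inl ⟨by simp [blockExec, Prim.exec], n,
      by simp [blockExec, Prim.exec, hdim], by simp [blockExec, Prim.exec, hdim], le_rfl, le_rfl,
      hpre, rfl⟩⟩ ?_) le_rfl ?_
  · rintro i s₁ ⟨h1, h2, ⟨h3, l, h4, h5, h6, h7, h8, h9⟩ | ⟨h3, -⟩⟩ hr
    swap
    · exact (hr h3).elim
    obtain ⟨l, rfl⟩ : ∃ l', l = l' + 1 := Nat.exists_eq_succ_of_ne_zero (h4 ▸ hr)
    have hVl := (h8 l (by omega)).1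
    have hpre' : IsPrefix d (LevelOk n d r ok W) l s₁.V := fun j hj => h8 j (by omega)
    refine ⟨i - 1, by omega, Trip.seq (Trip.block ?_ (Trip.seq (Trip.mono (Trip.scan hB (l := l)
      (c := s₁.V l + 1) (by omega) hVl
      (by simp [blockExec, Prim.exec, h1]) (by simp [blockExec, Prim.exec, ArithOp.fn, h5])
      (by simp [blockExec, Prim.exec, ArithOp.fn, h5]) (fun i hi => (hpre' i hi).1)
      (fun a => by simpa [blockExec, Prim.exec, h2] using hW a)) le_rfl ?_)))⟩
    · simp [blockOk, Prim.Ok, Prim.exec, ArithOp.Ok, ArithOp.fn, h5]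
      omega
    rintro s₂ ⟨c, hcl, hcd, hcand, hno, hyes, hbelow, hW₂, hk⟩
    simp only [blockExec, Prim.exec, h2] at hno hyes hW₂ hbelow
    have hdim₂ : s₂.sc .dim = n := by
      rw [hk .dim trivial]; simp [blockExec, Prim.exec, h1]
    have hlvl₂ : s₂.sc .lvl = l := by
      rw [hk .lvl trivial]; simp [blockExec, Prim.exec, ArithOp.fn, h5]
    have hfound₂ : s₂.sc .found = 0 := by
      rw [hk .found trivial]; simp [blockExec, Prim.exec, h3]
    -- The letters rejected by the scan contribute no words to the list.
    rw [after, branches_skip_all hcl hno] at h9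
    refine Trip.seq (Trip.block (by simp [blockOk, Prim.Ok, ArithOp.Ok]; omega)
      (Trip.ifz (t := 18) (fun h => ?_) (fun h => ?_)))
    · have hc : d ≤ c := by
        simpa [blockExec, Prim.exec, ArithOp.fn, hcand, Nat.sub_eq_zero_iff_le] using h
      rw [branches_eq_nil hc, List.nil_append] at h9
      refine (Trip.block (by simp [blockOk, Prim.Ok]) ⟨by simp [blockExec, Prim.exec, hdim₂], hW₂,
        Or.inl ⟨by simp [blockExec, Prim.exec, hfound₂], l, by simp [blockExec, Prim.exec, hlvl₂],
        by simp [blockExec, Prim.exec, hlvl₂], by omega, by omega, ?_, ?_⟩⟩).time (by simp)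
      · exact isPrefix_congr hP (fun i hi => (hbelow i hi).symm) hpre'
      · rw [← h9]
        exact after_congr hP (by omega) hbelow
    · have hc : c < d := by
        simpa [blockExec, Prim.exec, ArithOp.fn, hcand, Nat.sub_eq_zero_iff_le] using h
      refine Trip.block ?_ ⟨by simp [blockExec, Prim.exec, hdim₂], hW₂,
        Or.inr ⟨by simp [blockExec, Prim.exec], by simp [blockExec, Prim.exec], l + 1, ?_⟩⟩
      · simp [blockOk, blockExec, Prim.Ok, Prim.exec, ArithOp.Ok, hlvl₂]
        omega
      · exact Remaining.step (by omega) hpre' (hyes hc).1 hc (hyes hc).2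
          (by simp [blockExec, Prim.exec, hdim₂])
          (by simp [blockExec, Prim.exec, ArithOp.fn, hlvl₂]) hW₂ h9
  · rintro s' ⟨i, ⟨h1, h2, ⟨h3, l, h4, h5, h6, h7, h8, h9⟩ | ⟨-, h3, l, h4⟩⟩, h0⟩
    · obtain rfl : l = 0 := h4.symm.trans h0
      exact Or.inl ⟨h3, h9.symm⟩
    · exact Or.inr ⟨h3, l, h4⟩

end


/-! ### The two programs -/

/-- The input rows. -/
def rowsAt (inp : ℕ → ℕ) (p n k : ℕ) : ℕ → ℕ := fun j => inp (p + k * n + j)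

/-- `W` lists, at the address of each tuple of coordinates, the projections of the rows to it. -/
structure IsTable (n m d r : ℕ) (row : ℕ → ℕ → ℕ) (W : ℕ → ℕ) : Prop where
  lt : ∀ a, W a < 2 ^ d ^ (r + 1)
  testBit : ∀ a u, (W a).testBit u ↔ ∃ k < m, (a, u) ∈ paths n d n (row k) (r + 1) 0 0

/-- Write the first vector to the output registers. -/
def writeOut : Cmd :=
  .seq (block [.const .tmp 0, .setOut .tmp .dim])
    (forDown (.cnt 0) .dim (block [.getV .val (.cnt 0), .opc .add .tmp (.cnt 0) 1,
      .setOut .tmp .val]))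

def writeTime (n : ℕ) : ℕ := 12 + (n * 26 + 8)

/-- Read `n` and `m`, and initialize the position of the rows with `p`. -/
def setup (p : Prim) : Cmd :=
  block [.const .tmp 0, .read .dim .tmp, .const .tmp 1, .read .rows .tmp, p]

/-- `r := 1` if `nul`, and `r :=` the number of rows otherwise. -/
def setNonempty (nul : Bool) (r : Slot) : Prim := if nul then .const r 1 else .copy r .rows

/-- Output all the words that remain. -/
noncomputable def outputLoop (d r : ℕ) (ok : ℕ → ℕ → Prop) (adv : Cmd) : Cmd :=
  .loop .found (.seq (down d r ok) (.seq writeOut (.seq .output adv)))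

/-- The passage to the next word is a parameter `adv`: in general it is `up`, but with at most one
letter it has to be an immediate stop for the delay to be constant. -/
noncomputable def enumerator (d r : ℕ) (ok : ℕ → ℕ → Prop) (nul : Bool) (adv : Cmd) : Cmd :=
  .seq (.seq (setup (.const .ptr 2)) (.seq (precompute d r)
    (block [setNonempty nul .found, .const .lvl 0]))) (outputLoop d r ok adv)

/-- The rows start after the target, at position `n + 2`; once they are recorded, `ptr` returns to
`2` and the target is loaded into the same array. -/
noncomputable def decider (d r : ℕ) (ok : ℕ → ℕ → Prop) (nul : Bool) : Cmd :=
  .seq (setup (.opc .add .ptr .dim 2)) (.seq (precompute d r) (.seq (block [.const .ptr 2])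
    -- The two subtractions compute `1 - (1 - ans)`, which turns any positive number of rows into
    -- `1`.
    (.seq loadRow (.seq (block [setNonempty nul .ans, .const .val 1, .op .sub .ans .val .ans,
        .op .sub .ans .val .ans])
      (forDown .row .dim (.seq (block [.copy .lvl .row]) (.seq (check d r ok)
        (block [.op .mul .ans .ans .flag]))))))))

section

variable {inp : ℕ → ℕ} {B n m d r : ℕ} {s : Store} {ok : ℕ → ℕ → Prop}

theorem Trip.writeOut (hB : 4 * n + 1 ≤ B) (hdim : s.sc .dim = n) :
    Trip inp B writeOut (writeTime n) s (fun s' => wordOf s'.out = (List.range n).map s.V ∧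
      s'.V = s.V ∧ s'.W = s.W ∧ s'.sc .dim = n) := by
  refine Trip.seq (Trip.block (by simp [blockOk, Prim.Ok]) ?_)
  refine Trip.mono (Trip.forDown (t := 18) (fun i s' => s'.out 0 = n ∧
    (∀ j < n, i ≤ j → s'.out (j + 1) = s.V j) ∧ s'.V = s.V ∧ s'.W = s.W ∧ s'.sc .dim = n)
    (by omega) (n := n) ?_ ?_ ?_ ?_) (by omega) ?_
  · simp [blockExec, Prim.exec, hdim]
  · exact ⟨by simp [blockExec, Prim.exec, hdim], by omega, rfl, rfl,
      by simp [blockExec, Prim.exec, hdim]⟩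
  · rintro i s' v ⟨h1, h2, h3, h4, h5⟩
    exact ⟨h1, h2, h3, h4, by simpa using h5⟩
  · rintro i hi s' ⟨h1, h2, h3, h4, h5⟩ hc
    refine Trip.block ?_ ⟨⟨?_, fun j hj hij => ?_, h3, h4, ?_⟩, ?_⟩
    · simp [blockOk, Prim.Ok, Prim.exec, ArithOp.Ok, hc]
      omega
    · simp [blockExec, Prim.exec, ArithOp.fn, h1]
    · rcases Nat.eq_or_lt_of_le hij with rfl | hij
      · simp [blockExec, Prim.exec, ArithOp.fn, hc, h3]
      · have : j ≠ i := by omega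
        simp [blockExec, Prim.exec, ArithOp.fn, hc, this, h2 j hj hij]
    · simp [blockExec, Prim.exec, h5]
    · simp [blockExec, Prim.exec, hc]
  · rintro s' ⟨h1, h2, h3, h4, h5⟩
    refine ⟨?_, h3, h4, h5⟩
    refine List.ext_getElem (by simp [wordOf, h1]) fun i hi hi' => ?_
    have : i < n := by simpa using hi'
    simp [wordOf, h2 i this]

/-- The trace of the output loop: it outputs the remaining words, one after the other. -/
theorem Exec.outputLoop (hB : Fits n d r B) {W : ℕ → ℕ} (hW : ∀ a, W a < 2 ^ d ^ (r + 1))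
    (hext : Extendable n d (LevelOk n d r ok W)) {adv : Cmd} {t δ : ℕ}
    (hadv : ∀ s : Store, s.sc .dim = n → s.W = W → IsPrefix d (LevelOk n d r ok W) n s.V →
      Trip inp B adv t s (Advanced n d r ok W (after n d (LevelOk n d r ok W) n s.V)))
    (hδ : t + 2 ≤ δ) (L : List (List ℕ)) :
    (L.length ≤ 1 ∨ t + 1 + (downTime n d r + writeTime n + 1) ≤ δ) →
    ∀ (s : Store) (l : ℕ), s.sc .found ≠ 0 → Remaining n d r ok W l L s →
      ∃ τ s', Exec inp B (outputLoop d r ok adv) s τ s' ∧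
        Delayed δ (downTime n d r + writeTime n + 1) L τ := by
  have := hB.dim
  induction L with
  | nil =>
    rintro - s l - h
    -- This case is impossible: a prefix can always be completed, and the completed word belongs to
    -- the list.
    obtain ⟨k, -, s', -, h'⟩ := Trip.down (inp := inp) hB hW hext h
    simpa [extensions] using h'.eq
  | cons w L ih =>
    intro hL s l hf h
    obtain ⟨k₁, hk₁, s₁, e₁, h₁⟩ := Trip.down (inp := inp) hB hW hext h
    obtain ⟨k₂, hk₂, s₂, e₂, hw, hV₂, hW₂, hd₂⟩ := Trip.writeOut (inp := inp) (B := B) (by omega) h₁.dim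
    have heq := h₁.eq
    simp only [Nat.sub_self, extensions, List.singleton_append, List.cons.injEq] at heq
    obtain ⟨rfl, hL'⟩ := heq
    obtain ⟨k₃, hk₃, s₃, e₃, h₃⟩ := hadv s₂ hd₂ (hW₂.trans h₁.table) (hV₂ ▸ h₁.pre)
    rw [hV₂, hL'] at h₃
    have body := e₁.seq (e₂.seq ((Exec.output s₂).seq e₃))
    rw [hw] at body
    have key : ∀ {τ s'}, Exec inp B (_root_.outputLoop d r ok adv) s₃ τ s' →
        Exec inp B (_root_.outputLoop d r ok adv) s (List.replicate (1 + k₁ + k₂) none ++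
          some ((List.range n).map s₁.V) :: (List.replicate (k₃ + 1) none ++ τ)) s' := by
      intro τ s' he
      have := Exec.loop_ne hf body he
      have hτ : List.replicate (1 + k₁ + k₂) none ++
          some ((List.range n).map s₁.V) :: (List.replicate (k₃ + 1) none ++ τ) =
          none :: (List.replicate k₁ none ++ (List.replicate k₂ none ++
            ([some ((List.range n).map s₁.V)] ++ List.replicate k₃ none))) ++ none :: τ := by
        rw [add_assoc, add_comm 1, List.replicate_succ, ← List.replicate_append_replicate,
          List.replicate_succ']
        simp
        rw [← List.replicate_append_replicate, List.append_assoc]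
      rw [hτ]
      exact this
    have hlen : 1 + k₁ + k₂ ≤ downTime n d r + writeTime n + 1 := by omega
    rcases h₃ with ⟨h0, rfl⟩ | ⟨h0, l', h₃⟩
    · exact ⟨_, _, key (Exec.loop_zero h0), .cons hlen
        (((Delayed.nil (g := 1) le_rfl).replicate_append (k₃ + 1)).mono (by omega))⟩
    -- A prefix found by `adv` can be completed, so another word follows. The list then has at least
    -- two words, and the full bound on `δ` is available.
    · have hne : L ≠ [] := by
        rintro rfl
        obtain ⟨k, -, s', -, h'⟩ := Trip.down (inp := inp) hB hW hext h₃
        simpa [extensions] using h'.eq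
      have hδ' : t + 1 + (downTime n d r + writeTime n + 1) ≤ δ := by
        refine hL.resolve_left ?_
        have := List.length_pos_iff.2 hne
        simp
        omega
      obtain ⟨τ, s', he, hD⟩ := ih (Or.inr hδ') s₃ l' h0 h₃
      exact ⟨_, _, key he, .cons hlen ((hD.replicate_append (k₃ + 1)).mono (by omega))⟩

theorem Trip.setup_precompute (hB : Fits n d r B) (hmB : m ≤ B) {p : ℕ} {i : Prim}
    (hn : inp 0 = n) (hm : inp 1 = m)
    (hinp : ∀ k < m, ∀ j < n, rowsAt inp p n k j < d) (hpB : p + m * n ≤ B)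
    (hi : ∀ s : Store, s.sc .dim = n → i.Ok inp B s ∧
      i.exec inp s = { s with sc := Function.update s.sc .ptr p }) {c : Cmd} {t : ℕ}
    {Q : Store → Prop}
    (hc : ∀ s : Store, IsTable n m d r (rowsAt inp p n) s.W → s.sc .dim = n → s.sc .rows = m →
      Trip inp B c t s Q) :
    Trip inp B (.seq (setup i) (.seq (_root_.precompute d r) c)) (30 + (precomputeTime n m d r + t)) .init
      Q := by
  have := hB.dim
  let s₀ : Store := { Store.init with sc := Function.update (Function.update (Function.update
    (Function.update Store.init.sc .tmp 0) .dim n) .tmp 1) .rows m }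
  have h := hi s₀ (by simp [s₀])
  have e : blockExec inp [.const .tmp 0, .read .dim .tmp, .const .tmp 1, .read .rows .tmp] .init =
      s₀ := by
    simp [blockExec, Prim.exec, s₀, hn, hm]
  refine Trip.seq (Trip.block ?_ ?_)
  · refine ⟨Nat.zero_le _, ?_, (by omega : 1 ≤ B), ?_, ?_, trivial⟩
    · simp [Prim.Ok, Prim.exec, hn]
      omega
    · simp [Prim.Ok, Prim.exec, hm, hmB]
    · exact (congrArg (fun s => i.Ok inp B s) e).mpr h.1
  · have e' : blockExec inp [.const .tmp 0, .read .dim .tmp, .const .tmp 1, .read .rows .tmp, i]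
        .init = { s₀ with sc := Function.update s₀.sc .ptr p } :=
      (congrArg (fun s => i.exec inp s) e).trans h.2
    rw [e']
    refine Trip.seq (Trip.mono (Trip.precompute hB (m := m) (p := p) (by simp [s₀]) (by simp [s₀]) (by simp)
      hpB hinp (fun a => rfl)) le_rfl ?_)
    rintro s ⟨h1, h2, h3, h4⟩
    exact hc s ⟨h1, h2⟩ h3 h4

theorem setNonempty_ok {nul : Bool} {x : Slot} (hB : 1 ≤ B) : (setNonempty nul x).Ok inp B s := by
  cases nul <;> simp [setNonempty, Prim.Ok, hB]

theorem setNonempty_exec {nul : Bool} {x : Slot} : (setNonempty nul x).exec inp s =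
    { s with sc := Function.update s.sc x (if nul then 1 else s.sc .rows) } := by
  cases nul <;> simp [setNonempty, Prim.exec]

theorem Exec.enumerator (hB : Fits n d r B) (hmB : m ≤ B) (hn : inp 0 = n) (hm : inp 1 = m)
    (hinp : ∀ k < m, ∀ j < n, rowsAt inp 2 n k j < d) (hpB : 2 + m * n ≤ B) {nul : Bool}
    {adv : Cmd} {t δ : ℕ}
    (hext : ∀ W, IsTable n m d r (rowsAt inp 2 n) W → nul = true ∨ 0 < m →
      Extendable n d (LevelOk n d r ok W))
    (hadv : ∀ (W : ℕ → ℕ) (s : Store), IsTable n m d r (rowsAt inp 2 n) W → s.sc .dim = n →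
      s.W = W → IsPrefix d (LevelOk n d r ok W) n s.V →
      Trip inp B adv t s (Advanced n d r ok W (after n d (LevelOk n d r ok W) n s.V)))
    (hδ : t + 2 ≤ δ) (hδ' : d ≤ 1 ∨ t + 1 + (downTime n d r + writeTime n + 1) ≤ δ) :
    ∃ W v τ s', IsTable n m d r (rowsAt inp 2 n) W ∧
      Exec inp B (enumerator d r ok nul adv) .init τ s' ∧
      Delayed δ (30 + (precomputeTime n m d r + 12) + (downTime n d r + writeTime n + 1))
        (if nul = true ∨ 0 < m then extensions n d (LevelOk n d r ok W) n 0 v else []) τ := by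
  have := hB.dim
  have hpre : Trip inp B (.seq (setup (.const .ptr 2)) (.seq (precompute d r)
      (_root_.block [setNonempty nul .found, .const .lvl 0]))) (30 + (precomputeTime n m d r + 12))
      .init (fun s => IsTable n m d r (rowsAt inp 2 n) s.W ∧ s.sc .dim = n ∧ s.sc .lvl = 0 ∧
        s.sc .found = if nul then 1 else m) := by
    refine Trip.setup_precompute hB hmB hn hm hinp hpB (fun s _ => ?_) (fun s h1 h2 h3 => ?_)
    · exact ⟨by simp [Prim.Ok]; omega, rfl⟩
    · refine Trip.block ⟨setNonempty_ok (by omega), by simp [blockOk, Prim.Ok]⟩ ?_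
      simp only [blockExec, setNonempty_exec]
      exact ⟨h1, by simp [Prim.exec, h2], by simp [Prim.exec], by simp [Prim.exec, h3]⟩
  obtain ⟨k, hk, s, he, hT, hdim, hlvl, hfound⟩ := hpre
  by_cases h : nul = true ∨ 0 < m
  · have hf : s.sc .found ≠ 0 := by
      rw [hfound]
      split_ifs with h'
      · exact one_ne_zero
      · exact (h.resolve_left h').ne'
    -- With `d ≤ 1` the only possible letter is `0`, so there is at most one word and a
    -- repetition-free list of such words has length at most one.
    have hlen : (extensions n d (LevelOk n d r ok s.W) n 0 s.V).length ≤ 1 ∨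
        t + 1 + (downTime n d r + writeTime n + 1) ≤ δ := by
      refine hδ'.imp_left fun hd => ?_
      have hloc := levelOk_isLocal n d r ok s.W
      have hnd : (extensions n d (LevelOk n d r ok s.W) n 0 s.V).Nodup :=
        nodup_extensions hloc (by omega)
      have hsub : extensions n d (LevelOk n d r ok s.W) n 0 s.V ⊆
          [(List.range n).map fun _ => 0] := by
        intro w hw
        obtain ⟨x, -, hx, rfl⟩ := (mem_extensions hloc (by omega) w).1 hw
        rw [List.mem_singleton]
        refine List.map_congr_left fun i hi => ?_
        have := (hx i (by simpa using hi) (Nat.zero_le _)).1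
        omega
      exact (hnd.subperm hsub).length_le
    obtain ⟨τ, s', he', hD⟩ := Exec.outputLoop (inp := inp) hB hT.lt (hext s.W hT h)
      (fun s' => hadv s.W s' hT) hδ _ hlen s 0 hf ⟨hdim, hlvl, Nat.zero_le _, rfl,
        fun j hj => absurd hj (Nat.not_lt_zero _), by simp [after]⟩
    refine ⟨s.W, s.V, _, s', hT, he.seq he', ?_⟩
    rw [if_pos h]
    exact (hD.replicate_append k).mono (by omega)
  · have hf : s.sc .found = 0 := by
      rw [hfound]
      split_ifs with h'
      · exact (h (Or.inl h')).elim
      · exact Nat.eq_zero_of_not_pos fun h' => h (Or.inr h')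
    refine ⟨s.W, s.V, _, s, hT, he.seq (Exec.loop_zero hf), ?_⟩
    rw [if_neg h]
    exact ((Delayed.nil (g := 1) le_rfl).replicate_append k).mono (by omega)

def deciderTime (n m d r : ℕ) : ℕ :=
  30 + (precomputeTime n m d r + (6 + (n * 26 + 8 + (24 + (n * (6 + (checkTime n d r + 6) + 8) + 8)))))

theorem Trip.decider (hB : Fits n d r B) (hmB : m ≤ B) (hn : inp 0 = n) (hm : inp 1 = m)
    (hinp : ∀ k < m, ∀ j < n, rowsAt inp (2 + n) n k j < d) (htarget : ∀ j < n, inp (2 + j) < d)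
    (hpB : 2 + n + m * n ≤ B) {nul : Bool} :
    Trip inp B (decider d r ok nul) (deciderTime n m d r) .init (fun s =>
      ∃ W, IsTable n m d r (rowsAt inp (2 + n) n) W ∧
        (s.sc .ans = 1 ∧ ((nul = true ∨ 0 < m) ∧
            ∀ l < n, LevelOk n d r ok W (fun j => inp (2 + j)) l) ∨
          s.sc .ans = 0 ∧ ¬ ((nul = true ∨ 0 < m) ∧
            ∀ l < n, LevelOk n d r ok W (fun j => inp (2 + j)) l))) := by
  have := hB.dim
  have := hB.base
  refine Trip.setup_precompute hB hmB hn hm hinp hpB (fun s hs => ?_) (fun s hT hdim hrows => ?_)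
  · constructor
    · simp [Prim.Ok, ArithOp.Ok, hs]
      omega
    · simp [Prim.exec, ArithOp.fn, hs, add_comm]
  · refine Trip.seq (Trip.block (by simp [blockOk, Prim.Ok]; omega) (Trip.seq (Trip.mono
      (Trip.loadRow (n := n) (p := 2) (by omega) (by simp [blockExec, Prim.exec, hdim])
      (by simp [blockExec, Prim.exec]) (by omega)
      (fun j hj => (htarget j hj).le.trans (by omega))) le_rfl ?_)))
    rintro s₁ ⟨hV₁, hW₁, hsc₁⟩
    have hdim₁ : s₁.sc .dim = n := by
      rw [hsc₁ .dim (by simp) (by simp)]; simp [blockExec, Prim.exec, hdim]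
    have hrows₁ : s₁.sc .rows = m := by
      rw [hsc₁ .rows (by simp) (by simp)]; simp [blockExec, Prim.exec, hrows]
    refine Trip.seq (Trip.block ⟨setNonempty_ok (by omega), ?_⟩ ?_)
    · refine ⟨(by omega : 1 ≤ B), trivial, trivial, trivial⟩
    set s₂ := blockExec inp [setNonempty nul .ans, .const .val 1, .op .sub .ans .val .ans,
      .op .sub .ans .val .ans] s₁ with hs₂
    have e : s₂ = blockExec inp [.const .val 1, .op .sub .ans .val .ans, .op .sub .ans .val .ans]
        { s₁ with sc := Function.update s₁.sc .ans (if nul then 1 else m) } := by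
      rw [hs₂, blockExec, setNonempty_exec, hrows₁]
    have hans : s₂.sc .ans = 1 ∧ (nul = true ∨ 0 < m) ∨
        s₂.sc .ans = 0 ∧ ¬ (nul = true ∨ 0 < m) := by
      rw [e]
      cases nul <;> simp [blockExec, Prim.exec, ArithOp.fn]
      omega
    have hdim₂ : s₂.sc .dim = n := by simp [e, blockExec, Prim.exec, hdim₁]
    have hV₂ : s₂.V = s₁.V := by rw [e]; rfl
    have hW₂ : s₂.W = s.W := by rw [e]; exact hW₁
    refine Trip.mono (Trip.forDown (n := n) (fun i s' => s'.sc .dim = n ∧ s'.V = s₁.V ∧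
      s'.W = s.W ∧ (s'.sc .ans = 1 ∧ ((nul = true ∨ 0 < m) ∧
            ∀ l < n, i ≤ l → LevelOk n d r ok s.W s₁.V l) ∨
          s'.sc .ans = 0 ∧ ¬ ((nul = true ∨ 0 < m) ∧
            ∀ l < n, i ≤ l → LevelOk n d r ok s.W s₁.V l))) (by omega) hdim₂
      ⟨hdim₂, hV₂, hW₂, ?_⟩ ?_ ?_) le_rfl ?_
    · have : ∀ l < n, n ≤ l → LevelOk n d r ok s.W s₁.V l := fun l h h' => by omega
      simpa only [eq_true this, and_true] using hans
    · rintro i s' v ⟨h1, h2, h3, h4⟩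
      exact ⟨by simpa using h1, h2, h3, by simpa using h4⟩
    · rintro i hi s' ⟨h1, h2, h3, h4⟩ hc
      refine Trip.seq (Trip.block (by simp [blockOk, Prim.Ok]) (Trip.seq (Trip.mono
        (Trip.check hB hi (by simp [blockExec, Prim.exec, h1]) (by simp [blockExec, Prim.exec, hc])
        (fun j hj => ?_) (fun a => ?_)) le_rfl ?_)))
      · simp only [blockExec, Prim.exec, h2]
        rw [hV₁ j (by omega)]
        exact htarget j (by omega)
      · simpa [blockExec, Prim.exec, h3] using hT.lt a
      · rintro s₃ ⟨h5, h6, h7, h8⟩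
        simp only [blockExec, Prim.exec, h2, h3] at h5 h6 h7
        have hans₃ : s₃.sc .ans = s'.sc .ans := by
          rw [h8 .ans id (by simp) (by simp)]; simp [blockExec, Prim.exec]
        have hdim₃ : s₃.sc .dim = n := by
          rw [h8 .dim id (by simp) (by simp)]; simp [blockExec, Prim.exec, h1]
        have hrow₃ : s₃.sc .row = i := by
          rw [h8 .row id (by simp) (by simp)]; simp [blockExec, Prim.exec, hc]
        have hsplit : (∀ l < n, i ≤ l → LevelOk n d r ok s.W s₁.V l) ↔
            LevelOk n d r ok s.W s₁.V i ∧ ∀ l < n, i + 1 ≤ l → LevelOk n d r ok s.W s₁.V l := by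
          constructor
          · exact fun h => ⟨h i hi le_rfl, fun l hl h' => h l hl (by omega)⟩
          · rintro ⟨h, h'⟩ l hl hil
            rcases Nat.eq_or_lt_of_le hil with rfl | hil
            · exact h
            · exact h' l hl hil
        refine Trip.block ?_ ⟨⟨by simp [blockExec, Prim.exec, hdim₃], h6, h7, ?_⟩,
          by simp [blockExec, Prim.exec, hrow₃]⟩
        · simp only [blockOk, Prim.Ok, ArithOp.Ok, and_true, hans₃]
          rcases h4 with ⟨h4, -⟩ | ⟨h4, -⟩ <;> rcases h5 with ⟨h5, -⟩ | ⟨h5, -⟩ <;>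
            rw [h4, h5] <;> omega
        · rw [hsplit]
          simp only [blockExec, Prim.exec, ArithOp.fn, hans₃, Function.update_self]
          rcases h4 with ⟨h4, h4'⟩ | ⟨h4, h4'⟩ <;> rcases h5 with ⟨h5, h5'⟩ | ⟨h5, h5'⟩ <;>
            rw [h4, h5]
          · exact Or.inl ⟨rfl, h4'.1, h5', h4'.2⟩
          · exact Or.inr ⟨rfl, fun h => h5' h.2.1⟩
          · exact Or.inr ⟨rfl, fun h => h4' ⟨h.1, h.2.2⟩⟩
          · exact Or.inr ⟨rfl, fun h => h5' h.2.1⟩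
    · rintro s' ⟨-, -, -, h⟩
      have hlev : ∀ l < n, (LevelOk n d r ok s.W s₁.V l ↔
          LevelOk n d r ok s.W (fun j => inp (2 + j)) l) := fun l hl =>
        levelOk_isLocal n d r ok s.W l _ _ fun i hi => hV₁ i (by omega)
      have hall : (∀ l < n, 0 ≤ l → LevelOk n d r ok s.W s₁.V l) ↔
          ∀ l < n, LevelOk n d r ok s.W (fun j => inp (2 + j)) l :=
        forall₂_congr fun l hl => by simp [hlev l hl]
      rw [hall] at h
      exact ⟨s.W, hT, h⟩

end


/-! ### Tables of projections and closures -/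

/-- Append digits in base `b` to `a`. -/
def horner (b a : ℕ) (L : List ℕ) : ℕ := L.foldl (fun a i => a * b + i) a

theorem horner_cons (b a i : ℕ) (L : List ℕ) : horner b a (i :: L) = horner b (a * b + i) L := rfl

/-- The digits are peeled off from the right: once the initial values extended by the first digit
agree, reduction modulo `b` recovers that digit. Equal lengths are essential, because of leading
zeros. -/
theorem horner_inj {b : ℕ} {L L' : List ℕ} (hlen : L.length = L'.length) (hL : ∀ i ∈ L, i < b)
    (hL' : ∀ i ∈ L', i < b) {a a' : ℕ} (h : horner b a L = horner b a' L') : a = a' ∧ L = L' := by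
  induction L generalizing L' a a' with
  | nil =>
    obtain rfl : L' = [] := List.length_eq_zero_iff.1 hlen.symm
    exact ⟨h, rfl⟩
  | cons i L ih =>
    obtain ⟨i', L', rfl⟩ := List.exists_cons_of_length_eq_add_one hlen.symm
    rw [horner_cons, horner_cons] at h
    obtain ⟨h1, rfl⟩ := ih (by simpa using hlen) (fun k hk => hL k (List.mem_cons_of_mem _ hk))
      (fun k hk => hL' k (List.mem_cons_of_mem _ hk)) h
    have hi : i < b := hL i List.mem_cons_self
    have hi' : i' < b := hL' i' List.mem_cons_self
    have hmod : (a * b + i) % b = (a' * b + i') % b := by rw [h1]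
    rw [mul_comm a, mul_comm a', Nat.mul_add_mod, Nat.mul_add_mod, Nat.mod_eq_of_lt hi,
      Nat.mod_eq_of_lt hi'] at hmod
    subst hmod
    have := Nat.eq_of_mul_eq_mul_right (Nat.zero_lt_of_lt hi) (Nat.add_right_cancel h1)
    exact ⟨this, rfl⟩

/-- A closed form: the nested loops run through all tuples with entries below `N`, each encoded by
its coordinates and by the letters found there. -/
theorem mem_paths {n d N : ℕ} {v : ℕ → ℕ} {j a u : ℕ} {p : ℕ × ℕ} :
    p ∈ paths n d N v j a u ↔ ∃ I : Fin j → ℕ, (∀ i, I i < N) ∧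
      p = (horner n a (List.ofFn I), horner d u (List.ofFn fun i => v (I i))) := by
  induction j generalizing a u with
  | zero =>
    simp only [paths, Set.mem_singleton_iff]
    exact ⟨fun h => ⟨Fin.elim0, fun i => i.elim0, by simpa [horner] using h⟩,
      fun ⟨I, _, h⟩ => by simpa [horner] using h⟩
  | succ j ih =>
    simp only [paths, Set.mem_ofPred_eq, ih]
    constructor
    · rintro ⟨i, hi, I, hI, rfl⟩
      refine ⟨Fin.cons i I, fun k => ?_, by simp [List.ofFn_succ, horner_cons]⟩
      refine Fin.cases ?_ (fun k => ?_) k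
      · simpa using hi
      · simpa using hI k
    · rintro ⟨I, hI, rfl⟩
      exact ⟨I 0, hI 0, fun k => I k.succ, fun k => hI _, by simp [List.ofFn_succ, horner_cons]⟩

section

variable {D : Type*} {d : ℕ} (code : D ≃ Fin d) {F : Set (Operation D)} {n m r : ℕ}

/-- The number of a tuple. -/
def tupleCode {q : ℕ} (y : Fin q → D) : ℕ := horner d 0 (List.ofFn fun i => (code (y i) : ℕ))

/-- The address of a tuple of coordinates. -/
def tupleAddr {q : ℕ} (J : Fin q → Fin n) : ℕ := horner n 0 (List.ofFn fun i => (J i : ℕ))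

theorem horner_ofFn_inj {b q : ℕ} {I J : Fin q → ℕ} (hI : ∀ i, I i < b) (hJ : ∀ i, J i < b)
    (h : horner b 0 (List.ofFn I) = horner b 0 (List.ofFn J)) : I = J := by
  refine List.ofFn_injective (horner_inj (by simp) ?_ ?_ h).2
  · simpa [List.mem_ofFn] using hI
  · simpa [List.mem_ofFn] using hJ

theorem tupleCode_injective {q : ℕ} : Function.Injective (tupleCode code (q := q)) := by
  intro y y' h
  have := horner_ofFn_inj (fun i => (code (y i)).2) (fun i => (code (y' i)).2) h
  funext i
  exact code.injective (Fin.ext (congrFun this i))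

/-- The tuple with number `u` belongs to the closure of the set of tuples with bit mask `q`. -/
def InClosure (F : Set (Operation D)) (r q u : ℕ) : Prop :=
  ∃ y : Fin (r + 1) → D, tupleCode code y = u ∧
    Cl F {y' : Fin (r + 1) → D | q.testBit (tupleCode code y')} y

variable {vec : Fin m → Fin n → D} {row : ℕ → ℕ → ℕ} {W : ℕ → ℕ}

/-- Positional notation is injective on tuples of fixed length, so neither two tuples of coordinates
nor two tuples of letters collide. -/
theorem IsTable.testBit_iff (hW : IsTable n m d r row W)
    (hrow : ∀ (k : Fin m) (j : Fin n), row k j = code (vec k j)) (J : Fin (r + 1) → Fin n)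
    (y : Fin (r + 1) → D) :
    (W (tupleAddr J)).testBit (tupleCode code y) ↔ ∃ k, vec k ∘ J = y := by
  rw [hW.testBit]
  simp only [mem_paths, Prod.mk.injEq]
  constructor
  · rintro ⟨k, hk, I, hI, h1, h2⟩
    have e1 := horner_ofFn_inj (fun i => (J i).2) hI h1
    have e2 : ∀ i, row k (I i) = code (vec ⟨k, hk⟩ (J i)) := fun i => by
      rw [← congrFun e1 i]; exact hrow ⟨k, hk⟩ (J i)
    have e3 := horner_ofFn_inj (fun i => (code (y i)).2) (fun i => by rw [e2]; exact Fin.is_lt _) h2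
    refine ⟨⟨k, hk⟩, funext fun i => code.injective (Fin.ext ?_)⟩
    rw [congrFun e3 i, e2]
    rfl
  · rintro ⟨k, rfl⟩
    refine ⟨k, k.2, fun i => J i, fun i => (J i).2, rfl, ?_⟩
    simp [tupleCode, hrow]

/-- The mask is the set of projections of the rows, and closure commutes with projection; a lookup
thus answers a question about vectors of full length. -/
theorem IsTable.inClosure_iff (hW : IsTable n m d r row W)
    (hrow : ∀ (k : Fin m) (j : Fin n), row k j = code (vec k j)) (J : Fin (r + 1) → Fin n)
    (y : Fin (r + 1) → D) :
    InClosure code F r (W (tupleAddr J)) (tupleCode code y) ↔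
      ∃ w, Cl F (Set.range vec) w ∧ w ∘ J = y := by
  have : {y' : Fin (r + 1) → D | (W (tupleAddr J)).testBit (tupleCode code y')} =
      (fun s : Fin n → D => s ∘ J) '' Set.range vec := by
    ext y'
    simp only [Set.mem_ofPred_eq, hW.testBit_iff code hrow, Set.mem_image, Set.exists_range_iff]
  rw [← Cl.comp_iff, InClosure, this]
  constructor
  · rintro ⟨y', h, hy⟩
    exact tupleCode_injective code h ▸ hy
  · exact fun h => ⟨y, rfl, h⟩

theorem IsTable.levelOk_iff (hW : IsTable n m d r row W)
    (hrow : ∀ (k : Fin m) (j : Fin n), row k j = code (vec k j)) {v : ℕ → ℕ} {x : Fin n → D}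
    {l : Fin n} (hv : ∀ i ≤ l, v i = code (x i)) :
    LevelOk n d r (InClosure code F r) W v l ↔ ∀ I : Fin r → Fin n, (∀ i, I i ≤ l) →
      ∃ w, Cl F (Set.range vec) w ∧ w l = x l ∧ ∀ i, w (I i) = x (I i) := by
  have key : ∀ I : Fin r → Fin n, (∀ i, I i ≤ l) →
      (InClosure code F r (W (horner n l (List.ofFn fun i => (I i : ℕ))))
        (horner d (v l) (List.ofFn fun i => v (I i))) ↔
      ∃ w, Cl F (Set.range vec) w ∧ w l = x l ∧ ∀ i, w (I i) = x (I i)) := by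
    intro I hI
    let J : Fin (r + 1) → Fin n := Fin.cons l I
    have h1 : horner n l (List.ofFn fun i => (I i : ℕ)) = tupleAddr J := by
      simp [tupleAddr, J, List.ofFn_succ, horner_cons]
    have h2 : horner d (v l) (List.ofFn fun i => v (I i)) = tupleCode code (x ∘ J) := by
      simp [tupleCode, J, List.ofFn_succ, horner_cons, hv l le_rfl, hv _ (hI _)]
    rw [h1, h2, hW.inClosure_iff code hrow]
    refine exists_congr fun w => and_congr_right fun _ => ?_
    simp [funext_iff, Fin.forall_fin_succ, J]
  constructor
  · exact fun h I hI => (key I hI).1 (h _ (mem_paths.2 ⟨fun i => I i,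
      fun i => Nat.lt_succ_of_le (Fin.le_def.1 (hI i)), rfl⟩))
  · rintro h p hp
    obtain ⟨I, hI, rfl⟩ := mem_paths.1 hp
    have hI' : ∀ i, I i ≤ l := fun i => Nat.le_of_lt_succ (hI i)
    exact (key (fun i => ⟨I i, (hI' i).trans_lt l.2⟩) (fun i => Fin.le_def.2 (hI' i))).2 (h _ fun i => hI' i)

variable {f : (Fin (r + 2) → D) → D}

theorem IsTable.forall_levelOk_iff (hW : IsTable n m d r row W)
    (hrow : ∀ (k : Fin m) (j : Fin n), row k j = code (vec k j)) (hf : InClone F (r + 2) f)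
    (hnu : IsNearUnanimity f) (hne : ∃ w, Cl F (Set.range vec) w) {v : ℕ → ℕ} {x : Fin n → D}
    (hv : ∀ i : Fin n, v i = code (x i)) :
    (∀ l < n, LevelOk n d r (InClosure code F r) W v l) ↔ Cl F (Set.range vec) x := by
  have h := Cl.exists_prefix_iff hf hnu hne x n
  have h1 : (∃ w, Cl F (Set.range vec) w ∧ ∀ i : Fin n, (i : ℕ) < n → w i = x i) ↔
      Cl F (Set.range vec) x :=
    ⟨fun ⟨w, hw, hx⟩ => (funext fun i => hx i i.2 : w = x) ▸ hw, fun hx => ⟨x, hx, fun _ _ => rfl⟩⟩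
  rw [← h1, h]
  constructor
  · exact fun hl l _ => (hW.levelOk_iff code hrow fun i _ => hv i).1 (hl l l.2)
  · exact fun hl l hln => (hW.levelOk_iff code hrow (l := ⟨l, hln⟩) fun i _ => hv i).2
      (hl ⟨l, hln⟩ hln)

/-- By Baker–Pixley an acceptable prefix is a prefix of some `w` in the closure. The next letter of
`w` is acceptable, with `w` itself as witness for every tuple. -/
theorem IsTable.extendable (hW : IsTable n m d r row W)
    (hrow : ∀ (k : Fin m) (j : Fin n), row k j = code (vec k j)) (hf : InClone F (r + 2) f)
    (hnu : IsNearUnanimity f) (hne : ∃ w, Cl F (Set.range vec) w) :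
    Extendable n d (LevelOk n d r (InClosure code F r) W) := by
  intro l hl v hpre
  obtain ⟨w₀, hw₀⟩ := id hne
  -- Only the letters of the prefix matter; `w₀` fills the positions that may hold no valid letter.
  let x : Fin n → D := fun i => if h : v i < d then code.symm ⟨v i, h⟩ else w₀ i
  have hx : ∀ i : Fin n, (i : ℕ) < l → v i = code (x i) := fun i hi => by
    simp [x, (hpre i hi).1]
  obtain ⟨w, hw, hwx⟩ := (Cl.exists_prefix_iff hf hnu hne x l).2 fun l' hl' =>
    (hW.levelOk_iff code hrow fun i hi => hx i ((Fin.le_def.1 hi).trans_lt hl')).1 (hpre l' hl').2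
  refine ⟨code (w ⟨l, hl⟩), Fin.is_lt _, ?_⟩
  refine (hW.levelOk_iff code hrow (l := ⟨l, hl⟩) (x := w) fun i hi => ?_).2 fun I _ =>
    ⟨w, hw, rfl, fun _ => rfl⟩
  rcases eq_or_ne i ⟨l, hl⟩ with rfl | hne
  · simp
  · have hil : (i : ℕ) < l := lt_of_le_of_ne (Fin.le_def.1 hi) fun h => hne (Fin.ext h)
    rw [Function.update_of_ne hil.ne, hx i hil, hwx i hil]

theorem IsTable.mem_extensions_iff (hW : IsTable n m d r row W)
    (hrow : ∀ (k : Fin m) (j : Fin n), row k j = code (vec k j)) (hf : InClone F (r + 2) f)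
    (hnu : IsNearUnanimity f) (hne : ∃ w, Cl F (Set.range vec) w) (v : ℕ → ℕ) (u : List ℕ) :
    u ∈ extensions n d (LevelOk n d r (InClosure code F r) W) n 0 v ↔
      ∃ x, Cl F (Set.range vec) x ∧ encodeVector code x = u := by
  have hword : ∀ (y : ℕ → ℕ) (x : Fin n → D), (∀ i : Fin n, y i = code (x i)) →
      (List.range n).map y = encodeVector code x := fun y x h =>
    List.ext_getElem (by simp [encodeVector]) fun i hi _ => by
      have hi' : i < n := by simpa using hi
      simpa [encodeVector] using h ⟨i, hi'⟩
  rw [mem_extensions (levelOk_isLocal _ _ _ _ _) (by omega)]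
  constructor
  · rintro ⟨y, -, hy, rfl⟩
    let x : Fin n → D := fun i => code.symm ⟨y i, (hy i i.2 (Nat.zero_le _)).1⟩
    have hx : ∀ i : Fin n, y i = code (x i) := fun i => by simp [x]
    exact ⟨x, (hW.forall_levelOk_iff code hrow hf hnu hne hx).1
      fun l hl => (hy l hl (Nat.zero_le _)).2, (hword y x hx).symm⟩
  · rintro ⟨x, hx, rfl⟩
    let y : ℕ → ℕ := fun i => if h : i < n then code (x ⟨i, h⟩) else 0
    have hy : ∀ i : Fin n, y i = code (x i) := fun i => by simp [y]
    exact ⟨y, by omega, fun i hi _ => ⟨by rw [hy ⟨i, hi⟩]; exact Fin.is_lt _,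
      (hW.forall_levelOk_iff code hrow hf hnu hne hy).2 hx i hi⟩, hword y x hy⟩

end


/-! ### Time bounds -/

/-- Adding `46 = 38 + 8` absorbs the constants of the affine recursion and makes the growth
geometric, with ratio `2 * (n + 1)`. -/
theorem nestTime_le (n t j : ℕ) : nestTime n t j + 46 ≤ (t + 46) * 2 ^ j * (n + 1) ^ j := by
  induction j with
  | zero => simp [nestTime]
  | succ j ih =>
    have h : nestTime n t (j + 1) + 46 ≤ (nestTime n t j + 46) * (2 * (n + 1)) := by
      rw [nestTime]
      nlinarith [Nat.zero_le (n * nestTime n t j), Nat.zero_le (nestTime n t j)]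
    calc _ ≤ _ := h
      _ ≤ (t + 46) * 2 ^ j * (n + 1) ^ j * (2 * (n + 1)) := Nat.mul_le_mul_right _ ih
      _ = _ := by ring

theorem exists_scanTime_le (d r : ℕ) : ∃ K, ∀ n, scanTime n d r ≤ K * (n + 1) ^ r ∧
    checkTime n d r ≤ K * (n + 1) ^ r := by
  set C := (markTime (d ^ (r + 1)) + 46) * 2 ^ r with hC
  refine ⟨d * (C + 28) + 14 + C, fun n => ?_⟩
  have h1 : checkTime n d r ≤ C * (n + 1) ^ r := by
    have := nestTime_le n (markTime (d ^ (r + 1))) r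
    rw [checkTime]
    rw [← hC] at this
    omega
  have hX : 1 ≤ (n + 1) ^ r := Nat.one_le_pow _ _ (Nat.succ_pos _)
  refine ⟨?_, h1.trans (Nat.mul_le_mul_right _ (by omega))⟩
  rw [scanTime]
  generalize (n + 1) ^ r = X at *
  have h2 : d * (6 + (checkTime n d r + 20) + 2) ≤ d * (C * X + 28 * X) :=
    Nat.mul_le_mul_left _ (by omega)
  calc _ ≤ d * (C * X + 28 * X) + 14 * X := by omega
    _ ≤ d * (C * X + 28 * X) + 14 * X + C * X := Nat.le_add_right _ _
    _ = _ := by ring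

/-- The time between two outputs. -/
theorem exists_cycleTime_le (d r : ℕ) : ∃ K, ∀ n,
    upTime n d r + (downTime n d r + writeTime n) + 2 ≤ K * (n + 1) ^ (r + 1) := by
  obtain ⟨K, hK⟩ := exists_scanTime_le d r
  refine ⟨2 * K + 200, fun n => ?_⟩
  have h := (hK n).1
  have hX : 1 ≤ (n + 1) ^ r := Nat.one_le_pow _ _ (Nat.succ_pos _)
  rw [upTime, downTime, writeTime, pow_succ]
  generalize (n + 1) ^ r = X at *
  have h1 : n * scanTime n d r ≤ n * (K * X) := Nat.mul_le_mul_left _ h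
  have h2 : n ≤ n * X := Nat.le_mul_of_pos_right _ hX
  calc _ = 2 * (n * scanTime n d r) + 98 * n + 50 := by ring
    _ ≤ 2 * (n * (K * X)) + 98 * (n * X) + 50 * X := by omega
    _ ≤ 2 * (n * (K * X)) + 98 * (n * X) + 50 * X + (2 * K * X + 102 * (n * X) + 150 * X) :=
      Nat.le_add_right _ _
    _ = _ := by ring

theorem exists_precomputeTime_le (d r : ℕ) : ∃ K, ∀ n m,
    precomputeTime n m d r ≤ K * ((n + 1) ^ (r + 1) * (m + 1)) := by
  set C := (markTime (d ^ (r + 1)) + 46) * 2 ^ (r + 1) with hC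
  refine ⟨C + 60, fun n m => ?_⟩
  have h1 : markAllTime n d r ≤ C * (n + 1) ^ (r + 1) := by
    have := nestTime_le n (markTime (d ^ (r + 1))) (r + 1)
    rw [markAllTime]
    rw [← hC] at this
    omega
  have hX : n + 1 ≤ (n + 1) ^ (r + 1) := Nat.le_self_pow (by omega) _
  rw [precomputeTime]
  generalize (n + 1) ^ (r + 1) = X at *
  have h2 : m * (n * 26 + 8 + (6 + markAllTime n d r) + 8) ≤ m * (C * X + 26 * X) :=
    Nat.mul_le_mul_left _ (by omega)
  calc _ ≤ m * (C * X + 26 * X) + 8 * X := by omega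
    _ ≤ m * (C * X + 26 * X) + 8 * X + (34 * (m * X) + C * X + 52 * X) := Nat.le_add_right _ _
    _ = _ := by ring

/-- One polynomial bounds all the times and all the register contents. -/
theorem exists_polynomial (d r : ℕ) : ∃ q : Polynomial ℕ, ∀ n m B, B = q.eval ((n + 1) * (m + 1)) →
    Fits n d r B ∧ m ≤ B ∧ 2 + n + m * n ≤ B ∧ deciderTime n m d r ≤ B ∧
      30 + (precomputeTime n m d r + 12) + (downTime n d r + writeTime n + 1) ≤ B := by
  obtain ⟨K₁, h₁⟩ := exists_scanTime_le d r
  obtain ⟨K₂, h₂⟩ := exists_cycleTime_le d r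
  obtain ⟨K₃, h₃⟩ := exists_precomputeTime_le d r
  set U := d ^ (r + 1) with hU
  set K := K₁ + K₂ + K₃ + 2 ^ U * U + 2 ^ U + U + d + 200 with hK
  -- The times and addresses are at most a constant times `(n + 1) ^ (r + 1) * (m + 1)`, which the
  -- power `r + 2` of the size dominates.
  refine ⟨Polynomial.C K * Polynomial.X ^ (r + 2), fun n m B hB => ?_⟩
  have hB : K * ((n + 1) ^ (r + 1) * (m + 1)) ≤ B := by
    rw [hB]
    simp only [Polynomial.eval_mul, Polynomial.eval_C, Polynomial.eval_pow, Polynomial.eval_X]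
    refine Nat.mul_le_mul_left _ ?_
    rw [mul_pow]
    exact Nat.mul_le_mul (Nat.pow_le_pow_right (by omega) (by omega)) (Nat.le_self_pow (by omega) _)
  have hX : n + 1 ≤ (n + 1) ^ (r + 1) := Nat.le_self_pow (by omega) _
  have hn : n ^ (r + 1) ≤ (n + 1) ^ (r + 1) := Nat.pow_le_pow_left (by omega) _
  have h₁ : n * checkTime n d r ≤ K₁ * (n + 1) ^ (r + 1) := by
    calc n * checkTime n d r ≤ (n + 1) * (K₁ * (n + 1) ^ r) :=
          Nat.mul_le_mul (by omega) (h₁ n).2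
      _ = _ := by ring
  have h₂ := h₂ n
  have h₃ := h₃ n m
  generalize (n + 1) ^ (r + 1) = X at *
  set Z := X * (m + 1) with hZ
  have hXZ : X ≤ Z := Nat.le_mul_of_pos_right _ (by omega)
  have hmZ : m + 1 ≤ Z := Nat.le_mul_of_pos_left _ (by omega)
  have hnm : m * n ≤ Z := by
    rw [hZ, mul_comm]
    exact Nat.mul_le_mul (by omega) (by omega)
  have b₁ : K₁ * X ≤ K₁ * Z := Nat.mul_le_mul_left _ hXZ
  have b₂ : K₂ * X ≤ K₂ * Z := Nat.mul_le_mul_left _ hXZ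
  have hc : ∀ c, c ≤ c * Z := fun c => Nat.le_mul_of_pos_right _ (by omega)
  have c₁ := hc (2 ^ U * U)
  have c₂ := hc (2 ^ U)
  have c₃ := hc U
  have c₄ := hc d
  have hsum : K₁ * Z + K₂ * Z + K₃ * Z + 2 ^ U * U * Z + 2 ^ U * Z + U * Z + d * Z + 200 * Z ≤ B := by
    refine le_trans (le_of_eq ?_) hB
    rw [hK]
    ring
  refine ⟨⟨?_, ?_, ?_, ?_, ?_, ?_⟩, ?_, ?_, ?_, ?_⟩
  · show 2 ^ U * U ≤ B
    omega
  · show 2 ^ U ≤ B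
    omega
  · omega
  · show U ≤ B
    omega
  · omega
  · omega
  · omega
  · omega
  · have : deciderTime n m d r = precomputeTime n m d r + n * checkTime n d r + 46 * n + 76 := by
      rw [deciderTime]; ring
    omega
  · omega

/-! ### Inputs -/

theorem getD_flatten_ofFn {n m : ℕ} (g : Fin m → Fin n → ℕ) (k : Fin m) (j : Fin n) :
    (List.ofFn fun i => List.ofFn (g i)).flatten.getD (k * n + j) 0 = g k j := by
  induction m with
  | zero => exact k.elim0
  | succ m ih =>
    rw [List.ofFn_succ, List.flatten_cons]
    refine Fin.cases ?_ (fun k => ?_) k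
    · rw [List.getD_append _ _ _ _ (by simp)]
      simp
    · rw [List.getD_append_right _ _ _ _ (by simp [add_mul]; omega)]
      have : ((k.succ : Fin (m + 1)) : ℕ) * n + j - (List.ofFn (g 0)).length = k * n + j := by
        simp [add_mul]; omega
      rw [this]
      exact ih (fun i => g i.succ) k

section

variable {D : Type*} {d : ℕ} (code : D ≃ Fin d)

theorem VectorFamily.rowsAt_encode (S : VectorFamily D) (k : Fin S.m) (j : Fin S.n) :
    rowsAt (fun i => (S.encode code).getD i 0) 2 S.n k j = code (S.vec k j) := by
  have : 2 + k * S.n + j = k * S.n + j + 1 + 1 := by omega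
  simp only [rowsAt, VectorFamily.encode, this, List.getD_cons_succ]
  exact getD_flatten_ofFn (fun i j => (code (S.vec i j) : ℕ)) k j

theorem ClosureInstance.rowsAt_encode (x : ClosureInstance D) (k : Fin x.m) (j : Fin x.n) :
    rowsAt (fun i => (x.encode code).getD i 0) (2 + x.n) x.n k j = code (x.vec k j) := by
  have : 2 + x.n + k * x.n + j = x.n + (k * x.n + j) + 1 + 1 := by omega
  simp only [rowsAt, ClosureInstance.encode, this, List.getD_cons_succ]
  rw [List.getD_append_right _ _ _ _ (by simp [encodeVector])]
  simp only [encodeVector, List.length_ofFn, Nat.add_sub_cancel_left]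
  exact getD_flatten_ofFn (fun i j => (code (x.vec i j) : ℕ)) k j

theorem ClosureInstance.target_encode (x : ClosureInstance D) (j : Fin x.n) :
    (x.encode code).getD (2 + j) 0 = code (x.target j) := by
  have : 2 + (j : ℕ) = j + 1 + 1 := by omega
  simp only [ClosureInstance.encode, this, List.getD_cons_succ]
  rw [List.getD_append _ _ _ _ (by simp [encodeVector])]
  simp [encodeVector]

/-! ### The closure problems -/

variable {F : Set (Operation D)} {r : ℕ} {f : (Fin (r + 2) → D) → D}

open scoped Classical in
/-- Whether there is a nullary operation. -/
noncomputable def hasNullary (F : Set (Operation D)) : Bool := decide (∃ o ∈ F, o.1 = 0)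

theorem hasNullary_or_iff {n m : ℕ} (vec : Fin m → Fin n → D) :
    (hasNullary F = true ∨ 0 < m) ↔ ∃ w, Cl F (Set.range vec) w := by
  rw [Cl.nonempty_iff, or_comm, Set.range_nonempty_iff_nonempty, ← Fin.pos_iff_nonempty]
  simp [hasNullary]

theorem closureInP_of_nearUnanimity (hf : InClone F (r + 2) f) (hnu : IsNearUnanimity f) :
    ClosureInP code F := by
  obtain ⟨q, hq⟩ := exists_polynomial d r
  refine InP.of_exec (decider d r (InClosure code F r) (hasNullary F)) q fun x => ?_
  obtain ⟨hB, hm, hp, ht, -⟩ := hq x.n x.m _ rfl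
  have hrow := x.rowsAt_encode code
  obtain ⟨k, hk, s, he, W, hW, hs⟩ := Trip.decider (ok := InClosure code F r)
    (nul := hasNullary F) (inp := fun i => (x.encode code).getD i 0) hB hm rfl rfl
    (fun k hk j hj => by rw [hrow ⟨k, hk⟩ ⟨j, hj⟩]; exact Fin.is_lt _)
    (fun j hj => by
      have := x.target_encode code ⟨j, hj⟩
      simp only at this
      rw [this]; exact Fin.is_lt _) hp
  have key : ((hasNullary F = true ∨ 0 < x.m) ∧ ∀ l < x.n, LevelOk x.n d r (InClosure code F r) W
      (fun j => (x.encode code).getD (2 + j) 0) l) ↔ Cl F (Set.range x.vec) x.target := by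
    rw [hasNullary_or_iff x.vec]
    constructor
    · rintro ⟨hne, h⟩
      exact (hW.forall_levelOk_iff code hrow hf hnu hne (x.target_encode code)).1 h
    · exact fun h => ⟨⟨_, h⟩,
        (hW.forall_levelOk_iff code hrow hf hnu ⟨_, h⟩ (x.target_encode code)).2 h⟩
  rw [key] at hs
  refine ⟨_, s, he, by rw [List.length_replicate]; exact hk.trans ht, fun h => ?_, fun h => ?_⟩
  · exact (hs.resolve_right fun h' => h'.2 h).1
  · exact (hs.resolve_left fun h' => h h'.2).1

theorem enumClosureWithDelay_of_advance (hf : InClone F (r + 2) f) (hnu : IsNearUnanimity f)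
    {adv : Cmd} {t δ : ℕ → ℕ}
    (hadv : ∀ (inp : ℕ → ℕ) (n m B : ℕ) (row : ℕ → ℕ → ℕ) (W : ℕ → ℕ) (s : Store), Fits n d r B →
      IsTable n m d r row W → s.sc .dim = n → s.W = W →
      IsPrefix d (LevelOk n d r (InClosure code F r) W) n s.V → Trip inp B adv (t n) s
        (Advanced n d r (InClosure code F r) W
          (after n d (LevelOk n d r (InClosure code F r) W) n s.V)))
    (hδ : ∀ n, t n + 2 ≤ δ n)
    (hδ' : d ≤ 1 ∨ ∀ n, t n + 1 + (downTime n d r + writeTime n + 1) ≤ δ n) :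
    EnumClosureWithDelay code F (fun n => δ n + 1) := by
  obtain ⟨q, hq⟩ := exists_polynomial d r
  refine EnumerableWithDelay.of_exec (δ := fun S : VectorFamily D => δ S.n)
    (enumerator d r (InClosure code F r) (hasNullary F) adv) q fun S => ?_
  obtain ⟨hB, hm, hp, -, ht⟩ := hq S.n S.m _ rfl
  have hrow := S.rowsAt_encode code
  obtain ⟨W, v, τ, s, hW, he, hD⟩ := Exec.enumerator (ok := InClosure code F r) (t := t S.n)
    (δ := δ S.n) (nul := hasNullary F) (inp := fun i => (S.encode code).getD i 0) hB hm rfl rfl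
    (fun k hk j hj => by rw [hrow ⟨k, hk⟩ ⟨j, hj⟩]; exact Fin.is_lt _) (by omega)
    (fun W hW h => hW.extendable code hrow hf hnu ((hasNullary_or_iff S.vec).1 h))
    (fun W s hW h1 h2 h3 => hadv _ _ _ _ _ W s hB hW h1 h2 h3) (hδ _)
    (hδ'.imp_right fun h => h _)
  refine ⟨τ, s, _, he, hD.mono ht, ?_, fun u => ?_⟩
  · split_ifs
    · exact nodup_extensions (levelOk_isLocal _ _ _ _ _) (by omega)
    · exact List.nodup_nil
  · split_ifs with h
    · exact hW.mem_extensions_iff code hrow hf hnu ((hasNullary_or_iff S.vec).1 h) v u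
    · refine iff_of_false (by simp) ?_
      rintro ⟨w, hw, -⟩
      exact h ((hasNullary_or_iff S.vec).2 ⟨w, hw⟩)

theorem enumClosureWithDelay_of_nearUnanimity (hf : InClone F (r + 2) f)
    (hnu : IsNearUnanimity f) : ∃ K, EnumClosureWithDelay code F (fun n => K * (n + 1) ^ (r + 1)) := by
  obtain ⟨K, hK⟩ := exists_cycleTime_le d r
  refine ⟨K + 1, ?_⟩
  have h1 : ∀ n, 1 ≤ (n + 1) ^ (r + 1) := fun n => Nat.one_le_pow _ _ (Nat.succ_pos _)
  have h2 : ∀ n, (K + 1) * (n + 1) ^ (r + 1) = K * (n + 1) ^ (r + 1) + (n + 1) ^ (r + 1) :=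
    fun n => by ring
  have := enumClosureWithDelay_of_advance code hf hnu (adv := up d r (InClosure code F r))
    -- The subtracted `1` makes up for the output step that is added when silent steps are turned
    -- into a delay.
    (t := fun n => upTime n d r) (δ := fun n => (K + 1) * (n + 1) ^ (r + 1) - 1)
    (fun inp n m B row W s hB hW hdim hsW hpre => Trip.up hB hW.lt hdim hsW hpre)
    (fun n => by have := hK n; have := h1 n; have := h2 n; simp only [downTime, writeTime] at *; omega)
    (Or.inr fun n => by have := hK n; have := h1 n; have := h2 n; omega)
  refine cast (congrArg _ (funext fun n => ?_)) this
  have := h1 n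
  have := h2 n
  omega

/-- With at most one letter there is no larger letter to try at any level. -/
theorem after_eq_nil {n : ℕ} {P : (ℕ → ℕ) → ℕ → Prop} (hd : d ≤ 1) (l : ℕ) (v : ℕ → ℕ) :
    after n d P l v = [] := by
  induction l with
  | zero => rfl
  | succ l ih => rw [after, ih, branches_eq_nil (by omega), List.append_nil]

/-- If there is at most one letter, the program may stop right after its first output. -/
theorem enumClosureWithDelay_of_le_one (hd : d ≤ 1) (hf : InClone F (r + 2) f)
    (hnu : IsNearUnanimity f) : EnumClosureWithDelay code F (fun _ => 9) := by
  refine enumClosureWithDelay_of_advance code hf hnu (adv := .prim (.const .found 0))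
    (t := fun _ => 6) (δ := fun _ => 8) (fun inp n m B row W s hB hW hdim hsW hpre => ?_)
    (fun _ => le_rfl) (Or.inl hd)
  exact Trip.prim (p := .const .found 0) (Nat.zero_le _)
    (Or.inl ⟨by simp [Prim.exec], after_eq_nil hd _ _⟩)

end

/-! ### Small arities and the main theorem -/

/-- With at most one argument, at most one entry can deviate from any given element, so the same
value of `f` equals every element of `D`. -/
theorem IsNearUnanimity.subsingleton {D : Type*} {k : ℕ} {f : (Fin k → D) → D}
    (hnu : IsNearUnanimity f) (hk : k ≤ 1) : Subsingleton D := by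
  have : Subsingleton (Fin k) := Fin.subsingleton_iff_le_one.2 hk
  refine ⟨fun a b => ?_⟩
  rw [← hnu a (fun _ => a) (Set.subsingleton_of_subsingleton),
    hnu b (fun _ => a) (Set.subsingleton_of_subsingleton)]

theorem mainTheorem11 {D : Type*} [Fintype D] (code : D ≃ Fin (Fintype.card D))
    (F : Set (Operation D)) (k : ℕ) (f : (Fin k → D) → D)
    (hf : (⟨k, f⟩ : Operation D) ∈ cloneOf F) (hnu : IsNearUnanimity f) :
    ClosureInP code F ∧
    ∃ δ : ℕ → ℕ,
      (fun n => (δ n : ℝ)) =O[Filter.atTop] (fun n : ℕ => (n : ℝ) ^ (k - 1)) ∧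
      EnumClosureWithDelay code F δ := by
  by_cases hd : Fintype.card D ≤ 1
  · have : Subsingleton D := Fintype.card_le_one_iff_subsingleton.1 hd
    -- On at most one element a binary projection is a near unanimity operation, so the construction
    -- applies with `r = 0` even when the given `k` is `0` or `1`.
    have hf' : InClone F (0 + 2) fun x : Fin 2 → D => x 0 := .proj 0
    have hnu' : IsNearUnanimity fun x : Fin 2 → D => x 0 := fun _ _ _ => Subsingleton.elim _ _
    refine ⟨closureInP_of_nearUnanimity code hf' hnu', fun _ => 9, ?_,
      enumClosureWithDelay_of_le_one code hd hf' hnu'⟩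
    refine Asymptotics.IsBigO.of_bound 9 ?_
    filter_upwards [Filter.eventually_ge_atTop 1] with n hn
    have h1 : (1 : ℝ) ≤ (n : ℝ) ^ (k - 1) := one_le_pow₀ (by exact_mod_cast hn)
    rw [Real.norm_of_nonneg (by positivity), Real.norm_of_nonneg (by positivity)]
    push_cast
    linarith
  · obtain ⟨r, rfl⟩ : ∃ r, k = r + 2 := by
      refine Nat.exists_eq_add_of_le' (Nat.lt_of_not_le fun hk => hd ?_)
      exact Fintype.card_le_one_iff_subsingleton.2 (hnu.subsingleton hk)
    obtain ⟨K, hK⟩ := enumClosureWithDelay_of_nearUnanimity code hf hnu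
    refine ⟨closureInP_of_nearUnanimity code hf hnu, _, ?_, hK⟩
    -- The factor `2 ^ (r + 1)` comes from `n + 1 ≤ 2 * n` for `n ≥ 1`.
    refine Asymptotics.IsBigO.of_bound (K * 2 ^ (r + 1)) ?_
    filter_upwards [Filter.eventually_ge_atTop 1] with n hn
    have h1 : ((n : ℝ) + 1) ^ (r + 1) ≤ (2 * n) ^ (r + 1) := by
      have : (1 : ℝ) ≤ n := by exact_mod_cast hn
      gcongr
      linarith
    rw [Real.norm_of_nonneg (by positivity), Real.norm_of_nonneg (by positivity)]
    push_cast
    calc (K : ℝ) * (n + 1) ^ (r + 1) ≤ K * (2 * n) ^ (r + 1) := by gcongr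
      _ = _ := by rw [mul_pow, mul_assoc]
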